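/- A dyadic interval is an interval $[j2^k,(j+1)2^k)\subset\mathbb R$ with $j,k\in\mathbb Z$; its ($L^\infty$-normalized) Haar function is $h_I=-\mathbf 1_{I_{\mathrm{left}}}+\mathbf 1_{I_{\mathrm{right}}}$, where $I_{\mathrm{left}},I_{\mathrm{right}}$ are the left and right halves of $I$. A dyadic rectangle in $\mathbb R^3$ is a product $R=R_1\times R_2\times R_3$ of dyadic intervals, $|R|$ is its volume, and $h_R(x_1,x_2,x_3)=h_{R_1}(x_1)h_{R_2}(x_2)h_{R_3}(x_3)$. **Theorem.** There are absolute constants $\epsilon>0$ and $K>0$ such that for every integer $n\ge 1$ and all real coefficients $\alpha_R$, indexed by the dyadic rectangles $R\subset[0,1]^3$ with $|R|=2^{-n}$, $$2^{-n}\sum_{|R|=2^{-n}}|\alpha_R|\;\le\;K\,n^{1-\epsilon}\,\Bigl\|\sum_{|R|=2^{-n}}\alpha_R h_R\Bigr\|_{L^\infty},$$ where both sums run over the dyadic rectangles $R\subset[0,1]^3$ with $|R|=2^{-n}$. -/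

import Mathlib

open scoped ENNReal

noncomputable section

/-- The dyadic interval `[j 2^k, (j+1) 2^k)`, recorded by the integers `k` and `j`,
which the interval determines. -/
@[ext]
structure DyadicInterval where
  /-- The exponent `k` of the length `2^k`. -/
  scale : ℤ
  /-- The position `j`. -/
  pos : ℤ

namespace DyadicInterval

/-- The length `2^k`. -/
def length (I : DyadicInterval) : ℝ := (2 : ℝ) ^ I.scale

/-- The set of points `[j 2^k, (j+1) 2^k)`. -/
def toSet (I : DyadicInterval) : Set ℝ :=
  Set.Ico ((I.pos : ℝ) * (2 : ℝ) ^ I.scale) (((I.pos : ℝ) + 1) * (2 : ℝ) ^ I.scale)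

/-- The left half `[2j 2^(k-1), (2j+1) 2^(k-1))`. -/
def left (I : DyadicInterval) : DyadicInterval := ⟨I.scale - 1, 2 * I.pos⟩

/-- The right half `[(2j+1) 2^(k-1), (2j+2) 2^(k-1))`. -/
def right (I : DyadicInterval) : DyadicInterval := ⟨I.scale - 1, 2 * I.pos + 1⟩

/-- The Haar function `-1` on the left half, `+1` on the right half, `0` elsewhere. -/
def haar (I : DyadicInterval) (x : ℝ) : ℝ :=
  -(I.left.toSet.indicator 1 x) + I.right.toSet.indicator 1 x

end DyadicInterval

/-- A dyadic rectangle in `ℝ^d`: a product of `d` dyadic intervals, its sides. -/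
abbrev DyadicRectangle (d : ℕ) : Type := Fin d → DyadicInterval

namespace DyadicRectangle

variable {d : ℕ}

/-- The set of points of the rectangle. -/
def toSet (R : DyadicRectangle d) : Set (Fin d → ℝ) := Set.univ.pi fun i => (R i).toSet

/-- The volume `|R|`, the product of the side lengths. -/
def vol (R : DyadicRectangle d) : ℝ := ∏ i, (R i).length

/-- The tensor product Haar function, normalized in `L^∞`. -/
def haar (R : DyadicRectangle d) (x : Fin d → ℝ) : ℝ := ∏ i, (R i).haar (x i)

/-- The dyadic rectangles of volume `2^(-n)` in the unit cube `[0,1]^d`. -/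
def hyperbolicSet (d n : ℕ) : Set (DyadicRectangle d) :=
  {R | R.toSet ⊆ Set.Icc 0 1 ∧ R.vol = (2 : ℝ) ^ (-(n : ℤ))}

theorem side_bounds {I : DyadicInterval} (h : I.toSet ⊆ Set.Icc 0 1) :
    0 ≤ I.pos ∧ ((I.pos : ℝ) + 1) * (2 : ℝ) ^ I.scale ≤ 1 := by
  have hp : (0 : ℝ) < (2 : ℝ) ^ I.scale := by positivity
  have hlt : (I.pos : ℝ) * (2 : ℝ) ^ I.scale < ((I.pos : ℝ) + 1) * (2 : ℝ) ^ I.scale := by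
    nlinarith
  have h2 := closure_mono h
  rw [DyadicInterval.toSet, closure_Ico hlt.ne, isClosed_Icc.closure_eq,
    Set.Icc_subset_Icc_iff hlt.le] at h2
  refine ⟨?_, h2.2⟩
  have : (0 : ℝ) ≤ (I.pos : ℝ) := nonneg_of_mul_nonneg_left h2.1 hp
  exact_mod_cast this

theorem hyperbolicSet_finite (d n : ℕ) : (hyperbolicSet d n).Finite := by
  have key : ∀ R ∈ hyperbolicSet d n, ∀ i, R i ∈
      (fun p : ℤ × ℤ => DyadicInterval.mk p.1 p.2) ''
        (Set.Icc (-(n : ℤ)) 0 ×ˢ Set.Icc 0 ((2 : ℤ) ^ n)) := by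
    rintro R ⟨hR, hv⟩
    have hne : ∀ i, ((R i).toSet).Nonempty := fun i => by
      refine Set.nonempty_Ico.2 ?_
      have hp : (0 : ℝ) < (2 : ℝ) ^ (R i).scale := by positivity
      nlinarith
    have hside : ∀ i, (R i).toSet ⊆ Set.Icc 0 1 := by
      intro i x hx
      choose y hy using hne
      have := hR (show Function.update y i x ∈ toSet R by
        intro k _
        by_cases hk : k = i
        · subst hk; simpa using hx
        · simpa [hk] using hy k)
      have h0 := this.1 i
      have h1 := this.2 i
      simp only [Function.update_self, Pi.zero_apply, Pi.one_apply] at h0 h1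
      exact ⟨h0, h1⟩
    have hk0 : ∀ i, (R i).scale ≤ 0 := by
      intro i
      obtain ⟨hj, hb⟩ := side_bounds (hside i)
      have hj' : (0 : ℝ) ≤ ((R i).pos : ℝ) := by exact_mod_cast hj
      have hp : (0 : ℝ) < (2 : ℝ) ^ (R i).scale := by positivity
      have : (2 : ℝ) ^ (R i).scale ≤ (2 : ℝ) ^ (0 : ℤ) := by
        rw [zpow_zero]; nlinarith
      exact (zpow_le_zpow_iff_right₀ (by norm_num)).1 this
    have hk1 : ∀ i, -(n : ℤ) ≤ (R i).scale := by
      intro i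
      have hle : (2 : ℝ) ^ (-(n : ℤ)) ≤ (2 : ℝ) ^ (R i).scale := by
        rw [← hv, vol, ← Finset.mul_prod_erase Finset.univ _ (Finset.mem_univ i)]
        refine mul_le_of_le_one_right (zpow_nonneg (by norm_num) _) ?_
        refine Finset.prod_le_one (fun k _ => zpow_nonneg (by norm_num) _) fun k _ => ?_
        exact zpow_le_one_of_nonpos₀ (by norm_num) (hk0 k)
      exact (zpow_le_zpow_iff_right₀ (by norm_num)).1 hle
    intro i
    obtain ⟨hj, hb⟩ := side_bounds (hside i)
    refine ⟨((R i).scale, (R i).pos), ⟨⟨hk1 i, hk0 i⟩, hj, ?_⟩, rfl⟩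
    have hj' : (0 : ℝ) ≤ ((R i).pos : ℝ) := by exact_mod_cast hj
    have hle : (2 : ℝ) ^ (-(n : ℤ)) ≤ (2 : ℝ) ^ (R i).scale :=
      (zpow_le_zpow_iff_right₀ (by norm_num)).2 (hk1 i)
    have h3 : ((R i).pos : ℝ) * (2 : ℝ) ^ (-(n : ℤ)) ≤ 1 := by
      have hp : (0 : ℝ) < (2 : ℝ) ^ (R i).scale := by positivity
      nlinarith
    rw [zpow_neg, zpow_natCast, ← div_eq_mul_inv, div_le_one (by positivity)] at h3
    exact_mod_cast h3
  refine (Set.Finite.pi' (fun _ : Fin d => ?_)).subset key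
  exact ((Set.finite_Icc _ _).prod (Set.finite_Icc _ _)).image _

/-- The finite set of dyadic rectangles of volume `2^(-n)` in the unit cube `[0,1]^d`. -/
def hyperbolic (d n : ℕ) : Finset (DyadicRectangle d) := (hyperbolicSet_finite d n).toFinset

end DyadicRectangle

/-- The hyperbolic Haar sum `∑_{|R| = 2^(-n)} α_R h_R`. -/
def hyperbolicHaarSum {d : ℕ} (n : ℕ) (α : DyadicRectangle d → ℝ) (x : Fin d → ℝ) : ℝ :=
  ∑ R ∈ DyadicRectangle.hyperbolic d n, α R * R.haar x

end

open scoped BigOperators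

/-!
Sort the rectangles by their scale `r`, so that `∑ i, r i = n`. In terms of the binary digits of
the coordinates, the part `H r` of the sum with scale `r` is odd under the flip of the digit `r i`
of coordinate `i` and invariant under the flips of later digits; so is the function `f r` with
values `±1` which has the signs of the `α R` as its coefficients, and `f r * H r = |H r|`.

Cut the range of the first coordinate of `r` into `q` blocks and expand the Riesz product
`∏ w, (1 + ρ * ∑ r in block w, f r)`. If the maxima over the blocks of the second and of the third
coordinate are each attained only once, then a product of `f`s with distinct first coordinates is
again of a definite scale, and it is orthogonal to all `H r` unless it is a single `f r`. Testing
`∑ r, H r` against the part of the Riesz product with unrepeated maxima thus bounds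
`ρ * ∑ r, 𝔼 |H r|`, the left side of the theorem up to the factor `ρ`, by the supremum norm times
the `L¹` norm of that part. That norm has to stay bounded for a `ρ` which is larger than `1 / n` by
a small power of `n`.

A block contains about `n ^ 2 / q` scales, so that the sum over it is mostly of order `n / √q`. For
`ρ` small compared with `√q / n` the Riesz product is therefore rarely negative; since its mean is
`1`, its `L¹` norm is at most `2`. By inclusion–exclusion it remains to bound the terms with
repeated maxima. A coincidence of the second coordinates of two scales leaves one free parameter
less, and the sum of the products `f r * f s` over all coincidences is smaller still, because a
square function estimate in two parameters applies to it; this is the gain observed by Beck.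
-/

section PowerInequalities

theorem sub_mul_pow_sub_pow_nonneg {x y : ℝ} (hx : 0 ≤ x) (hy : 0 ≤ y) (m : ℕ) :
    0 ≤ (x - y) * (x ^ m - y ^ m) := by
  rcases le_total x y with h | h
  · exact mul_nonneg_of_nonpos_of_nonpos (sub_nonpos.2 h)
      (sub_nonpos.2 (pow_le_pow_left₀ hx h m))
  · exact mul_nonneg (sub_nonneg.2 h) (sub_nonneg.2 (pow_le_pow_left₀ hy h m))

theorem add_mul_pow_add_pow_le {x y : ℝ} (hx : 0 ≤ x) (hy : 0 ≤ y) (m : ℕ) :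
    (x + y) * (x ^ m + y ^ m) ≤ 2 * (x ^ (m + 1) + y ^ (m + 1)) := by
  linear_combination sub_mul_pow_sub_pow_nonneg hx hy m

theorem sub_mul_pow_sub_pow_le {x y : ℝ} (hx : 0 ≤ x) (hy : 0 ≤ y) (m : ℕ) :
    2 * ((x - y) * (x ^ (m + 1) - y ^ (m + 1))) ≤
      (m + 1) * ((x - y) ^ 2 * (x ^ m + y ^ m)) := by
  induction m with
  | zero => simp; nlinarith
  | succ m ih =>
    push_cast
    calc 2 * ((x - y) * (x ^ (m + 2) - y ^ (m + 2)))
        = (x + y) * ((x - y) * (x ^ (m + 1) - y ^ (m + 1))) +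
            (x - y) ^ 2 * (x ^ (m + 1) + y ^ (m + 1)) := by ring
      _ ≤ (x + y) * ((m + 1) * ((x - y) ^ 2 * (x ^ m + y ^ m)) / 2) +
            (x - y) ^ 2 * (x ^ (m + 1) + y ^ (m + 1)) := by gcongr; linarith
      _ = (m + 1) * (x - y) ^ 2 / 2 * ((x + y) * (x ^ m + y ^ m)) +
            (x - y) ^ 2 * (x ^ (m + 1) + y ^ (m + 1)) := by ring
      _ ≤ (m + 1) * (x - y) ^ 2 / 2 * (2 * (x ^ (m + 1) + y ^ (m + 1))) +
            (x - y) ^ 2 * (x ^ (m + 1) + y ^ (m + 1)) := by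
          exact add_le_add_left (mul_le_mul_of_nonneg_left (add_mul_pow_add_pow_le hx hy m)
            (by positivity)) _
      _ = _ := by ring

theorem pow_add_pow_le_of_sub_sq_le {x y a e : ℝ} (hx : 0 ≤ x) (hy : 0 ≤ y) (ha : 0 ≤ a)
    (he : 0 ≤ e) (hs : x + y = 2 * (a + e)) (hd : (x - y) ^ 2 ≤ 16 * (a * e)) (m : ℕ) :
    x ^ (m + 1) + y ^ (m + 1) ≤
      2 * a ^ (m + 1) + 2 * ((m : ℝ) + 1) ^ 2 * (e * (x ^ m + y ^ m)) := by
  induction m with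
  | zero => simp; nlinarith
  | succ m ih =>
    set p := x ^ m + y ^ m
    set p' := x ^ (m + 1) + y ^ (m + 1)
    have hp' : 0 ≤ e * p' := by positivity
    have h_mean : a * p ≤ p' := by
      have : (x + y) * p ≤ 2 * p' := add_mul_pow_add_pow_le hx hy m
      have : 0 ≤ e * p := by positivity
      rw [hs] at *
      linarith
    have h_diff : (x - y) * (x ^ (m + 1) - y ^ (m + 1)) / 2 ≤ 4 * (m + 1) * (e * p') := by
      calc (x - y) * (x ^ (m + 1) - y ^ (m + 1)) / 2
          ≤ (m + 1) * ((x - y) ^ 2 * p) / 4 := by linarith [sub_mul_pow_sub_pow_le hx hy m]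
        _ ≤ (m + 1) * (16 * (a * e) * p) / 4 := by gcongr
        _ = 4 * (m + 1) * (e * (a * p)) := by ring
        _ ≤ 4 * (m + 1) * (e * p') := by gcongr
    calc x ^ (m + 2) + y ^ (m + 2)
        = (a + e) * p' + (x - y) * (x ^ (m + 1) - y ^ (m + 1)) / 2 := by
          rw [show a + e = (x + y) / 2 by linarith]; ring
      _ ≤ a * p' + e * p' + 4 * (m + 1) * (e * p') := by linarith
      _ ≤ a * (2 * a ^ (m + 1) + 2 * ((m : ℝ) + 1) ^ 2 * (e * p)) + e * p' +
            4 * (m + 1) * (e * p') := by gcongr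
      _ = 2 * a ^ (m + 2) + 2 * ((m : ℝ) + 1) ^ 2 * (e * (a * p)) + e * p' +
            4 * (m + 1) * (e * p') := by ring
      _ ≤ 2 * a ^ (m + 2) + 2 * ((m : ℝ) + 1) ^ 2 * (e * p') + e * p' +
            4 * (m + 1) * (e * p') := by gcongr
      _ ≤ _ := by push_cast; nlinarith

theorem two_mul_pow_le_pow_add_pow {x y a : ℝ} (hx : 0 ≤ x) (hy : 0 ≤ y) (ha : 0 ≤ a)
    (h : 2 * a ≤ x + y) (m : ℕ) : 2 * a ^ m ≤ x ^ m + y ^ m := by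
  rcases m with _ | m
  · norm_num
  have key : 2 ^ m * (2 * a ^ (m + 1)) ≤ 2 ^ m * (x ^ (m + 1) + y ^ (m + 1)) :=
    calc 2 ^ m * (2 * a ^ (m + 1)) = (2 * a) ^ (m + 1) := by ring
      _ ≤ (x + y) ^ (m + 1) := by gcongr
      _ ≤ 2 ^ m * (x ^ (m + 1) + y ^ (m + 1)) := add_pow_le hx hy (m + 1)
  exact le_of_mul_le_mul_left key (by positivity)

theorem add_one_mul_mul_pow_le {a b : ℝ} (ha : 0 ≤ a) (hb : 0 ≤ b) (m : ℕ) :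
    ((m : ℝ) + 1) * (a * b ^ m) ≤ a ^ (m + 1) + m * b ^ (m + 1) := by
  induction m with
  | zero => simp
  | succ m ih =>
    have h : 0 ≤ ((m : ℝ) + 1) * b ^ m * (a - b) ^ 2 := by positivity
    push_cast
    linear_combination a * ih + h

end PowerInequalities

section HaarMartingales

variable {Ω ι κ : Type*}

/-- `g` behaves like a one-parameter Haar function on the dyadic intervals of length `2 ^ (-k)`:
with `T l` standing for the flip of the binary digit of index `l`, `g` changes sign with digit `k`
and ignores the finer digits. -/
structure IsHaarAt (T : ℕ → Equiv.Perm Ω) (k : ℕ) (g : Ω → ℝ) : Prop where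
  odd : ∀ ω, g (T k ω) = -g ω
  inv : ∀ l, k < l → ∀ ω, g (T l ω) = g ω

theorem IsHaarAt.sum {T : ℕ → Equiv.Perm Ω} {k : ℕ} {s : Finset ι} {d : ι → Ω → ℝ}
    (h : ∀ i ∈ s, IsHaarAt T k (d i)) : IsHaarAt T k fun ω => ∑ i ∈ s, d i ω where
  odd ω := by
    rw [← Finset.sum_neg_distrib]
    exact Finset.sum_congr rfl fun i hi => (h i hi).odd ω
  inv l hl ω := Finset.sum_congr rfl fun i hi => (h i hi).inv l hl ω

theorem IsHaarAt.mul_of_lt {T : ℕ → Equiv.Perm Ω} {k l : ℕ} {g h : Ω → ℝ} (hg : IsHaarAt T k g)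
    (hh : IsHaarAt T l h) (hkl : k < l) : IsHaarAt T l fun ω => g ω * h ω where
  odd ω := by rw [hg.inv l hkl, hh.odd, mul_neg]
  inv l' hl' ω := by rw [hg.inv l' (hkl.trans hl'), hh.inv l' hl']

theorem IsHaarAt.mul_of_ne {T : ℕ → Equiv.Perm Ω} {k l : ℕ} {g h : Ω → ℝ} (hg : IsHaarAt T k g)
    (hh : IsHaarAt T l h) (hkl : k ≠ l) : IsHaarAt T (max k l) fun ω => g ω * h ω := by
  rcases hkl.lt_or_gt with hlt | hlt
  · rw [max_eq_right hlt.le]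
    exact hg.mul_of_lt hh hlt
  · rw [max_eq_left hlt.le]
    simpa only [mul_comm] using hh.mul_of_lt hg hlt

theorem sum_add_sq_comp {T : Equiv.Perm Ω} {J : Finset κ} {F d : κ → Ω → ℝ}
    (hF : ∀ j ∈ J, ∀ ω, F j (T ω) = F j ω) (hd : ∀ j ∈ J, ∀ ω, d j (T ω) = -d j ω) (ω : Ω) :
    ∑ j ∈ J, (F j (T ω) + d j (T ω)) ^ 2 = ∑ j ∈ J, (F j ω - d j ω) ^ 2 :=
  Finset.sum_congr rfl fun j hj => by rw [hF j hj, hd j hj, sub_eq_add_neg]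

variable [Fintype Ω]

theorem expect_eq_zero_of_odd (T : Equiv.Perm Ω) {f : Ω → ℝ} (h : ∀ ω, f (T ω) = -f ω) :
    𝔼 ω, f ω = 0 := by
  have : 𝔼 ω, f ω = -𝔼 ω, f ω := by
    rw [← Finset.expect_neg_distrib]
    exact (Fintype.expect_equiv T _ _ fun ω => (h ω).symm).symm
  linarith

theorem expect_eq_expect_symmetrize (T : Equiv.Perm Ω) (f : Ω → ℝ) :
    𝔼 ω, f ω = 𝔼 ω, (f ω + f (T ω)) / 2 := by
  rw [← Finset.expect_div, Finset.expect_add_distrib,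
    Fintype.expect_equiv T (fun ω => f (T ω)) f fun _ => rfl, add_self_div_two]

theorem expect_sum_add_sq_pow_le (T : Equiv.Perm Ω) (J : Finset κ) (F d : κ → Ω → ℝ)
    (hF : ∀ j ∈ J, ∀ ω, F j (T ω) = F j ω) (hd : ∀ j ∈ J, ∀ ω, d j (T ω) = -d j ω) (m : ℕ) :
    𝔼 ω, (∑ j ∈ J, (F j ω + d j ω) ^ 2) ^ (m + 1) ≤
      𝔼 ω, (∑ j ∈ J, F j ω ^ 2) ^ (m + 1) +
        2 * ((m : ℝ) + 1) ^ 2 *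
          𝔼 ω, (∑ j ∈ J, d j ω ^ 2) * (∑ j ∈ J, (F j ω + d j ω) ^ 2) ^ m := by
  rw [expect_eq_expect_symmetrize T,
    expect_eq_expect_symmetrize T fun ω => (∑ j ∈ J, d j ω ^ 2) * _, Finset.mul_expect,
    ← Finset.expect_add_distrib]
  refine Finset.expect_le_expect fun ω _ => ?_
  have h_energy : ∑ j ∈ J, d j (T ω) ^ 2 = ∑ j ∈ J, d j ω ^ 2 :=
    Finset.sum_congr rfl fun j hj => by rw [hd j hj, neg_sq]
  have h_sum : ∑ j ∈ J, (F j ω + d j ω) ^ 2 + ∑ j ∈ J, (F j ω - d j ω) ^ 2 =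
      2 * (∑ j ∈ J, F j ω ^ 2 + ∑ j ∈ J, d j ω ^ 2) := by
    rw [← Finset.sum_add_distrib, ← Finset.sum_add_distrib, Finset.mul_sum]
    exact Finset.sum_congr rfl fun j _ => by ring
  have h_diff : ∑ j ∈ J, (F j ω + d j ω) ^ 2 - ∑ j ∈ J, (F j ω - d j ω) ^ 2 =
      4 * ∑ j ∈ J, F j ω * d j ω := by
    rw [← Finset.sum_sub_distrib, Finset.mul_sum]
    exact Finset.sum_congr rfl fun j _ => by ring
  have h_cauchy := Finset.sum_mul_sq_le_sq_mul_sq J (fun j => F j ω) (fun j => d j ω)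
  have key := pow_add_pow_le_of_sub_sq_le (Finset.sum_nonneg fun _ _ => sq_nonneg _)
    (Finset.sum_nonneg fun _ _ => sq_nonneg _) (Finset.sum_nonneg fun _ _ => sq_nonneg _)
    (Finset.sum_nonneg fun _ _ => sq_nonneg _) h_sum (by rw [h_diff]; linarith) m
  rw [sum_add_sq_comp hF hd, h_energy]
  linarith

theorem expect_mul_sum_sq_pow_le (T : Equiv.Perm Ω) (J : Finset κ) (F d : κ → Ω → ℝ)
    (w : Ω → ℝ) (hF : ∀ j ∈ J, ∀ ω, F j (T ω) = F j ω) (hd : ∀ j ∈ J, ∀ ω, d j (T ω) = -d j ω)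
    (hw : ∀ ω, w (T ω) = w ω) (hw0 : ∀ ω, 0 ≤ w ω) (m : ℕ) :
    𝔼 ω, w ω * (∑ j ∈ J, F j ω ^ 2) ^ m ≤
      𝔼 ω, w ω * (∑ j ∈ J, (F j ω + d j ω) ^ 2) ^ m := by
  rw [expect_eq_expect_symmetrize T fun ω => w ω * (∑ j ∈ J, (F j ω + d j ω) ^ 2) ^ m]
  refine Finset.expect_le_expect fun ω _ => ?_
  have h_sum : 2 * ∑ j ∈ J, F j ω ^ 2 ≤
      ∑ j ∈ J, (F j ω + d j ω) ^ 2 + ∑ j ∈ J, (F j ω - d j ω) ^ 2 := by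
    rw [← Finset.sum_add_distrib, Finset.mul_sum]
    exact Finset.sum_le_sum fun j _ => by nlinarith [sq_nonneg (d j ω)]
  have h_convex := two_mul_pow_le_pow_add_pow (Finset.sum_nonneg fun _ _ => sq_nonneg _)
    (Finset.sum_nonneg fun _ _ => sq_nonneg _) (Finset.sum_nonneg fun _ _ => sq_nonneg _) h_sum m
  rw [sum_add_sq_comp hF hd, hw]
  linarith [mul_le_mul_of_nonneg_left h_convex (hw0 ω)]

theorem expect_sum_sq_pow_succ_le (T : ℕ → Equiv.Perm Ω) (s : Finset ι) (key : ι → ℕ)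
    (hinj : Set.InjOn key s) (J : Finset κ) (d : ι → κ → Ω → ℝ)
    (hd : ∀ i ∈ s, ∀ j ∈ J, IsHaarAt T (key i) (d i j)) (m : ℕ) :
    𝔼 ω, (∑ j ∈ J, (∑ i ∈ s, d i j ω) ^ 2) ^ (m + 1) ≤
      2 * ((m : ℝ) + 1) ^ 2 *
        𝔼 ω, (∑ i ∈ s, ∑ j ∈ J, d i j ω ^ 2) * (∑ j ∈ J, (∑ i ∈ s, d i j ω) ^ 2) ^ m := by
  classical
  induction s using Finset.induction_on_max_value key with
  | empty => simp
  | insert i s his hmax ih =>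
    have hlt : ∀ i' ∈ s, key i' < key i := fun i' hi' =>
      lt_of_le_of_ne (hmax i' hi') fun h => his <| by
        rw [← hinj (Finset.mem_insert_of_mem hi') (Finset.mem_insert_self i s) h]; exact hi'
    have h_inv : ∀ i' ∈ s, ∀ j ∈ J, ∀ ω, d i' j (T (key i) ω) = d i' j ω :=
      fun i' hi' j hj => (hd i' (Finset.mem_insert_of_mem hi') j hj).inv _ (hlt i' hi')
    have hF : ∀ j ∈ J, ∀ ω, ∑ i' ∈ s, d i' j (T (key i) ω) = ∑ i' ∈ s, d i' j ω :=
      fun j hj ω => Finset.sum_congr rfl fun i' hi' => h_inv i' hi' j hj ω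
    have h_odd : ∀ j ∈ J, ∀ ω, d i j (T (key i) ω) = -d i j ω :=
      fun j hj => (hd i (Finset.mem_insert_self i s) j hj).odd
    have h_last := expect_sum_add_sq_pow_le (T (key i)) J (fun j ω => ∑ i' ∈ s, d i' j ω)
      (d i) hF h_odd m
    have h_prev := ih (hinj.mono (by simp)) fun i' h => hd i' (Finset.mem_insert_of_mem h)
    have h_mono := expect_mul_sum_sq_pow_le (T (key i)) J (fun j ω => ∑ i' ∈ s, d i' j ω) (d i)
      (fun ω => ∑ i' ∈ s, ∑ j ∈ J, d i' j ω ^ 2) hF h_odd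
      (fun ω => Finset.sum_congr rfl fun i' hi' => Finset.sum_congr rfl fun j hj => by
        rw [h_inv i' hi' j hj])
      (fun ω => Finset.sum_nonneg fun _ _ => Finset.sum_nonneg fun _ _ => sq_nonneg _) m
    have h_insert : ∀ j ω, ∑ i' ∈ insert i s, d i' j ω = ∑ i' ∈ s, d i' j ω + d i j ω :=
      fun j ω => by rw [Finset.sum_insert his, add_comm]
    simp only [h_insert, Finset.sum_insert his, add_mul]
    rw [Finset.expect_add_distrib, mul_add]
    linarith [mul_le_mul_of_nonneg_left h_mono (by positivity : 0 ≤ 2 * ((m : ℝ) + 1) ^ 2)]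

theorem expect_sum_sq_pow_le (T : ℕ → Equiv.Perm Ω) (s : Finset ι) (key : ι → ℕ)
    (hinj : Set.InjOn key s) (J : Finset κ) (d : ι → κ → Ω → ℝ)
    (hd : ∀ i ∈ s, ∀ j ∈ J, IsHaarAt T (key i) (d i j)) (m : ℕ) :
    𝔼 ω, (∑ j ∈ J, (∑ i ∈ s, d i j ω) ^ 2) ^ m ≤
      (2 * (m : ℝ) ^ 2) ^ m * 𝔼 ω, (∑ i ∈ s, ∑ j ∈ J, d i j ω ^ 2) ^ m := by
  rcases m with _ | m
  · simp
  push_cast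
  set c : ℝ := 2 * ((m : ℝ) + 1) ^ 2 with hc
  have h_weighted := expect_sum_sq_pow_succ_le T s key hinj J d hd m
  rw [← hc, Finset.mul_expect] at h_weighted
  -- Young's inequality absorbs the `m`-th power of the left side into the left side.
  have h_young : ((m : ℝ) + 1) * 𝔼 ω, c * ((∑ i ∈ s, ∑ j ∈ J, d i j ω ^ 2) *
        (∑ j ∈ J, (∑ i ∈ s, d i j ω) ^ 2) ^ m) ≤
      c ^ (m + 1) * 𝔼 ω, (∑ i ∈ s, ∑ j ∈ J, d i j ω ^ 2) ^ (m + 1) +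
        m * 𝔼 ω, (∑ j ∈ J, (∑ i ∈ s, d i j ω) ^ 2) ^ (m + 1) := by
    simp only [Finset.mul_expect, ← Finset.expect_add_distrib]
    refine Finset.expect_le_expect fun ω _ => ?_
    have := add_one_mul_mul_pow_le (a := c * ∑ i ∈ s, ∑ j ∈ J, d i j ω ^ 2)
      (b := ∑ j ∈ J, (∑ i ∈ s, d i j ω) ^ 2) (by positivity) (by positivity) m
    rwa [mul_pow, mul_assoc] at this
  linarith [mul_le_mul_of_nonneg_left h_weighted (by positivity : 0 ≤ (m : ℝ) + 1)]

theorem expect_sum_pow_le (T : ℕ → Equiv.Perm Ω) (s : Finset ι) (key : ι → ℕ)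
    (hinj : Set.InjOn key s) (d : ι → Ω → ℝ) (hd : ∀ i ∈ s, IsHaarAt T (key i) (d i)) (m : ℕ) :
    𝔼 ω, (∑ i ∈ s, d i ω) ^ (2 * m) ≤
      (2 * (m : ℝ) ^ 2) ^ m * 𝔼 ω, (∑ i ∈ s, d i ω ^ 2) ^ m := by
  have := expect_sum_sq_pow_le T s key hinj {()} (fun i _ => d i) (fun i hi _ _ => hd i hi) m
  simpa only [Finset.sum_singleton, ← pow_mul] using this

theorem expect_sum_pow_le_card [Nonempty Ω] (T : ℕ → Equiv.Perm Ω) (s : Finset ι) (key : ι → ℕ)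
    (hinj : Set.InjOn key s) (d : ι → Ω → ℝ) (hd : ∀ i ∈ s, IsHaarAt T (key i) (d i))
    (hd1 : ∀ i ∈ s, ∀ ω, |d i ω| ≤ 1) (m : ℕ) :
    𝔼 ω, (∑ i ∈ s, d i ω) ^ (2 * m) ≤ (2 * (m : ℝ) ^ 2 * s.card) ^ m := by
  refine (expect_sum_pow_le T s key hinj d hd m).trans ?_
  rw [mul_pow _ (s.card : ℝ)]
  gcongr
  refine Finset.expect_le Finset.univ_nonempty fun ω _ => ?_
  gcongr
  simpa using Finset.sum_le_card_nsmul s (fun i => d i ω ^ 2) 1 fun i hi =>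
    (sq_le_one_iff_abs_le_one _).2 (hd1 i hi ω)

theorem sum_fiber_sq [DecidableEq κ] {s : Finset ι} {t : Finset κ} {g : ι → κ}
    (hg : ∀ i ∈ s, g i ∈ t) (d : ι → ℝ) :
    ∑ x ∈ t, (∑ i ∈ s with g i = x, d i) ^ 2 =
      ∑ p ∈ s ×ˢ s with g p.1 = g p.2, d p.1 * d p.2 := by
  rw [← Finset.sum_fiberwise_of_maps_to (g := fun p : ι × ι => g p.1) (t := t)]
  · refine Finset.sum_congr rfl fun x _ => ?_
    rw [sq, Finset.sum_mul_sum, ← Finset.sum_product', ← Finset.filter_product,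
      Finset.filter_filter]
    refine Finset.sum_congr (Finset.filter_congr fun p _ => ?_) fun _ _ => rfl
    exact ⟨fun h => ⟨h.1.trans h.2.symm, h.1⟩, fun h => ⟨h.2, h.1.symm.trans h.2⟩⟩
  · exact fun p hp => hg _ (Finset.mem_product.1 (Finset.mem_filter.1 hp).1).1

/-- The two-parameter square function estimate: only the products of terms with the same pair of
keys survive. -/
theorem expect_sum_pow_le_of_two_keys (T T' : ℕ → Equiv.Perm Ω) (s : Finset ι) (a b : ι → ℕ)
    (d : ι → Ω → ℝ) (ha : ∀ i ∈ s, IsHaarAt T (a i) (d i))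
    (hb : ∀ i ∈ s, IsHaarAt T' (b i) (d i)) (m : ℕ) :
    𝔼 ω, (∑ i ∈ s, d i ω) ^ (2 * m) ≤ (4 * (m : ℝ) ^ 4) ^ m *
      𝔼 ω, (∑ p ∈ s ×ˢ s with (b p.1, a p.1) = (b p.2, a p.2), d p.1 ω * d p.2 ω) ^ m := by
  classical
  have h_first := expect_sum_pow_le T (s.image a) id Function.injective_id.injOn
    (fun x ω => ∑ i ∈ s with a i = x, d i ω) (fun x _ => .sum fun i hi => by
      obtain ⟨his, rfl⟩ := Finset.mem_filter.1 hi
      exact ha i his) m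
  have h_second := expect_sum_sq_pow_le T' (s.image b) id Function.injective_id.injOn (s.image a)
    (fun y x ω => ∑ i ∈ s with (b i, a i) = (y, x), d i ω) (fun y _ x _ => .sum fun i hi => by
      obtain ⟨his, h⟩ := Finset.mem_filter.1 hi
      obtain ⟨rfl, rfl⟩ := Prod.mk.inj h
      exact hb i his) m
  have h_total : ∀ ω, ∑ x ∈ s.image a, ∑ i ∈ s with a i = x, d i ω = ∑ i ∈ s, d i ω := fun ω =>
    Finset.sum_fiberwise_of_maps_to (fun i => Finset.mem_image_of_mem a) _
  have h_refine : ∀ x ω, ∑ y ∈ s.image b, ∑ i ∈ s with (b i, a i) = (y, x), d i ω =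
      ∑ i ∈ s with a i = x, d i ω := fun x ω => by
    rw [← Finset.sum_fiberwise_of_maps_to (t := s.image b) (g := b) fun i hi =>
      Finset.mem_image_of_mem b (Finset.mem_filter.1 hi).1]
    simp only [Finset.filter_filter, Prod.mk.injEq, and_comm]
  have h_pairs : ∀ ω, ∑ y ∈ s.image b, ∑ x ∈ s.image a,
      (∑ i ∈ s with (b i, a i) = (y, x), d i ω) ^ 2 =
        ∑ p ∈ s ×ˢ s with (b p.1, a p.1) = (b p.2, a p.2), d p.1 ω * d p.2 ω := fun ω => by
    rw [← Finset.sum_product']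
    exact sum_fiber_sq (g := fun i => (b i, a i)) (fun i hi => Finset.mk_mem_product
      (Finset.mem_image_of_mem b hi) (Finset.mem_image_of_mem a hi)) fun i => d i ω
  simp only [h_total] at h_first
  simp only [h_refine, h_pairs] at h_second
  calc _ ≤ _ := h_first
    _ ≤ (2 * (m : ℝ) ^ 2) ^ m * ((2 * (m : ℝ) ^ 2) ^ m * _) := by gcongr
    _ = _ := by rw [← mul_assoc, ← mul_pow]; ring_nf

end HaarMartingales

section Expectation

variable {Ω ι : Type*} [Fintype Ω]

theorem expect_abs_pow_le_of_expect_pow_two_mul_le [Nonempty Ω] {Y : Ω → ℝ} {τ : ℝ} (hτ : 0 ≤ τ)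
    {m : ℕ} (hY : 𝔼 ω, Y ω ^ (2 * m) ≤ (τ ^ 2) ^ m) : 𝔼 ω, |Y ω| ^ m ≤ τ ^ m := by
  refine le_of_sq_le_sq ?_ (by positivity)
  calc (𝔼 ω, |Y ω| ^ m) ^ 2 = (𝔼 ω, |Y ω| ^ m * 1) ^ 2 := by simp only [mul_one]
    _ ≤ (𝔼 ω, (|Y ω| ^ m) ^ 2) * 𝔼 _ω : Ω, 1 ^ 2 := Finset.expect_mul_sq_le_sq_mul_sq _ _ _
    _ = 𝔼 ω, Y ω ^ (2 * m) := by
      simp only [← pow_mul, mul_comm m 2, (even_two_mul m).pow_abs, one_pow, Fintype.expect_const,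
        mul_one]
    _ ≤ (τ ^ 2) ^ m := hY
    _ = (τ ^ m) ^ 2 := pow_right_comm _ _ _

theorem expect_sum_pow_le_card_mul (I : Finset ι) (Y : ι → Ω → ℝ) (hY0 : ∀ i ω, 0 ≤ Y i ω)
    {τ : ℝ} {m : ℕ} (hm : m ≠ 0) (hY : ∀ i ∈ I, 𝔼 ω, Y i ω ^ m ≤ τ ^ m) :
    𝔼 ω, (∑ i ∈ I, Y i ω) ^ m ≤ (I.card * τ) ^ m := by
  obtain ⟨m, rfl⟩ := Nat.exists_eq_succ_of_ne_zero hm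
  rcases I.eq_empty_or_nonempty with rfl | hI
  · simp
  have h_jensen : ∀ ω, (∑ i ∈ I, Y i ω) ^ (m + 1) ≤
      (I.card : ℝ) ^ m * ∑ i ∈ I, Y i ω ^ (m + 1) := fun ω => by
    rw [← div_le_iff₀' (by exact_mod_cast pow_pos hI.card_pos m)]
    exact pow_sum_div_card_le_sum_pow (fun _ _ => hY0 _ ω) m
  calc 𝔼 ω, (∑ i ∈ I, Y i ω) ^ (m + 1)
      ≤ 𝔼 ω, (I.card : ℝ) ^ m * ∑ i ∈ I, Y i ω ^ (m + 1) :=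
        Finset.expect_le_expect fun ω _ => h_jensen ω
    _ = (I.card : ℝ) ^ m * ∑ i ∈ I, 𝔼 ω, Y i ω ^ (m + 1) := by
        rw [← Finset.mul_expect, Finset.expect_sum_comm]
    _ ≤ (I.card : ℝ) ^ m * ∑ _i ∈ I, τ ^ (m + 1) :=
        mul_le_mul_of_nonneg_left (Finset.sum_le_sum hY) (by positivity)
    _ = _ := by rw [Finset.sum_const, nsmul_eq_mul, mul_pow, Nat.succ_eq_add_one]; ring

theorem expect_const_add_sum_abs_pow_le [Nonempty Ω] (I : Finset ι) (Y : ι → Ω → ℝ) {c τ : ℝ}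
    (hc : 0 ≤ c) (hτ : 0 ≤ τ) {m : ℕ} (hm : m ≠ 0)
    (hY : ∀ i ∈ I, 𝔼 ω, Y i ω ^ (2 * m) ≤ (τ ^ 2) ^ m) :
    𝔼 ω, (c + ∑ i ∈ I, |Y i ω|) ^ m ≤ (2 * (c + I.card * τ)) ^ m := by
  have h_sum := expect_sum_pow_le_card_mul I (fun i ω => |Y i ω|) (fun _ _ => abs_nonneg _) hm
    fun i hi => expect_abs_pow_le_of_expect_pow_two_mul_le hτ (hY i hi)
  have h_card : 0 ≤ I.card * τ := by positivity
  calc 𝔼 ω, (c + ∑ i ∈ I, |Y i ω|) ^ m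
      ≤ 𝔼 ω, 2 ^ (m - 1) * (c ^ m + (∑ i ∈ I, |Y i ω|) ^ m) :=
        Finset.expect_le_expect fun ω _ => add_pow_le hc (by positivity) m
    _ = 2 ^ (m - 1) * (c ^ m + 𝔼 ω, (∑ i ∈ I, |Y i ω|) ^ m) := by
        rw [← Finset.mul_expect, Finset.expect_add_distrib, Fintype.expect_const]
    _ ≤ 2 ^ (m - 1) * ((c + I.card * τ) ^ m + (c + I.card * τ) ^ m) := by
        gcongr
        · linarith
        · exact h_sum.trans (by gcongr; linarith)
    _ = (2 * (c + I.card * τ)) ^ m := by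
        rw [← two_mul, ← mul_assoc, pow_sub_one_mul hm, mul_pow]

end Expectation

section HaarFamilies

/-- A scale: the exponents `r` of the side lengths `2 ^ (-r i)` of a dyadic rectangle. -/
abbrev Scale := Fin 3 → ℕ

theorem sum_coords {i j k : Fin 3} (hij : i ≠ j) (hik : i ≠ k) (hjk : j ≠ k) (r : Scale) :
    ∑ x, r x = r i + r j + r k := by
  rw [Fin.sum_univ_three]
  fin_cases i <;> fin_cases j <;> fin_cases k <;> simp at * <;> omega

theorem coord_le {d n : ℕ} {r : Fin d → ℕ} (hr : ∑ i, r i = n) (i : Fin d) : r i ≤ n :=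
  hr ▸ Finset.single_le_sum (fun _ _ => Nat.zero_le _) (Finset.mem_univ i)

theorem eq_of_two_coords {n : ℕ} {i j : Fin 3} (hij : i ≠ j) {r s : Scale} (hr : ∑ i, r i = n)
    (hs : ∑ i, s i = n) (hi : r i = s i) (hj : r j = s j) : r = s := by
  ext k
  by_cases hik : i = k
  · exact hik ▸ hi
  by_cases hjk : j = k
  · exact hjk ▸ hj
  rw [sum_coords hij hik hjk] at hr hs
  omega

variable {Ω : Type*} {T : Fin 3 → ℕ → Equiv.Perm Ω} {n : ℕ} {f : Scale → Ω → ℝ}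

/-- `g` behaves like a combination of Haar functions of the rectangles of scale `r`, where `T i k`
flips the binary digit of index `k` of the `i`-th coordinate. -/
def IsHaar (T : Fin 3 → ℕ → Equiv.Perm Ω) (r : Scale) (g : Ω → ℝ) : Prop :=
  ∀ i, IsHaarAt (T i) (r i) g

/-- A choice, for every scale `r` of order `n`, of a sign valued function of that scale. -/
def IsSignFamily (T : Fin 3 → ℕ → Equiv.Perm Ω) (n : ℕ) (f : Scale → Ω → ℝ) : Prop :=
  ∀ r, ∑ i, r i = n → IsHaar T r (f r) ∧ ∀ ω, f r ω ^ 2 = 1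

theorem IsSignFamily.isHaarAt (hf : IsSignFamily T n f) {r : Scale} (hr : ∑ i, r i = n)
    (i : Fin 3) : IsHaarAt (T i) (r i) (f r) :=
  (hf r hr).1 i

theorem IsSignFamily.sq_eq_one (hf : IsSignFamily T n f) {r : Scale} (hr : ∑ i, r i = n) (ω : Ω) :
    f r ω ^ 2 = 1 :=
  (hf r hr).2 ω

theorem IsSignFamily.abs_eq_one (hf : IsSignFamily T n f) {r : Scale} (hr : ∑ i, r i = n)
    (ω : Ω) : |f r ω| = 1 :=
  by rw [← sq_eq_sq₀ (abs_nonneg _) zero_le_one, sq_abs, hf.sq_eq_one hr, one_pow]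

theorem IsSignFamily.sum_two_coords_eq (hf : IsSignFamily T n f) {i j : Fin 3} (hij : i ≠ j)
    {A : Finset Scale} (hA : ∀ r ∈ A, ∑ i, r i = n) (ω : Ω) :
    ∑ p ∈ A ×ˢ A with p.1 i = p.2 i ∧ p.1 j = p.2 j, f p.1 ω * f p.2 ω = A.card := by
  have h_diag : {p ∈ A ×ˢ A | p.1 i = p.2 i ∧ p.1 j = p.2 j} = A.diag := by
    ext ⟨r, s⟩
    simp only [Finset.mem_filter, Finset.mem_product, Finset.mem_diag]
    constructor
    · rintro ⟨⟨hr, hs⟩, hi, hj⟩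
      exact ⟨hr, eq_of_two_coords hij (hA r hr) (hA s hs) hi hj⟩
    · rintro ⟨hr, rfl⟩
      exact ⟨⟨hr, hr⟩, rfl, rfl⟩
  rw [h_diag, Finset.sum_diag, Finset.card_eq_sum_ones, Nat.cast_sum]
  exact Finset.sum_congr rfl fun r hr => by
    simpa only [sq, Nat.cast_one] using hf.sq_eq_one (hA r hr) ω

theorem IsSignFamily.expect_sum_pow_le [Fintype Ω] [Nonempty Ω] (hf : IsSignFamily T n f)
    (A : Finset Scale) (hA : ∀ r ∈ A, ∑ i, r i = n) (m : ℕ) :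
    𝔼 ω, (∑ r ∈ A, f r ω) ^ (2 * m) ≤ (4 * (m : ℝ) ^ 4 * A.card) ^ m := by
  have h := expect_sum_pow_le_of_two_keys (T 0) (T 1) A (· 0) (· 1) f
    (fun r hr => hf.isHaarAt (hA r hr) 0) (fun r hr => hf.isHaarAt (hA r hr) 1) m
  simpa only [Prod.mk.injEq, hf.sum_two_coords_eq (i := 1) (j := 0) (by decide) hA,
    Fintype.expect_const, ← mul_pow] using h

/-- Two scales of order `n` with the same `i`-th coordinate, the first one having the smaller
`j`-th coordinate. Sums over such coincidences are what makes the three dimensional problem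
harder than the two dimensional one. -/
structure IsCoincidence (n : ℕ) (i j : Fin 3) (p : Scale × Scale) : Prop where
  sum_left : ∑ x, p.1 x = n
  sum_right : ∑ x, p.2 x = n
  eq : p.1 i = p.2 i
  lt : p.1 j < p.2 j

section Coincidences

variable {i j k : Fin 3} {E : Finset (Scale × Scale)}

theorem IsCoincidence.lt_third {p : Scale × Scale} (hp : IsCoincidence n i j p) (hij : i ≠ j)
    (hik : i ≠ k) (hjk : j ≠ k) : p.2 k < p.1 k := by
  have h1 := hp.sum_left
  have h2 := hp.sum_right
  rw [sum_coords hij hik hjk] at h1 h2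
  have := hp.eq
  have := hp.lt
  omega

/-- The pairs of coincidences surviving in the square function estimate for the parameters `j`
and `k`. -/
def alignedPairs (j k : Fin 3) (E : Finset (Scale × Scale)) :
    Finset ((Scale × Scale) × (Scale × Scale)) :=
  {q ∈ E ×ˢ E | (q.1.1 k, q.1.2 j) = (q.2.1 k, q.2.2 j)}

theorem mem_alignedPairs {q : (Scale × Scale) × (Scale × Scale)} :
    q ∈ alignedPairs j k E ↔ q.1 ∈ E ∧ q.2 ∈ E ∧ q.1.1 k = q.2.1 k ∧ q.1.2 j = q.2.2 j := by
  simp only [alignedPairs, Finset.mem_filter, Finset.mem_product, Prod.mk.injEq, and_assoc]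

theorem IsSignFamily.expect_coincidences_pow_le_alignedPairs [Fintype Ω]
    (hf : IsSignFamily T n f) (hij : i ≠ j) (hik : i ≠ k) (hjk : j ≠ k)
    (hE : ∀ p ∈ E, IsCoincidence n i j p) (m : ℕ) :
    𝔼 ω, (∑ p ∈ E, f p.1 ω * f p.2 ω) ^ (2 * m) ≤ (4 * (m : ℝ) ^ 4) ^ m *
      𝔼 ω, (∑ q ∈ alignedPairs j k E,
        f q.1.1 ω * f q.1.2 ω * (f q.2.1 ω * f q.2.2 ω)) ^ m := by
  refine expect_sum_pow_le_of_two_keys (T j) (T k) E (fun p => p.2 j) (fun p => p.1 k) _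
    (fun p hp => ?_) (fun p hp => ?_) m
  · exact (hf.isHaarAt (hE p hp).sum_left j).mul_of_lt (hf.isHaarAt (hE p hp).sum_right j)
      (hE p hp).lt
  · simpa only [mul_comm] using (hf.isHaarAt (hE p hp).sum_right k).mul_of_lt
      (hf.isHaarAt (hE p hp).sum_left k) ((hE p hp).lt_third hij hik hjk)

theorem eq_of_mem_alignedPairs (hij : i ≠ j) (hik : i ≠ k) (hE : ∀ p ∈ E, IsCoincidence n i j p)
    {q : (Scale × Scale) × (Scale × Scale)} (hq : q ∈ alignedPairs j k E)
    (h : q.1.1 i = q.2.1 i) : q.1 = q.2 := by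
  obtain ⟨h1, h2, hk, hj⟩ := mem_alignedPairs.1 hq
  refine Prod.ext (eq_of_two_coords hik (hE _ h1).sum_left (hE _ h2).sum_left h hk) ?_
  refine eq_of_two_coords hij (hE _ h1).sum_right (hE _ h2).sum_right ?_ hj
  rw [← (hE _ h1).eq, ← (hE _ h2).eq, h]

/-- With `r` and `r'` fixed, `max (q.1.2 k) (q.2.2 k)` is a key for which the products
`f q.1.2 * f q.2.2` are martingale differences: off the diagonal the two entries differ. -/
theorem IsSignFamily.expect_offDiag_fiber_pow_le [Fintype Ω] [Nonempty Ω]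
    (hf : IsSignFamily T n f) (hij : i ≠ j) (hik : i ≠ k) (hjk : j ≠ k)
    (hE : ∀ p ∈ E, IsCoincidence n i j p)
    (r r' : Scale) (m : ℕ) :
    𝔼 ω, (∑ q ∈ alignedPairs j k E with q.1 ≠ q.2 ∧ (q.1.1, q.2.1) = (r, r'),
      f q.1.2 ω * f q.2.2 ω) ^ (2 * m) ≤ (2 * (m : ℝ) ^ 2 * (n + 1)) ^ m := by
  set Q := {q ∈ alignedPairs j k E | q.1 ≠ q.2 ∧ (q.1.1, q.2.1) = (r, r')}
  have h_mem : ∀ q ∈ Q, ∑ x, q.1.2 x = n ∧ ∑ x, q.2.2 x = n ∧ q.1.2 i = r i ∧ q.2.2 i = r' i ∧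
      q.1.2 j = q.2.2 j ∧ q.1.2 i ≠ q.2.2 i ∧ q.1.1 = r ∧ q.2.1 = r' := by
    intro q hq
    obtain ⟨hqE, hne, hr⟩ := Finset.mem_filter.1 hq
    obtain ⟨rfl, rfl⟩ := Prod.mk.inj hr
    obtain ⟨h1, h2, -, hj⟩ := mem_alignedPairs.1 hqE
    refine ⟨(hE _ h1).sum_right, (hE _ h2).sum_right, (hE _ h1).eq.symm, (hE _ h2).eq.symm, hj,
      fun h => hne (eq_of_mem_alignedPairs hij hik hE hqE ?_), rfl, rfl⟩
    rw [(hE _ h1).eq, (hE _ h2).eq, h]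
  have h_sum : ∀ q ∈ Q, q.1.2 i + q.1.2 j + q.1.2 k = n ∧ q.2.2 i + q.2.2 j + q.2.2 k = n :=
    fun q hq => by
      rw [← sum_coords hij hik hjk, ← sum_coords hij hik hjk]
      exact ⟨(h_mem q hq).1, (h_mem q hq).2.1⟩
  have h_inj : Set.InjOn
      (fun q : (Scale × Scale) × Scale × Scale => max (q.1.2 k) (q.2.2 k)) Q := by
    intro q hq q' hq' h
    simp only at h
    obtain ⟨s1, s2, hi1, hi2, hj, -, h1, h2⟩ := h_mem q hq
    obtain ⟨s1', s2', hi1', hi2', hj', -, h1', h2'⟩ := h_mem q' hq'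
    have := h_sum q hq
    have := h_sum q' hq'
    refine Prod.ext (Prod.ext (h1.trans h1'.symm) ?_) (Prod.ext (h2.trans h2'.symm) ?_)
    · exact eq_of_two_coords hij s1 s1' (hi1.trans hi1'.symm) (by omega)
    · exact eq_of_two_coords hij s2 s2' (hi2.trans hi2'.symm) (by omega)
  have h_card : (Q.card : ℝ) ≤ n + 1 := by
    have := Finset.card_le_card_of_injOn (t := Finset.range (n + 1)) _
      (fun q hq => Finset.mem_coe.2 <| Finset.mem_range.2 <| by
        have := h_sum q hq
        omega) h_inj
    rw [Finset.card_range] at this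
    exact_mod_cast this
  refine (expect_sum_pow_le_card (T k) Q _ h_inj _ (fun q hq => ?_) (fun q hq ω => ?_) m).trans
    (by gcongr)
  · have := h_sum q hq
    obtain ⟨s1, s2, -, -, hj, hne, -⟩ := h_mem q hq
    exact (hf.isHaarAt s1 k).mul_of_ne (hf.isHaarAt s2 k) (by omega)
  · rw [abs_mul, hf.abs_eq_one (h_mem q hq).1, hf.abs_eq_one (h_mem q hq).2.1, mul_one]

theorem card_diag_alignedPairs_le (hij : i ≠ j) (hik : i ≠ k)
    (hE : ∀ p ∈ E, IsCoincidence n i j p) (C K : Finset ℕ) (hC : ∀ p ∈ E, p.1 i ∈ C)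
    (hK : ∀ p ∈ E, p.1 k ∈ K) :
    {q ∈ alignedPairs j k E | q.1 = q.2}.card ≤ C.card * K.card * (n + 1) := by
  have h := Finset.card_le_card_of_injOn (s := {q ∈ alignedPairs j k E | q.1 = q.2})
    (t := (C ×ˢ K) ×ˢ Finset.range (n + 1)) (fun q => ((q.1.1 i, q.1.1 k), q.1.2 j)) ?_ ?_
  · simpa only [Finset.card_product, Finset.card_range] using h
  · intro q hq
    obtain ⟨h1, -⟩ := mem_alignedPairs.1 (Finset.mem_filter.1 hq).1
    have hj := coord_le (hE _ h1).sum_right j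
    simp [hC _ h1, hK _ h1, hj]
  · intro q hq q' hq' h
    obtain ⟨hq, hqq⟩ := Finset.mem_filter.1 hq
    obtain ⟨hq', hqq'⟩ := Finset.mem_filter.1 hq'
    simp only [Prod.mk.injEq] at h
    have : (q.1, q'.1) ∈ alignedPairs j k E := mem_alignedPairs.2
      ⟨(mem_alignedPairs.1 hq).1, (mem_alignedPairs.1 hq').1, h.1.2, h.2⟩
    have h_fst : q.1 = q'.1 := eq_of_mem_alignedPairs hij hik hE this h.1.1
    exact Prod.ext h_fst (by rw [← hqq, ← hqq', h_fst])

theorem card_image_offDiag_alignedPairs_le (hik : i ≠ k) (hE : ∀ p ∈ E, IsCoincidence n i j p)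
    (C K : Finset ℕ) (hC : ∀ p ∈ E, p.1 i ∈ C) (hK : ∀ p ∈ E, p.1 k ∈ K) :
    ({q ∈ alignedPairs j k E | q.1 ≠ q.2}.image fun q => (q.1.1, q.2.1)).card ≤
      C.card ^ 2 * K.card := by
  have h := Finset.card_le_card_of_injOn
    (s := {q ∈ alignedPairs j k E | q.1 ≠ q.2}.image fun q => (q.1.1, q.2.1))
    (t := (C ×ˢ C) ×ˢ K) (fun r => ((r.1 i, r.2 i), r.1 k)) ?_ ?_
  · simpa only [Finset.card_product, ← sq] using h
  · intro r hr
    obtain ⟨q, hq, rfl⟩ := Finset.mem_image.1 hr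
    obtain ⟨h1, h2, -⟩ := mem_alignedPairs.1 (Finset.mem_filter.1 hq).1
    simp [hC _ h1, hC _ h2, hK _ h1]
  · intro r hr r' hr' h
    obtain ⟨q, hq, rfl⟩ := Finset.mem_image.1 hr
    obtain ⟨q', hq', rfl⟩ := Finset.mem_image.1 hr'
    obtain ⟨h1, h2, hk, -⟩ := mem_alignedPairs.1 (Finset.mem_filter.1 hq).1
    obtain ⟨h1', h2', hk', -⟩ := mem_alignedPairs.1 (Finset.mem_filter.1 hq').1
    simp only [Prod.mk.injEq] at h
    exact Prod.ext
      (eq_of_two_coords hik (hE _ h1).sum_left (hE _ h1').sum_left h.1.1 h.2)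
      (eq_of_two_coords hik (hE _ h2).sum_left (hE _ h2').sum_left h.1.2
        (hk.symm.trans (h.2.trans hk')))

theorem IsSignFamily.abs_sum_alignedPairs_le (hf : IsSignFamily T n f)
    (hE : ∀ p ∈ E, IsCoincidence n i j p) (ω : Ω) :
    |∑ q ∈ alignedPairs j k E, f q.1.1 ω * f q.1.2 ω * (f q.2.1 ω * f q.2.2 ω)| ≤
      {q ∈ alignedPairs j k E | q.1 = q.2}.card +
        ∑ r ∈ {q ∈ alignedPairs j k E | q.1 ≠ q.2}.image fun q => (q.1.1, q.2.1),
          |∑ q ∈ alignedPairs j k E with q.1 ≠ q.2 ∧ (q.1.1, q.2.1) = r,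
            f q.1.2 ω * f q.2.2 ω| := by
  have h_abs : ∀ q ∈ alignedPairs j k E, |f q.1.1 ω| = 1 ∧ |f q.1.2 ω| = 1 ∧ |f q.2.1 ω| = 1 ∧
      |f q.2.2 ω| = 1 := fun q hq => by
    obtain ⟨h1, h2, -⟩ := mem_alignedPairs.1 hq
    exact ⟨hf.abs_eq_one (hE _ h1).sum_left ω, hf.abs_eq_one (hE _ h1).sum_right ω,
      hf.abs_eq_one (hE _ h2).sum_left ω, hf.abs_eq_one (hE _ h2).sum_right ω⟩
  rw [← Finset.sum_filter_add_sum_filter_not _ fun q => q.1 = q.2]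
  refine (abs_add_le _ _).trans (add_le_add ?_ ?_)
  · refine (Finset.abs_sum_le_sum_abs _ _).trans (le_of_eq ?_)
    rw [Finset.card_eq_sum_ones, Nat.cast_sum]
    refine Finset.sum_congr rfl fun q hq => ?_
    obtain ⟨h11, h12, h21, h22⟩ := h_abs q (Finset.mem_filter.1 hq).1
    simp only [abs_mul, h11, h12, h21, h22, mul_one, Nat.cast_one]
  · rw [← Finset.sum_fiberwise_of_maps_to fun q => Finset.mem_image_of_mem
      fun q : (Scale × Scale) × Scale × Scale => (q.1.1, q.2.1)]
    refine (Finset.abs_sum_le_sum_abs _ _).trans (Finset.sum_le_sum fun r hr => le_of_eq ?_)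
    obtain ⟨q₀, hq₀, rfl⟩ := Finset.mem_image.1 hr
    obtain ⟨h11, -, h21, -⟩ := h_abs q₀ (Finset.mem_filter.1 hq₀).1
    rw [Finset.filter_filter]
    calc _ = |f q₀.1.1 ω * f q₀.2.1 ω * ∑ q ∈ alignedPairs j k E with
          q.1 ≠ q.2 ∧ (q.1.1, q.2.1) = (q₀.1.1, q₀.2.1), f q.1.2 ω * f q.2.2 ω| := by
          rw [Finset.mul_sum]
          refine congrArg _ (Finset.sum_congr rfl fun q hq => ?_)
          obtain ⟨hr1, hr2⟩ := Prod.mk.inj (Finset.mem_filter.1 hq).2.2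
          rw [← hr1, ← hr2]
          ring
      _ = _ := by rw [abs_mul, abs_mul, h11, h21, one_mul, one_mul]

/-- The gain from coinciding scales. There may be `|C| * |K| * (n + 1)` coincidences, so the last
term measures the loss over square root cancellation. -/
theorem IsSignFamily.expect_coincidences_pow_le [Fintype Ω] [Nonempty Ω]
    (hf : IsSignFamily T n f) (hij : i ≠ j) (hik : i ≠ k) (hjk : j ≠ k)
    (hE : ∀ p ∈ E, IsCoincidence n i j p)
    (C K : Finset ℕ) (hC : ∀ p ∈ E, p.1 i ∈ C) (hK : ∀ p ∈ E, p.1 k ∈ K) {m : ℕ} (hm : m ≠ 0)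
    {τ : ℝ} (hτ : 0 ≤ τ) (hτm : 2 * (m : ℝ) ^ 2 * (n + 1) ≤ τ ^ 2) :
    𝔼 ω, (∑ p ∈ E, f p.1 ω * f p.2 ω) ^ (2 * m) ≤
      (8 * (m : ℝ) ^ 4 * (C.card * K.card * (n + 1) + (C.card : ℝ) ^ 2 * K.card * τ)) ^ m := by
  set D := {q ∈ alignedPairs j k E | q.1 = q.2}
  set I := {q ∈ alignedPairs j k E | q.1 ≠ q.2}.image fun q => (q.1.1, q.2.1)
  have h_fiber : ∀ r ∈ I, 𝔼 ω, (∑ q ∈ alignedPairs j k E with q.1 ≠ q.2 ∧ (q.1.1, q.2.1) = r,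
      f q.1.2 ω * f q.2.2 ω) ^ (2 * m) ≤ (τ ^ 2) ^ m := fun r _ =>
    (hf.expect_offDiag_fiber_pow_le hij hik hjk hE r.1 r.2 m).trans (by gcongr)
  have hD : (D.card : ℝ) ≤ C.card * K.card * (n + 1) := by
    exact_mod_cast card_diag_alignedPairs_le hij hik hE C K hC hK
  have hI : (I.card : ℝ) ≤ (C.card : ℝ) ^ 2 * K.card := by
    exact_mod_cast card_image_offDiag_alignedPairs_le hik hE C K hC hK
  calc 𝔼 ω, (∑ p ∈ E, f p.1 ω * f p.2 ω) ^ (2 * m)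
      ≤ (4 * (m : ℝ) ^ 4) ^ m * 𝔼 ω, (∑ q ∈ alignedPairs j k E,
          f q.1.1 ω * f q.1.2 ω * (f q.2.1 ω * f q.2.2 ω)) ^ m :=
        hf.expect_coincidences_pow_le_alignedPairs hij hik hjk hE m
    _ ≤ (4 * (m : ℝ) ^ 4) ^ m * 𝔼 ω, (D.card + ∑ r ∈ I,
          |∑ q ∈ alignedPairs j k E with q.1 ≠ q.2 ∧ (q.1.1, q.2.1) = r,
            f q.1.2 ω * f q.2.2 ω|) ^ m := by
        refine mul_le_mul_of_nonneg_left (Finset.expect_le_expect fun ω _ => ?_) (by positivity)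
        exact (le_abs_self _).trans ((abs_pow _ _).trans_le
          (pow_le_pow_left₀ (abs_nonneg _) (hf.abs_sum_alignedPairs_le hE ω) m))
    _ ≤ (4 * (m : ℝ) ^ 4) ^ m * (2 * (D.card + I.card * τ)) ^ m := by
        gcongr
        exact expect_const_add_sum_abs_pow_le I _ (Nat.cast_nonneg _) hτ hm h_fiber
    _ ≤ (4 * (m : ℝ) ^ 4) ^ m * (2 * (C.card * K.card * (n + 1) +
          (C.card : ℝ) ^ 2 * K.card * τ)) ^ m := by gcongr
    _ = _ := by rw [← mul_pow]; ring_nf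

end Coincidences

end HaarFamilies

section RieszProducts

variable {Ω : Type*} {T : Fin 3 → ℕ → Equiv.Perm Ω} {n : ℕ} {f : Scale → Ω → ℝ}
  {blk : ℕ → ℕ} {A : ℕ → Finset Scale} {ρ : ℝ} {ε : ℕ → ℝ}

/-- The sum of the functions whose scales lie in `A`. -/
def signSum (f : Scale → Ω → ℝ) (A : Finset Scale) (ω : Ω) : ℝ :=
  ∑ r ∈ A, f r ω

/-- The sets `A w` consist of scales of order `n` whose first coordinate lies in block `w`, where
`blk` sends a first coordinate to the index of its block. -/
def IsBlocked (n : ℕ) (blk : ℕ → ℕ) (A : ℕ → Finset Scale) : Prop :=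
  ∀ w, ∀ r ∈ A w, ∑ i, r i = n ∧ blk (r 0) = w

/-- The Riesz product over the blocks in `W`. Besides `ε = 1`, the constants `ε w = 0` occur, which
turn a factor into the bare sum over the block. -/
def rieszProd (f : Scale → Ω → ℝ) (ρ : ℝ) (ε : ℕ → ℝ) (A : ℕ → Finset Scale) (W : Finset ℕ)
    (ω : Ω) : ℝ :=
  ∏ w ∈ W, (ε w + ρ * signSum f (A w) ω)

theorem rieszProd_inv (hf : IsSignFamily T n f) (hA : IsBlocked n blk A) (W : Finset ℕ)
    (i : Fin 3) (l : ℕ) (hl : ∀ w ∈ W, ∀ r ∈ A w, r i < l) (ω : Ω) :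
    rieszProd f ρ ε A W (T i l ω) = rieszProd f ρ ε A W ω := by
  refine Finset.prod_congr rfl fun w hw => ?_
  congr 2
  exact Finset.sum_congr rfl fun r hr => (hf.isHaarAt (hA w r hr).1 i).inv l (hl w hw r hr) ω

theorem IsBlocked.lt (hA : IsBlocked n blk A) (hblk : Monotone blk) {w w' : ℕ} (h : w < w')
    {r s : Scale} (hr : r ∈ A w) (hs : s ∈ A w') : r 0 < s 0 := by
  refine hblk.reflect_lt ?_
  rw [(hA w r hr).2, (hA w' s hs).2]
  exact h

/-- The sum over the coincidences within `A` of first coordinates. -/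
def pairSum (f : Scale → Ω → ℝ) (A : Finset Scale) (ω : Ω) : ℝ :=
  ∑ p ∈ A ×ˢ A with p.1 0 = p.2 0 ∧ p.1 1 < p.2 1, f p.1 ω * f p.2 ω

theorem IsSignFamily.sum_same_first_eq (hf : IsSignFamily T n f) {A : Finset Scale}
    (hA : ∀ r ∈ A, ∑ i, r i = n) (ω : Ω) :
    ∑ p ∈ A ×ˢ A with p.1 0 = p.2 0, f p.1 ω * f p.2 ω = A.card + 2 * pairSum f A ω := by
  have h_swap : ∑ p ∈ A ×ˢ A with p.1 0 = p.2 0 ∧ p.2 1 < p.1 1, f p.1 ω * f p.2 ω =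
      pairSum f A ω :=
    Finset.sum_nbij' Prod.swap Prod.swap (by simp; grind) (by simp; grind) (by simp) (by simp)
      fun _ _ => mul_comm _ _
  rw [← hf.sum_two_coords_eq (i := 0) (j := 1) (by decide) hA ω, two_mul, ← add_assoc]
  nth_rewrite 2 [← h_swap]
  rw [pairSum]
  simp only [Finset.sum_filter, ← Finset.sum_add_distrib]
  refine Finset.sum_congr rfl fun p _ => ?_
  rcases lt_trichotomy (p.1 1) (p.2 1) with h | h | h
  · simp [h, h.ne, h.not_gt]
  · simp [h]
  · simp [h, h.ne', h.not_gt]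

theorem IsSignFamily.signSum_sq_eq (hf : IsSignFamily T n f) {A : Finset Scale}
    (hA : ∀ r ∈ A, ∑ i, r i = n) (ω : Ω) :
    signSum f A ω ^ 2 = A.card + 2 * pairSum f A ω +
      ∑ p ∈ A ×ˢ A with p.1 0 ≠ p.2 0, f p.1 ω * f p.2 ω := by
  rw [← hf.sum_same_first_eq hA, Finset.sum_filter_add_sum_filter_not, sq, signSum,
    Finset.sum_mul_sum, ← Finset.sum_product']

variable [Fintype Ω]

theorem expect_mul_rieszProd (hf : IsSignFamily T n f) (hblk : Monotone blk)
    (hA : IsBlocked n blk A) (W : Finset ℕ) (g : Ω → ℝ)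
    (hg : ∀ w ∈ W, ∀ r ∈ A w, ∀ ω, g (T 0 (r 0) ω) = g ω) :
    𝔼 ω, g ω * rieszProd f ρ ε A W ω = (𝔼 ω, g ω) * ∏ w ∈ W, ε w := by
  induction W using Finset.induction_on_max with
  | empty => simp [rieszProd]
  | insert w W hmax ih =>
    have hw : w ∉ W := fun h => lt_irrefl _ (hmax w h)
    have h_expand : ∀ ω, g ω * rieszProd f ρ ε A (insert w W) ω =
        ε w * (g ω * rieszProd f ρ ε A W ω) +
          ρ * ∑ r ∈ A w, g ω * rieszProd f ρ ε A W ω * f r ω := fun ω => by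
      rw [rieszProd, Finset.prod_insert hw, ← Finset.mul_sum, signSum, rieszProd]
      ring
    have h_odd : ∀ r ∈ A w, 𝔼 ω, g ω * rieszProd f ρ ε A W ω * f r ω = 0 := fun r hr =>
      expect_eq_zero_of_odd (T 0 (r 0)) fun ω => by
        rw [hg w (by simp) r hr, (hf.isHaarAt (hA w r hr).1 0).odd, mul_neg,
          rieszProd_inv hf hA W 0 (r 0) fun w' hw' s hs => hA.lt hblk (hmax w' hw') hs hr]
    simp only [h_expand]
    rw [Finset.expect_add_distrib, ← Finset.mul_expect, ← Finset.mul_expect,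
      Finset.expect_sum_comm, Finset.sum_eq_zero h_odd, Finset.prod_insert hw,
      ih fun w' hw' => hg w' (Finset.mem_insert_of_mem hw')]
    ring

theorem expect_rieszProd [Nonempty Ω] (hf : IsSignFamily T n f) (hblk : Monotone blk)
    (hA : IsBlocked n blk A) (W : Finset ℕ) : 𝔼 ω, rieszProd f ρ ε A W ω = ∏ w ∈ W, ε w := by
  simpa using expect_mul_rieszProd (ρ := ρ) (ε := ε) hf hblk hA W (fun _ => 1)
    fun _ _ _ _ _ => rfl

theorem expect_mul_signSum_sq (hf : IsSignFamily T n f) (A : Finset Scale)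
    (hA : ∀ r ∈ A, ∑ i, r i = n) (g : Ω → ℝ) (hg : ∀ r ∈ A, ∀ ω, g (T 0 (r 0) ω) = g ω) :
    𝔼 ω, g ω * signSum f A ω ^ 2 =
      A.card * 𝔼 ω, g ω + 2 * 𝔼 ω, g ω * pairSum f A ω := by
  have h_lt : ∀ r ∈ A, ∀ s ∈ A, r 0 < s 0 → 𝔼 ω, g ω * (f r ω * f s ω) = 0 :=
    fun r hr s hs hrs => expect_eq_zero_of_odd (T 0 (s 0)) fun ω => by
      rw [hg s hs, ((hf.isHaarAt (hA r hr) 0).mul_of_lt (hf.isHaarAt (hA s hs) 0) hrs).odd,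
        mul_neg]
  have h_ne : 𝔼 ω, g ω * ∑ p ∈ A ×ˢ A with p.1 0 ≠ p.2 0, f p.1 ω * f p.2 ω = 0 := by
    simp only [Finset.mul_sum]
    rw [Finset.expect_sum_comm]
    refine Finset.sum_eq_zero fun p hp => ?_
    obtain ⟨hp, hne⟩ := Finset.mem_filter.1 hp
    obtain ⟨h1, h2⟩ := Finset.mem_product.1 hp
    rcases hne.lt_or_gt with h | h
    · exact h_lt _ h1 _ h2 h
    · simpa only [mul_comm (f p.1 _)] using h_lt _ h2 _ h1 h
  simp only [hf.signSum_sq_eq hA, mul_add, Finset.expect_add_distrib, h_ne, add_zero,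
    mul_left_comm (g _) 2, ← Finset.mul_expect, ← Finset.expect_mul, mul_comm (A.card : ℝ)]

end RieszProducts

section RieszMoments

variable {Ω : Type*} {T : Fin 3 → ℕ → Equiv.Perm Ω} {n : ℕ} {f : Scale → Ω → ℝ}
  {blk : ℕ → ℕ} {A : ℕ → Finset Scale} {ρ : ℝ}

theorem abs_signSum_le (hf : IsSignFamily T n f) (A : Finset Scale)
    (hA : ∀ r ∈ A, ∑ i, r i = n) (ω : Ω) : |signSum f A ω| ≤ A.card :=
  (Finset.abs_sum_le_sum_abs _ _).trans_eq <| by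
    rw [Finset.sum_congr rfl fun r hr => hf.abs_eq_one (hA r hr) ω]
    simp

theorem abs_rieszProd_le (hf : IsSignFamily T n f) (hA : IsBlocked n blk A) {B : ℝ}
    (hB : ∀ w, 1 + |ρ| * (A w).card ≤ B) (W : Finset ℕ) (ω : Ω) :
    |rieszProd f ρ 1 A W ω| ≤ B ^ W.card := by
  rw [rieszProd, Finset.abs_prod, ← Finset.prod_const]
  refine Finset.prod_le_prod (fun _ _ => abs_nonneg _) fun w _ =>
    (abs_add_le _ _).trans ((hB w).trans' ?_)
  rw [abs_mul, Pi.one_apply, abs_one]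
  gcongr
  exact abs_signSum_le hf _ (fun r hr => (hA w r hr).1) ω

theorem rieszProd_one_subset (A : ℕ → Finset Scale) {U W : Finset ℕ} (hU : U ⊆ W) (ω : Ω) :
    rieszProd f ρ 1 A U ω = rieszProd f ρ 1 (fun w => if w ∈ U then A w else ∅) W ω :=
  Finset.prod_subset_one_on_sdiff hU
    (fun w hw => by simp [(Finset.mem_sdiff.1 hw).2, signSum]) (fun w hw => by simp [hw])

theorem le_add_pow_div_mul {y η : ℝ} (hη : 0 < η) {m : ℕ} (hm : m ≠ 0) :
    y ≤ η + y ^ (2 * m) / η ^ (2 * m) * η := by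
  have h_nonneg : 0 ≤ y ^ (2 * m) / η ^ (2 * m) * η := by
    rw [pow_mul]
    positivity
  rcases le_total y η with h | h
  · exact le_add_of_le_of_nonneg h h_nonneg
  · refine le_add_of_nonneg_of_le hη.le ?_
    rw [← div_pow, ← div_le_iff₀ hη]
    exact le_self_pow₀ ((one_le_div hη).2 h) (by omega)

theorem exists_neg_of_rieszProd_neg {W : Finset ℕ} {ω : Ω} (h : rieszProd f ρ 1 A W ω < 0) :
    ∃ w ∈ W, 1 < (ρ * signSum f (A w) ω) ^ 2 := by
  by_contra! hcon
  refine h.not_ge (Finset.prod_nonneg fun w hw => ?_)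
  have := (abs_le.1 ((sq_le_one_iff_abs_le_one _).1 (hcon w hw))).1
  rw [Pi.one_apply]
  linarith

variable [Fintype Ω]

theorem expect_mul_le_of_expect_pow_le [Nonempty Ω] {F G : Ω → ℝ} {b v η : ℝ} (hη : 0 < η)
    {m : ℕ} (hm : m ≠ 0) (hF0 : ∀ ω, 0 ≤ F ω) (hF : ∀ ω, F ω ≤ b)
    (hG : 𝔼 ω, G ω ^ (2 * m) ≤ v) (hbv : b * v ≤ η ^ (2 * m)) :
    𝔼 ω, F ω * G ω ≤ η * 𝔼 ω, F ω + η := by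
  have hb : 0 ≤ b := (hF0 (Classical.arbitrary Ω)).trans (hF _)
  have h_pointwise : ∀ ω, F ω * G ω ≤ η * F ω + b / η ^ (2 * m) * η * G ω ^ (2 * m) := fun ω => by
    have h_pow : 0 ≤ G ω ^ (2 * m) / η ^ (2 * m) * η := by
      rw [pow_mul]
      positivity
    calc F ω * G ω ≤ F ω * (η + G ω ^ (2 * m) / η ^ (2 * m) * η) :=
          mul_le_mul_of_nonneg_left (le_add_pow_div_mul hη hm) (hF0 ω)
      _ ≤ F ω * η + b * (G ω ^ (2 * m) / η ^ (2 * m) * η) := by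
          rw [mul_add]
          exact add_le_add_right (mul_le_mul_of_nonneg_right (hF ω) h_pow) _
      _ = _ := by ring
  calc 𝔼 ω, F ω * G ω ≤ 𝔼 ω, (η * F ω + b / η ^ (2 * m) * η * G ω ^ (2 * m)) :=
        Finset.expect_le_expect fun ω _ => h_pointwise ω
    _ = η * 𝔼 ω, F ω + b / η ^ (2 * m) * η * 𝔼 ω, G ω ^ (2 * m) := by
        rw [Finset.expect_add_distrib, ← Finset.mul_expect, ← Finset.mul_expect]
    _ ≤ η * 𝔼 ω, F ω + b / η ^ (2 * m) * η * v := by gcongr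
    _ = η * 𝔼 ω, F ω + b * v / η ^ (2 * m) * η := by ring
    _ ≤ η * 𝔼 ω, F ω + η := by
        gcongr
        exact mul_le_of_le_one_left hη.le (div_le_one_of_le₀ hbv (by positivity))

theorem IsSignFamily.expect_pairSum_pow_le [Nonempty Ω] (hf : IsSignFamily T n f)
    (A : Finset Scale) (hA : ∀ r ∈ A, ∑ i, r i = n) {m : ℕ} (hm : m ≠ 0) {τ : ℝ}
    (hτ : 0 ≤ τ) (hτm : 2 * (m : ℝ) ^ 2 * (n + 1) ≤ τ ^ 2) :
    𝔼 ω, pairSum f A ω ^ (2 * m) ≤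
      (8 * (m : ℝ) ^ 4 * (((n : ℝ) + 1) ^ 3 + (n + 1) ^ 3 * τ)) ^ m := by
  have h_coord : ∀ r ∈ A, ∀ i, r i ∈ Finset.range (n + 1) := fun r hr i => by
    rw [Finset.mem_range, Nat.lt_succ_iff]
    exact coord_le (hA r hr) i
  have h_mem : ∀ p ∈ {p ∈ A ×ˢ A | p.1 0 = p.2 0 ∧ p.1 1 < p.2 1},
      p.1 ∈ A ∧ IsCoincidence n 0 1 p := fun p hp => by
    obtain ⟨hp, h0, h1⟩ := Finset.mem_filter.1 hp
    obtain ⟨hr, hs⟩ := Finset.mem_product.1 hp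
    exact ⟨hr, hA _ hr, hA _ hs, h0, h1⟩
  refine (hf.expect_coincidences_pow_le (i := 0) (j := 1) (k := 2) (by decide) (by decide)
    (by decide) (fun p hp => (h_mem p hp).2) (Finset.range (n + 1)) (Finset.range (n + 1))
    (fun p hp => h_coord _ (h_mem p hp).1 _) (fun p hp => h_coord _ (h_mem p hp).1 _)
    hm hτ hτm).trans_eq ?_
  rw [Finset.card_range]
  push_cast
  ring_nf

theorem expect_rieszProd_range_succ_sq (hf : IsSignFamily T n f) (hblk : Monotone blk)
    (hA : IsBlocked n blk A) (t : ℕ) :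
    𝔼 ω, rieszProd f ρ 1 A (Finset.range (t + 1)) ω ^ 2 =
      (1 + ρ ^ 2 * (A t).card) * 𝔼 ω, rieszProd f ρ 1 A (Finset.range t) ω ^ 2 +
        𝔼 ω, rieszProd f ρ 1 A (Finset.range t) ω ^ 2 *
          (2 * ρ ^ 2 * pairSum f (A t) ω) := by
  set P := rieszProd f ρ 1 A (Finset.range t) with hP
  have hP_inv : ∀ r ∈ A t, ∀ ω, P (T 0 (r 0) ω) = P ω := fun r hr =>
    rieszProd_inv hf hA _ 0 _ fun w hw s hs => hA.lt hblk (Finset.mem_range.1 hw) hs hr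
  have h_expand : ∀ ω, rieszProd f ρ 1 A (Finset.range (t + 1)) ω ^ 2 =
      P ω ^ 2 + 2 * ρ * ∑ r ∈ A t, P ω ^ 2 * f r ω +
        ρ ^ 2 * (P ω ^ 2 * signSum f (A t) ω ^ 2) := fun ω => by
    rw [rieszProd, Finset.prod_range_succ, ← Finset.mul_sum]
    simp only [hP, rieszProd, signSum, Pi.one_apply]
    ring
  have h_odd : 𝔼 ω, ∑ r ∈ A t, P ω ^ 2 * f r ω = 0 := by
    rw [Finset.expect_sum_comm]
    exact Finset.sum_eq_zero fun r hr => expect_eq_zero_of_odd (T 0 (r 0)) fun ω => by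
      rw [hP_inv r hr, (hf.isHaarAt (hA t r hr).1 0).odd, mul_neg]
  simp only [h_expand, mul_left_comm _ (2 * ρ ^ 2) (pairSum f _ _)]
  rw [Finset.expect_add_distrib, Finset.expect_add_distrib, ← Finset.mul_expect,
    ← Finset.mul_expect, ← Finset.mul_expect, h_odd,
    expect_mul_signSum_sq hf (A t) (fun r hr => (hA t r hr).1) (fun ω => P ω ^ 2)
      (fun r hr ω => by simp only [hP_inv r hr])]
  ring

theorem expect_rieszProd_sq_le [Nonempty Ω] (hf : IsSignFamily T n f) (hblk : Monotone blk)
    (hA : IsBlocked n blk A) {q m : ℕ} (hm : m ≠ 0) {x η B τ : ℝ} (hη : 0 < η)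
    (hx : ∀ w, ρ ^ 2 * (A w).card ≤ x) (hB : ∀ w, 1 + |ρ| * (A w).card ≤ B)
    (hτ : 0 ≤ τ) (hτm : 2 * (m : ℝ) ^ 2 * (n + 1) ≤ τ ^ 2)
    (hη_large : (B ^ q) ^ 2 * (4 * ρ ^ 4 * (8 * (m : ℝ) ^ 4 * (((n : ℝ) + 1) ^ 3 +
      (n + 1) ^ 3 * τ))) ^ m ≤ η ^ (2 * m)) :
    𝔼 ω, rieszProd f ρ 1 A (Finset.range q) ω ^ 2 ≤ (1 + x + 2 * η) ^ q := by
  have hx0 : 0 ≤ x := (hx 0).trans' (by positivity)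
  have hB1 : 1 ≤ B := (hB 0).trans' (le_add_of_nonneg_right (by positivity))
  suffices h : ∀ t ≤ q, 𝔼 ω, rieszProd f ρ 1 A (Finset.range t) ω ^ 2 ≤
      (1 + x + 2 * η) ^ t from h q le_rfl
  intro t ht
  induction t with
  | zero => simp [rieszProd]
  | succ t ih =>
    have h_sup : ∀ ω, rieszProd f ρ 1 A (Finset.range t) ω ^ 2 ≤ (B ^ q) ^ 2 := fun ω => by
      rw [← sq_abs]
      refine pow_le_pow_left₀ (abs_nonneg _) ((abs_rieszProd_le hf hA hB _ ω).trans ?_) 2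
      rw [Finset.card_range]
      exact pow_le_pow_right₀ hB1 (by omega)
    have h_pair : 𝔼 ω, (2 * ρ ^ 2 * pairSum f (A t) ω) ^ (2 * m) ≤
        (4 * ρ ^ 4 * (8 * (m : ℝ) ^ 4 * (((n : ℝ) + 1) ^ 3 + (n + 1) ^ 3 * τ))) ^ m := by
      have h_pow : (2 * ρ ^ 2) ^ (2 * m) = (4 * ρ ^ 4) ^ m := by rw [pow_mul]; ring_nf
      simp only [mul_pow (2 * ρ ^ 2), h_pow, ← Finset.mul_expect]
      rw [mul_pow (4 * ρ ^ 4)]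
      gcongr
      exact hf.expect_pairSum_pow_le (A t) (fun r hr => (hA t r hr).1) hm hτ hτm
    have h_cross := expect_mul_le_of_expect_pow_le hη hm (fun _ => sq_nonneg _) h_sup h_pair
      hη_large
    have : 0 ≤ 𝔼 ω, rieszProd f ρ 1 A (Finset.range t) ω ^ 2 :=
      Finset.expect_nonneg fun _ _ => sq_nonneg _
    have h_one : 1 ≤ (1 + x + 2 * η) ^ t := one_le_pow₀ (by linarith)
    calc 𝔼 ω, rieszProd f ρ 1 A (Finset.range (t + 1)) ω ^ 2
        ≤ (1 + x) * 𝔼 ω, rieszProd f ρ 1 A (Finset.range t) ω ^ 2 +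
          (η * 𝔼 ω, rieszProd f ρ 1 A (Finset.range t) ω ^ 2 + η) := by
          rw [expect_rieszProd_range_succ_sq hf hblk hA]
          gcongr
          exact hx t
      _ = (1 + x + η) * 𝔼 ω, rieszProd f ρ 1 A (Finset.range t) ω ^ 2 + η * 1 := by ring
      _ ≤ (1 + x + η) * (1 + x + 2 * η) ^ t + η * (1 + x + 2 * η) ^ t := by
          gcongr
          exact ih (by omega)
      _ = (1 + x + 2 * η) ^ (t + 1) := by ring

theorem expect_indicator_rieszProd_neg_le [Nonempty Ω] (hf : IsSignFamily T n f)
    (hA : IsBlocked n blk A) {x : ℝ} (hx : ∀ w, ρ ^ 2 * (A w).card ≤ x) (W : Finset ℕ) (m : ℕ) :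
    𝔼 ω, (if rieszProd f ρ 1 A W ω < 0 then 1 else 0 : ℝ) ≤
      W.card * (4 * (m : ℝ) ^ 4 * x) ^ m := by
  have h_pointwise : ∀ ω, (if rieszProd f ρ 1 A W ω < 0 then 1 else 0 : ℝ) ≤
      ∑ w ∈ W, (ρ ^ 2) ^ m * signSum f (A w) ω ^ (2 * m) := fun ω => by
    have h_nonneg : ∀ w ∈ W, 0 ≤ (ρ ^ 2) ^ m * signSum f (A w) ω ^ (2 * m) := fun w _ => by
      rw [pow_mul]
      positivity
    split_ifs with h
    · obtain ⟨w, hw, hlt⟩ := exists_neg_of_rieszProd_neg h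
      refine le_trans ?_ (Finset.single_le_sum h_nonneg hw)
      rw [pow_mul, ← mul_pow, ← mul_pow]
      exact one_le_pow₀ hlt.le
    · exact Finset.sum_nonneg h_nonneg
  calc _ ≤ 𝔼 ω, ∑ w ∈ W, (ρ ^ 2) ^ m * signSum f (A w) ω ^ (2 * m) :=
        Finset.expect_le_expect fun ω _ => h_pointwise ω
    _ = ∑ w ∈ W, (ρ ^ 2) ^ m * 𝔼 ω, signSum f (A w) ω ^ (2 * m) := by
        simp only [Finset.expect_sum_comm, ← Finset.mul_expect]
    _ ≤ ∑ w ∈ W, (ρ ^ 2) ^ m * (4 * (m : ℝ) ^ 4 * (A w).card) ^ m := by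
        gcongr with w
        exact hf.expect_sum_pow_le (A w) (fun r hr => (hA w r hr).1) m
    _ = ∑ w ∈ W, (4 * (m : ℝ) ^ 4 * (ρ ^ 2 * (A w).card)) ^ m := by
        simp only [← mul_pow, mul_left_comm (ρ ^ 2)]
    _ ≤ ∑ _w ∈ W, (4 * (m : ℝ) ^ 4 * x) ^ m := by
        gcongr with w
        exact hx w
    _ = _ := by rw [Finset.sum_const, nsmul_eq_mul]

/-- The product has mean `1`, and it is rarely negative because its factors are. -/
theorem expect_abs_rieszProd_le [Nonempty Ω] (hf : IsSignFamily T n f) (hblk : Monotone blk)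
    (hA : IsBlocked n blk A) {m : ℕ} {x y : ℝ} (W : Finset ℕ)
    (hx : ∀ w, ρ ^ 2 * (A w).card ≤ x) (hy : 𝔼 ω, rieszProd f ρ 1 A W ω ^ 2 ≤ y)
    (h_small : y * (W.card * (4 * (m : ℝ) ^ 4 * x) ^ m) ≤ 1 / 4) :
    𝔼 ω, |rieszProd f ρ 1 A W ω| ≤ 2 := by
  set P := rieszProd f ρ 1 A W with hP
  set I : Ω → ℝ := fun ω => if P ω < 0 then 1 else 0 with hI
  have h_mean : 𝔼 ω, P ω = 1 := by simp [hP, expect_rieszProd hf hblk hA]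
  have h_abs : ∀ ω, |P ω| = P ω + 2 * (|P ω| * I ω) := fun ω => by
    rcases lt_or_ge (P ω) 0 with h | h
    · simp only [hI, if_pos h, abs_of_neg h]
      ring
    · simp only [hI, if_neg h.not_gt, abs_of_nonneg h]
      ring
  have hI_sq : ∀ ω, I ω ^ 2 = I ω := fun ω => by simp [hI]
  have hI_nonneg : ∀ ω, 0 ≤ I ω := fun ω => hI_sq ω ▸ sq_nonneg _
  have h_neg : 𝔼 ω, |P ω| * I ω ≤ 1 / 2 := by
    refine le_of_sq_le_sq ?_ (by norm_num)
    calc (𝔼 ω, |P ω| * I ω) ^ 2 ≤ (𝔼 ω, |P ω| ^ 2) * 𝔼 ω, I ω ^ 2 :=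
          Finset.expect_mul_sq_le_sq_mul_sq _ _ _
      _ = (𝔼 ω, P ω ^ 2) * 𝔼 ω, I ω := by simp only [sq_abs, hI_sq]
      _ ≤ y * (W.card * (4 * (m : ℝ) ^ 4 * x) ^ m) :=
          mul_le_mul hy (expect_indicator_rieszProd_neg_le hf hA hx W m)
            (Finset.expect_nonneg fun ω _ => hI_nonneg ω)
            (hy.trans' (Finset.expect_nonneg fun _ _ => sq_nonneg _))
      _ ≤ (1 / 2) ^ 2 := h_small.trans_eq (by norm_num)
  calc 𝔼 ω, |P ω| = 𝔼 ω, (P ω + 2 * (|P ω| * I ω)) := Finset.expect_congr rfl fun ω _ => h_abs ω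
    _ = 1 + 2 * 𝔼 ω, |P ω| * I ω := by
        rw [Finset.expect_add_distrib, ← Finset.mul_expect, h_mean]
    _ ≤ 2 := by linarith

theorem expect_abs_pow_mul_abs_le {g P : Ω → ℝ} {m : ℕ} {σ b : ℝ} (hσ : 0 ≤ σ)
    (hg : 𝔼 ω, g ω ^ (2 * m) ≤ (σ ^ 2) ^ m) (hb : 0 ≤ b) (hP : 𝔼 ω, P ω ^ 2 ≤ b ^ 2) :
    𝔼 ω, |g ω| ^ m * |P ω| ≤ σ ^ m * b := by
  refine le_of_sq_le_sq ?_ (by positivity)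
  calc (𝔼 ω, |g ω| ^ m * |P ω|) ^ 2 ≤ (𝔼 ω, (|g ω| ^ m) ^ 2) * 𝔼 ω, |P ω| ^ 2 :=
        Finset.expect_mul_sq_le_sq_mul_sq _ _ _
    _ = (𝔼 ω, g ω ^ (2 * m)) * 𝔼 ω, P ω ^ 2 := by
        simp only [← pow_mul, mul_comm m 2, (even_two_mul m).pow_abs, sq_abs]
    _ ≤ (σ ^ 2) ^ m * b ^ 2 :=
        mul_le_mul hg hP (Finset.expect_nonneg fun _ _ => sq_nonneg _) (by positivity)
    _ = (σ ^ m * b) ^ 2 := by rw [mul_pow, pow_right_comm]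

/-- Where `|g| ≤ 2 * σ` the first moment of `P` is used; elsewhere `|g|` is at most
`|g| ^ m / (2 * σ) ^ (m - 1)`, and the second moment of `P` suffices although it may be
exponentially large in `m`. -/
theorem expect_abs_mul_le {g P : Ω → ℝ} {m : ℕ} {σ : ℝ} (hσ : 0 < σ) (hm : m ≠ 0)
    (hg : 𝔼 ω, g ω ^ (2 * m) ≤ (σ ^ 2) ^ m) (hP_one : 𝔼 ω, |P ω| ≤ 2)
    (hP_two : 𝔼 ω, P ω ^ 2 ≤ 4 ^ (m - 1)) :
    𝔼 ω, |g ω * P ω| ≤ 5 * σ := by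
  obtain ⟨m, rfl⟩ := Nat.exists_eq_succ_of_ne_zero hm
  simp only [Nat.succ_eq_add_one, Nat.add_sub_cancel] at *
  have h_pointwise : ∀ ω, |g ω * P ω| ≤
      2 * σ * |P ω| + ((2 * σ) ^ m)⁻¹ * (|g ω| ^ (m + 1) * |P ω|) := fun ω => by
    rw [abs_mul, ← mul_assoc, ← add_mul]
    gcongr
    rcases le_total |g ω| (2 * σ) with h | h
    · exact le_add_of_le_of_nonneg h (by positivity)
    · refine le_add_of_nonneg_of_le (by positivity) ?_
      rw [pow_succ, ← mul_assoc]
      refine le_mul_of_one_le_left (abs_nonneg _) ?_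
      rw [← div_eq_inv_mul, one_le_div (by positivity)]
      gcongr
  have h_large : 𝔼 ω, |g ω| ^ (m + 1) * |P ω| ≤ σ ^ (m + 1) * 2 ^ m :=
    expect_abs_pow_mul_abs_le hσ.le hg (by positivity) (by
      rwa [pow_right_comm, show (2 : ℝ) ^ 2 = 4 by norm_num])
  calc 𝔼 ω, |g ω * P ω|
      ≤ 𝔼 ω, (2 * σ * |P ω| + ((2 * σ) ^ m)⁻¹ * (|g ω| ^ (m + 1) * |P ω|)) :=
        Finset.expect_le_expect fun ω _ => h_pointwise ω
    _ = 2 * σ * 𝔼 ω, |P ω| + ((2 * σ) ^ m)⁻¹ * 𝔼 ω, |g ω| ^ (m + 1) * |P ω| := by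
        rw [Finset.expect_add_distrib, ← Finset.mul_expect, ← Finset.mul_expect]
    _ ≤ 2 * σ * 2 + ((2 * σ) ^ m)⁻¹ * (σ ^ (m + 1) * 2 ^ m) := by gcongr
    _ = 5 * σ := by
        rw [mul_pow]
        field_simp
        ring

end RieszMoments

section MomentBounds

variable {Ω : Type*} [Fintype Ω]

/-- The moments of `g` of even order up to `2 * M` are bounded by those of the constant `√v`. -/
structure HasMoments (M : ℕ) (g : Ω → ℝ) (v : ℝ) : Prop where
  pos : 0 < v
  le : ∀ m ≤ M, 𝔼 ω, g ω ^ (2 * m) ≤ v ^ m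

theorem HasMoments.mono {M M' : ℕ} {g : Ω → ℝ} {v v' : ℝ} (h : HasMoments M g v) (hM : M' ≤ M)
    (hv : v ≤ v') : HasMoments M' g v' :=
  ⟨h.pos.trans_le hv, fun m hm =>
    (h.le m (hm.trans hM)).trans (pow_le_pow_left₀ h.pos.le hv m)⟩

theorem hasMoments_one [Nonempty Ω] (M : ℕ) : HasMoments M (fun _ : Ω => (1 : ℝ)) 1 :=
  ⟨one_pos, fun m _ => by simp⟩

theorem HasMoments.mul {M : ℕ} {g h : Ω → ℝ} {v w : ℝ} (hg : HasMoments (2 * M) g v)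
    (hh : HasMoments (2 * M) h w) : HasMoments M (fun ω => g ω * h ω) (v * w) := by
  refine ⟨mul_pos hg.pos hh.pos, fun m hm => ?_⟩
  have hv := hg.pos
  have hw := hh.pos
  refine le_of_sq_le_sq ?_ (by positivity)
  calc (𝔼 ω, (g ω * h ω) ^ (2 * m)) ^ 2 = (𝔼 ω, g ω ^ (2 * m) * h ω ^ (2 * m)) ^ 2 := by
        simp only [mul_pow]
    _ ≤ (𝔼 ω, (g ω ^ (2 * m)) ^ 2) * 𝔼 ω, (h ω ^ (2 * m)) ^ 2 :=
        Finset.expect_mul_sq_le_sq_mul_sq _ _ _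
    _ = (𝔼 ω, g ω ^ (2 * (2 * m))) * 𝔼 ω, h ω ^ (2 * (2 * m)) := by
        simp only [← pow_mul, mul_comm _ 2]
    _ ≤ v ^ (2 * m) * w ^ (2 * m) :=
        mul_le_mul (hg.le _ (by omega)) (hh.le _ (by omega))
          (Finset.expect_nonneg fun _ _ => (even_two_mul _).pow_nonneg _) (by positivity)
    _ = ((v * w) ^ m) ^ 2 := by ring

theorem prod_le_sum_pow_div_card {ι : Type*} (s : Finset ι) (hs : s.Nonempty) (z : ι → ℝ)
    (hz : ∀ i ∈ s, 0 ≤ z i) : ∏ i ∈ s, z i ≤ (∑ i ∈ s, z i ^ s.card) / s.card := by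
  have h_card : (s.card : ℝ) ≠ 0 := by exact_mod_cast hs.card_pos.ne'
  calc ∏ i ∈ s, z i = ∏ i ∈ s, (z i ^ s.card) ^ (s.card : ℝ)⁻¹ :=
        Finset.prod_congr rfl fun i hi =>
          (Real.pow_rpow_inv_natCast (hz i hi) hs.card_pos.ne').symm
    _ ≤ ∑ i ∈ s, (s.card : ℝ)⁻¹ * z i ^ s.card :=
        Real.geom_mean_le_arith_mean_weighted s _ _ (fun _ _ => by positivity) (by simp [h_card])
          fun i hi => pow_nonneg (hz i hi) _
    _ = _ := by rw [← Finset.mul_sum, div_eq_inv_mul]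

theorem expect_prod_pow_le_one {ι : Type*} [Nonempty Ω] (s : Finset ι) {g : ι → Ω → ℝ} {l : ℕ}
    (h : ∀ i ∈ s, 𝔼 ω, g i ω ^ (2 * (l * s.card)) ≤ 1) :
    𝔼 ω, (∏ i ∈ s, g i ω) ^ (2 * l) ≤ 1 := by
  rcases s.eq_empty_or_nonempty with rfl | hs
  · simp
  have h_card : (s.card : ℝ) ≠ 0 := by exact_mod_cast hs.card_pos.ne'
  calc 𝔼 ω, (∏ i ∈ s, g i ω) ^ (2 * l)
      ≤ 𝔼 ω, (∑ i ∈ s, (g i ω ^ (2 * l)) ^ s.card) / s.card :=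
        Finset.expect_le_expect fun ω _ => by
          rw [← Finset.prod_pow]
          exact prod_le_sum_pow_div_card s hs _ fun i _ => (even_two_mul l).pow_nonneg _
    _ = (∑ i ∈ s, 𝔼 ω, g i ω ^ (2 * (l * s.card))) / s.card := by
        simp only [← Finset.expect_div, Finset.expect_sum_comm, ← pow_mul, mul_assoc]
    _ ≤ (∑ _i ∈ s, 1) / s.card := by
        gcongr with i hi
        exact h i hi
    _ = 1 := by rw [Finset.sum_const, nsmul_one, div_self h_card]

theorem HasMoments.prod {ι : Type*} [Nonempty Ω] {M m : ℕ} (s : Finset ι) {g : ι → Ω → ℝ}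
    {v : ι → ℝ} (h : ∀ i ∈ s, HasMoments M (g i) (v i)) (hm : m * s.card ≤ M) :
    HasMoments m (fun ω => ∏ i ∈ s, g i ω) (∏ i ∈ s, v i) := by
  have h_pos : 0 < ∏ i ∈ s, v i := Finset.prod_pos fun i hi => (h i hi).pos
  refine ⟨h_pos, fun l hl => ?_⟩
  have h_scale : ∀ v : ℝ, 0 < v → ∀ x : ℝ, ∀ k : ℕ, (x / √v) ^ (2 * k) = x ^ (2 * k) / v ^ k :=
    fun v hv x k => by rw [div_pow, pow_mul √v, Real.sq_sqrt hv.le]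
  have h_one := expect_prod_pow_le_one s (g := fun i ω => g i ω / √(v i)) (l := l) fun i hi => by
    have hv := (h i hi).pos
    simp only [h_scale _ hv, ← Finset.expect_div]
    exact div_le_one_of_le₀ ((h i hi).le _ ((Nat.mul_le_mul_right _ hl).trans hm))
      (by positivity)
  simp only [Finset.prod_div_distrib, ← Real.sqrt_prod s fun i hi => (h i hi).pos.le] at h_one
  simp only [h_scale _ h_pos, ← Finset.expect_div] at h_one
  rwa [div_le_one (by positivity)] at h_one

variable {T : Fin 3 → ℕ → Equiv.Perm Ω} {n : ℕ} {f : Scale → Ω → ℝ} {blk : ℕ → ℕ} {ρ : ℝ}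

theorem IsSignFamily.hasMoments [Nonempty Ω] (hf : IsSignFamily T n f) (hρ : 0 < ρ)
    {A : Finset Scale} (hA : ∀ r ∈ A, ∑ i, r i = n) {M : ℕ} (hM : 0 < M) {a v : ℝ}
    (ha : 0 < a) (hcard : (A.card : ℝ) ≤ a) (hv : 4 * (M : ℝ) ^ 4 * ρ ^ 2 * a ≤ v) :
    HasMoments M (fun ω => ρ * signSum f A ω) v := by
  refine ⟨hv.trans_lt' (by positivity), fun m hm => ?_⟩
  calc 𝔼 ω, (ρ * signSum f A ω) ^ (2 * m)
      = (ρ ^ 2) ^ m * 𝔼 ω, signSum f A ω ^ (2 * m) := by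
        simp only [mul_pow ρ, pow_mul ρ, Finset.mul_expect]
    _ ≤ (ρ ^ 2) ^ m * (4 * (m : ℝ) ^ 4 * A.card) ^ m := by
        gcongr
        exact hf.expect_sum_pow_le A hA m
    _ = (4 * (m : ℝ) ^ 4 * ρ ^ 2 * A.card) ^ m := by rw [← mul_pow]; ring_nf
    _ ≤ (4 * (M : ℝ) ^ 4 * ρ ^ 2 * a) ^ m := by gcongr
    _ ≤ v ^ m := by gcongr

/-- Control of the first two moments of the Riesz products of `f` over `q` blocks, uniform over the
choice of blocks. -/
structure RieszControl (f : Scale → Ω → ℝ) (n : ℕ) (blk : ℕ → ℕ) (q : ℕ) (ρ : ℝ)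
    (m : ℕ) : Prop where
  first : ∀ A, IsBlocked n blk A → 𝔼 ω, |rieszProd f ρ 1 A (Finset.range q) ω| ≤ 2
  second : ∀ A, IsBlocked n blk A → 𝔼 ω, rieszProd f ρ 1 A (Finset.range q) ω ^ 2 ≤ 4 ^ (m - 1)

theorem RieszControl.expect_abs_mul_prod_mul_rieszProd_le [Nonempty Ω] {q m : ℕ}
    (hR : RieszControl f n blk q ρ m) (hm : m ≠ 0) {A : ℕ → Finset Scale}
    (hA : IsBlocked n blk A) {U V : Finset ℕ} (hU : U ⊆ Finset.range q)
    (hV : V ⊆ Finset.range q) {M : ℕ} {G : Ω → ℝ} {vG : ℝ} (hG : HasMoments M G vG)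
    {g : ℕ → Ω → ℝ} {v : ℕ → ℝ} (hg : ∀ w ∈ V, HasMoments M (g w) (v w))
    (hM : 2 * m * (q + 1) ≤ M) {σ : ℝ} (hσ : 0 < σ) (hv : vG * ∏ w ∈ V, v w ≤ σ ^ 2) :
    𝔼 ω, |G ω * (∏ w ∈ V, g w ω) * rieszProd f ρ 1 A U ω| ≤ 5 * σ := by
  have hV_card : V.card ≤ q := by simpa using Finset.card_le_card hV
  have hA_restrict : IsBlocked n blk (fun w => if w ∈ U then A w else ∅) := fun w r hr => by
    dsimp only at hr
    split_ifs at hr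
    · exact hA w r hr
    · simp at hr
  have h_prod : HasMoments (2 * m) (fun ω => ∏ w ∈ V, g w ω) (∏ w ∈ V, v w) :=
    HasMoments.prod V hg (hM.trans' (by gcongr; omega))
  have h_mul := ((hG.mono (hM.trans' (Nat.le_mul_of_pos_right _ q.succ_pos)) le_rfl).mul
    h_prod).mono le_rfl hv
  simp only [rieszProd_one_subset A hU]
  exact expect_abs_mul_le hσ hm (h_mul.le m le_rfl) (hR.first _ hA_restrict)
    (hR.second _ hA_restrict)

end MomentBounds

section Terms

/-- The scales of order `n` in block `w` with second coordinate in `C` and third one in `D`. -/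
def boxScales (n : ℕ) (blk : ℕ → ℕ) (C D : Finset ℕ) (w : ℕ) : Finset Scale :=
  {r ∈ Finset.Nat.antidiagonalTuple 3 n | blk (r 0) = w ∧ r 1 ∈ C ∧ r 2 ∈ D}

/-- The values which a coordinate may take in block `w` if its maximum over all blocks is `c` and
the blocks attaining the maximum are those in `V`. -/
def allowed (c : ℕ) (V : Finset ℕ) (w : ℕ) : Finset ℕ :=
  if w ∈ V then {c} else Finset.range c

/-- The part of the Riesz product over the blocks `0, …, q - 1` in which the second coordinate has
its maximum `c` exactly in the blocks of `V`, and the third its maximum `d` exactly in the blocks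
of `V'`. -/
def rieszTerm {Ω : Type*} (f : Scale → Ω → ℝ) (n : ℕ) (blk : ℕ → ℕ) (q : ℕ) (ρ : ℝ) (c d : ℕ)
    (V V' : Finset ℕ) (ω : Ω) : ℝ :=
  rieszProd f ρ (fun w => if w ∈ V ∪ V' then 0 else 1)
    (fun w => boxScales n blk (allowed c V w) (allowed d V' w) w) (Finset.range q) ω

theorem le_of_mem_allowed {c w a : ℕ} {V : Finset ℕ} (ha : a ∈ allowed c V w) : a ≤ c := by
  rw [allowed] at ha
  split_ifs at ha
  · exact (Finset.mem_singleton.1 ha).le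
  · exact (Finset.mem_range.1 ha).le

theorem mem_boxScales {n : ℕ} {blk : ℕ → ℕ} {C D : Finset ℕ} {w : ℕ} {r : Scale} :
    r ∈ boxScales n blk C D w ↔ ∑ i, r i = n ∧ blk (r 0) = w ∧ r 1 ∈ C ∧ r 2 ∈ D := by
  rw [boxScales, Finset.mem_filter, Finset.Nat.mem_antidiagonalTuple]

theorem isBlocked_boxScales {n : ℕ} {blk : ℕ → ℕ} (C D : ℕ → Finset ℕ) :
    IsBlocked n blk fun w => boxScales n blk (C w) (D w) w :=
  fun _ _ hr => ⟨(mem_boxScales.1 hr).1, (mem_boxScales.1 hr).2.1⟩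

variable {Ω : Type*} {T : Fin 3 → ℕ → Equiv.Perm Ω} {n : ℕ} {f : Scale → Ω → ℝ} {blk : ℕ → ℕ}
  {q : ℕ} {ρ : ℝ}

theorem signSum_boxScales_empty_left (D : Finset ℕ) (w : ℕ) (ω : Ω) :
    signSum f (boxScales n blk ∅ D w) ω = 0 := by
  simp [signSum, boxScales]

theorem signSum_boxScales_union {C₁ C₂ : Finset ℕ} (hC : Disjoint C₁ C₂) (D : Finset ℕ) (w : ℕ)
    (ω : Ω) :
    signSum f (boxScales n blk (C₁ ∪ C₂) D w) ω =
      signSum f (boxScales n blk C₁ D w) ω + signSum f (boxScales n blk C₂ D w) ω := by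
  rw [signSum, signSum, signSum, ← Finset.sum_union]
  · refine Finset.sum_congr ?_ fun _ _ => rfl
    ext r
    simp only [Finset.mem_union, mem_boxScales]
    tauto
  · exact Finset.disjoint_left.2 fun r h₁ h₂ =>
      Finset.disjoint_left.1 hC (mem_boxScales.1 h₁).2.2.1 (mem_boxScales.1 h₂).2.2.1

theorem rieszTerm_succ (c d : ℕ) (V' : Finset ℕ) (ω : Ω) :
    rieszTerm f n blk q ρ (c + 1) d ∅ V' ω =
      ∑ V ∈ (Finset.range q).powerset, rieszTerm f n blk q ρ c d V V' ω := by
  have h_factor : ∀ w, (if w ∈ ∅ ∪ V' then (0 : ℝ) else 1) +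
      ρ * signSum f (boxScales n blk (allowed (c + 1) ∅ w) (allowed d V' w) w) ω =
      ρ * signSum f (boxScales n blk {c} (allowed d V' w) w) ω +
      ((if w ∈ V' then (0 : ℝ) else 1) +
        ρ * signSum f (boxScales n blk (Finset.range c) (allowed d V' w) w) ω) := fun w => by
    rw [allowed, if_neg (Finset.notMem_empty w), Finset.range_add_one, Finset.insert_eq,
      signSum_boxScales_union (by simp), Finset.empty_union]
    ring
  rw [rieszTerm, rieszProd, Finset.prod_congr rfl fun w _ => h_factor w, Finset.prod_add]
  refine Finset.sum_congr rfl fun V hV => ?_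
  rw [rieszTerm, rieszProd, ← Finset.prod_sdiff (Finset.mem_powerset.1 hV), mul_comm]
  congr 1
  · refine Finset.prod_congr rfl fun w hw => ?_
    simp [allowed, (Finset.mem_sdiff.1 hw).2]
  · refine Finset.prod_congr rfl fun w hw => ?_
    simp [allowed, hw]

theorem rieszTerm_sub_rieszTerm_zero (c d : ℕ) (V' : Finset ℕ) (ω : Ω) :
    rieszTerm f n blk q ρ c d ∅ V' ω - rieszTerm f n blk q ρ 0 d ∅ V' ω =
      ∑ b ∈ Finset.range c, ∑ V ∈ (Finset.range q).powerset.erase ∅,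
        rieszTerm f n blk q ρ b d V V' ω := by
  rw [← Finset.sum_range_sub fun b => rieszTerm f n blk q ρ b d ∅ V' ω]
  refine Finset.sum_congr rfl fun b _ => ?_
  rw [rieszTerm_succ, ← Finset.add_sum_erase _ _ (Finset.empty_mem_powerset _), add_sub_cancel_left]

theorem rieszTerm_zero_of_nonempty (d : ℕ) {V' : Finset ℕ} (hV' : V'.Nonempty)
    (hV'q : V' ⊆ Finset.range q) (ω : Ω) : rieszTerm f n blk q ρ 0 d ∅ V' ω = 0 := by
  obtain ⟨w, hw⟩ := hV'
  refine Finset.prod_eq_zero (hV'q hw) ?_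
  simp [hw, allowed, signSum_boxScales_empty_left]

theorem rieszTerm_zero_empty (d : ℕ) (ω : Ω) : rieszTerm f n blk q ρ 0 d ∅ ∅ ω = 1 := by
  rw [rieszTerm, rieszProd]
  exact Finset.prod_eq_one fun w _ => by simp [allowed, signSum_boxScales_empty_left]

/-- Exchange of the second and third coordinates. -/
def swapCoord : Equiv.Perm (Fin 3) := Equiv.swap 1 2

theorem swapCoord_swapCoord (i : Fin 3) : swapCoord (swapCoord i) = i :=
  Equiv.swap_apply_self _ _ _

theorem comp_swapCoord_comp_swapCoord (r : Scale) : (r ∘ swapCoord) ∘ swapCoord = r :=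
  funext fun i => congrArg r (swapCoord_swapCoord i)

/-- The family with second and third coordinates exchanged. -/
def swapFamily (f : Scale → Ω → ℝ) : Scale → Ω → ℝ := fun r => f (r ∘ swapCoord)

theorem IsSignFamily.swap (hf : IsSignFamily T n f) :
    IsSignFamily (fun i => T (swapCoord i)) n (swapFamily f) := fun r hr => by
  obtain ⟨h_haar, h_sq⟩ := hf (r ∘ swapCoord) (by rw [← hr]; exact Equiv.sum_comp swapCoord r)
  refine ⟨fun i => ?_, h_sq⟩
  simpa only [swapFamily, Function.comp_apply, swapCoord_swapCoord] using h_haar (swapCoord i)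

theorem comp_swapCoord_mem_boxScales {C D : Finset ℕ} {w : ℕ} {r : Scale}
    (hr : r ∈ boxScales n blk C D w) : r ∘ swapCoord ∈ boxScales n blk D C w := by
  obtain ⟨h_sum, h0, h1, h2⟩ := mem_boxScales.1 hr
  exact mem_boxScales.2 ⟨by rw [← h_sum]; exact Equiv.sum_comp swapCoord r, h0, h2, h1⟩

theorem signSum_swapFamily (C D : Finset ℕ) (w : ℕ) (ω : Ω) :
    signSum (swapFamily f) (boxScales n blk C D w) ω = signSum f (boxScales n blk D C w) ω :=
  Finset.sum_nbij' (· ∘ swapCoord) (· ∘ swapCoord)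
    (fun _ hr => comp_swapCoord_mem_boxScales hr) (fun _ hr => comp_swapCoord_mem_boxScales hr)
    (fun r _ => comp_swapCoord_comp_swapCoord r) (fun r _ => comp_swapCoord_comp_swapCoord r)
    fun _ _ => rfl

theorem rieszTerm_swap (c d : ℕ) (V V' : Finset ℕ) (ω : Ω) :
    rieszTerm (swapFamily f) n blk q ρ c d V V' ω = rieszTerm f n blk q ρ d c V' V ω := by
  rw [rieszTerm, rieszTerm, rieszProd, rieszProd]
  exact Finset.prod_congr rfl fun w _ => by rw [Finset.union_comm, signSum_swapFamily]

/-- The part of the Riesz product in which the second coordinate attains its maximum exactly in the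
blocks of `V`, and the third exactly in the blocks of `V'`. -/
def maximaPart (f : Scale → Ω → ℝ) (n : ℕ) (blk : ℕ → ℕ) (q : ℕ) (ρ : ℝ) (V V' : Finset ℕ)
    (ω : Ω) : ℝ :=
  ∑ c ∈ Finset.range (n + 1), ∑ d ∈ Finset.range (n + 1), rieszTerm f n blk q ρ c d V V' ω

/-- The part of the Riesz product in which the maxima of both coordinates are not repeated. -/
def mainPart (f : Scale → Ω → ℝ) (n : ℕ) (blk : ℕ → ℕ) (q : ℕ) (ρ : ℝ) (ω : Ω) : ℝ :=
  ∑ t ∈ Finset.range q, ∑ u ∈ Finset.range q, maximaPart f n blk q ρ {t} {u} ω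

/-- The part in which the maximum of the second coordinate is repeated, for given data `d`, `V'` of
the third. -/
def repeatedPart (f : Scale → Ω → ℝ) (n : ℕ) (blk : ℕ → ℕ) (q : ℕ) (ρ : ℝ) (d : ℕ)
    (V' : Finset ℕ) (ω : Ω) : ℝ :=
  ∑ V ∈ (Finset.range q).powerset with 2 ≤ V.card,
    ∑ c ∈ Finset.range (n + 1), rieszTerm f n blk q ρ c d V V' ω

theorem maximaPart_swap (V V' : Finset ℕ) (ω : Ω) :
    maximaPart (swapFamily f) n blk q ρ V V' ω = maximaPart f n blk q ρ V' V ω := by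
  simp only [maximaPart, rieszTerm_swap]
  exact Finset.sum_comm

theorem sum_rieszTerm_eq_sum_maximaPart_left {V' : Finset ℕ} (hne : V' ≠ ∅)
    (hV' : V' ⊆ Finset.range q) (ω : Ω) :
    ∑ d ∈ Finset.range (n + 1), rieszTerm f n blk q ρ (n + 1) d ∅ V' ω =
      ∑ V ∈ (Finset.range q).powerset.erase ∅, maximaPart f n blk q ρ V V' ω := by
  have h_term : ∀ d, rieszTerm f n blk q ρ (n + 1) d ∅ V' ω =
      ∑ c ∈ Finset.range (n + 1), ∑ V ∈ (Finset.range q).powerset.erase ∅,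
        rieszTerm f n blk q ρ c d V V' ω := fun d => by
    rw [← rieszTerm_sub_rieszTerm_zero, rieszTerm_zero_of_nonempty d
      (Finset.nonempty_iff_ne_empty.2 hne) hV', sub_zero]
  simp only [h_term, maximaPart]
  rw [Finset.sum_comm, Finset.sum_congr rfl fun c _ => Finset.sum_comm, Finset.sum_comm]

theorem sum_rieszTerm_eq_sum_maximaPart_right {V : Finset ℕ} (hne : V ≠ ∅)
    (hV : V ⊆ Finset.range q) (ω : Ω) :
    ∑ c ∈ Finset.range (n + 1), rieszTerm f n blk q ρ c (n + 1) V ∅ ω =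
      ∑ V' ∈ (Finset.range q).powerset.erase ∅, maximaPart f n blk q ρ V V' ω := by
  simp only [← rieszTerm_swap (f := f), ← maximaPart_swap (f := f)]
  exact sum_rieszTerm_eq_sum_maximaPart_left hne hV ω

theorem rieszTerm_sub_one (ω : Ω) :
    rieszTerm f n blk q ρ (n + 1) (n + 1) ∅ ∅ ω - 1 =
      ∑ V ∈ (Finset.range q).powerset.erase ∅, ∑ V' ∈ (Finset.range q).powerset.erase ∅,
        maximaPart f n blk q ρ V V' ω := by
  rw [← rieszTerm_zero_empty (f := f) (n := n) (blk := blk) (q := q) (ρ := ρ) (n + 1) ω,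
    rieszTerm_sub_rieszTerm_zero, Finset.sum_comm]
  refine Finset.sum_congr rfl fun V hV => ?_
  obtain ⟨hne, hV⟩ := Finset.mem_erase.1 hV
  exact sum_rieszTerm_eq_sum_maximaPart_right hne (Finset.mem_powerset.1 hV) ω

theorem sum_powerset_card_ge {α : Type*} (s : Finset α) (k : ℕ) (g : Finset α → ℝ) :
    ∑ V ∈ s.powerset with k ≤ V.card, g V =
      ∑ V ∈ s.powersetCard k, g V + ∑ V ∈ s.powerset with k + 1 ≤ V.card, g V := by
  classical
  rw [← Finset.sum_union]
  · refine Finset.sum_congr ?_ fun _ _ => rfl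
    ext V
    simp only [Finset.mem_filter, Finset.mem_powerset, Finset.mem_union, Finset.mem_powersetCard,
      ← and_or_left]
    exact and_congr_right fun _ => by omega
  · refine Finset.disjoint_left.2 fun V h₁ h₂ => ?_
    have := (Finset.mem_powersetCard.1 h₁).2
    have := (Finset.mem_filter.1 h₂).2
    omega

theorem sum_powerset_erase_empty {α : Type*} [DecidableEq α] (s : Finset α)
    (g : Finset α → ℝ) :
    ∑ V ∈ s.powerset.erase ∅, g V = ∑ t ∈ s, g {t} + ∑ V ∈ s.powerset with 2 ≤ V.card, g V := by
  have h_erase : s.powerset.erase ∅ = {V ∈ s.powerset | 1 ≤ V.card} := by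
    ext V
    simp [Finset.one_le_card, Finset.nonempty_iff_ne_empty, and_comm]
  rw [h_erase, sum_powerset_card_ge, Finset.powersetCard_one, Finset.sum_map]
  rfl

/-- Inclusion–exclusion: the last sum restores the terms with repetitions in both coordinates,
which the two sums before it have both removed. -/
theorem mainPart_eq (ω : Ω) :
    mainPart f n blk q ρ ω = rieszTerm f n blk q ρ (n + 1) (n + 1) ∅ ∅ ω - 1
      - repeatedPart f n blk q ρ (n + 1) ∅ ω
      - repeatedPart (swapFamily f) n blk q ρ (n + 1) ∅ ω
      + ∑ V' ∈ (Finset.range q).powerset with 2 ≤ V'.card, ∑ d ∈ Finset.range (n + 1),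
          repeatedPart f n blk q ρ d V' ω := by
  have h_ne : ∀ V ∈ (Finset.range q).powerset.filter (2 ≤ ·.card), V ≠ ∅ ∧ V ⊆ Finset.range q :=
    fun V hV => by
      obtain ⟨hV, h_card⟩ := Finset.mem_filter.1 hV
      exact ⟨by rintro rfl; simp at h_card, Finset.mem_powerset.1 hV⟩
  have h_second : repeatedPart f n blk q ρ (n + 1) ∅ ω =
      ∑ V ∈ (Finset.range q).powerset with 2 ≤ V.card,
        ∑ V' ∈ (Finset.range q).powerset.erase ∅, maximaPart f n blk q ρ V V' ω :=
    Finset.sum_congr rfl fun V hV =>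
      sum_rieszTerm_eq_sum_maximaPart_right (h_ne V hV).1 (h_ne V hV).2 ω
  have h_third : repeatedPart (swapFamily f) n blk q ρ (n + 1) ∅ ω =
      ∑ V' ∈ (Finset.range q).powerset with 2 ≤ V'.card,
        ∑ V ∈ (Finset.range q).powerset.erase ∅, maximaPart f n blk q ρ V V' ω :=
    Finset.sum_congr rfl fun V' hV' => by
      simp only [rieszTerm_swap]
      exact sum_rieszTerm_eq_sum_maximaPart_left (h_ne V' hV').1 (h_ne V' hV').2 ω
  have h_both : ∀ V', ∑ d ∈ Finset.range (n + 1), repeatedPart f n blk q ρ d V' ω =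
      ∑ V ∈ (Finset.range q).powerset with 2 ≤ V.card, maximaPart f n blk q ρ V V' ω :=
    fun V' => by
      simp only [repeatedPart, maximaPart]
      rw [Finset.sum_comm]
      exact Finset.sum_congr rfl fun V _ => Finset.sum_comm
  rw [rieszTerm_sub_one, h_second, h_third, mainPart]
  simp only [h_both, sum_powerset_erase_empty, Finset.sum_add_distrib]
  rw [Finset.sum_comm (s := Finset.range q) (t := Finset.filter _ _),
    Finset.sum_comm (s := Finset.filter _ _) (t := Finset.filter _ _)]
  ring

end Terms

section Duality

variable {Ω : Type*} {T : Fin 3 → ℕ → Equiv.Perm Ω} {n : ℕ} {f : Scale → Ω → ℝ} {blk : ℕ → ℕ}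
  {q : ℕ} {ρ : ℝ} {s : Scale} {H : Ω → ℝ}

theorem IsSignFamily.isHaarAt_rieszTerm_second (hf : IsSignFamily T n f) {t : ℕ} (ht : t < q)
    (c d : ℕ) (V' : Finset ℕ) :
    IsHaarAt (T 1) c (rieszTerm f n blk q ρ c d {t} V') where
  odd ω := by
    have h_odd : signSum f (boxScales n blk (allowed c {t} t) (allowed d V' t) t) (T 1 c ω) =
        -signSum f (boxScales n blk (allowed c {t} t) (allowed d V' t) t) ω := by
      refine (IsHaarAt.sum (T := T 1) fun r hr => ?_).odd ω
      obtain ⟨h_sum, -, h1, -⟩ := mem_boxScales.1 hr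
      have h1 : r 1 = c := by simpa [allowed] using h1
      exact h1 ▸ hf.isHaarAt h_sum 1
    have h_inv : ∀ w ∈ (Finset.range q).erase t,
        signSum f (boxScales n blk (allowed c {t} w) (allowed d V' w) w) (T 1 c ω) =
          signSum f (boxScales n blk (allowed c {t} w) (allowed d V' w) w) ω := fun w hw => by
      refine Finset.sum_congr rfl fun r hr => ?_
      obtain ⟨h_sum, -, h1, -⟩ := mem_boxScales.1 hr
      have h1 : r 1 < c := by simpa [allowed, Finset.ne_of_mem_erase hw] using h1
      exact (hf.isHaarAt h_sum 1).inv c h1 ω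
    rw [rieszTerm, rieszTerm, rieszProd, rieszProd,
      ← Finset.mul_prod_erase _ _ (Finset.mem_range.2 ht),
      ← Finset.mul_prod_erase _ _ (Finset.mem_range.2 ht), h_odd,
      Finset.prod_congr rfl fun w hw => by rw [h_inv w hw]]
    simp
  inv l hl ω := by
    refine rieszProd_inv hf (isBlocked_boxScales _ _) _ 1 l (fun w _ r hr => ?_) ω
    exact (le_of_mem_allowed (mem_boxScales.1 hr).2.2.1).trans_lt hl

theorem IsSignFamily.isHaarAt_rieszTerm_third (hf : IsSignFamily T n f) {u : ℕ} (hu : u < q)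
    (c d : ℕ) (V : Finset ℕ) :
    IsHaarAt (T 2) d (rieszTerm f n blk q ρ c d V {u}) := by
  rw [← funext (rieszTerm_swap (f := f) d c {u} V)]
  exact hf.swap.isHaarAt_rieszTerm_second hu d c V

theorem eq_or_lt_of_mem_boxScales (hs : ∑ i, s i = n) {V V' : Finset ℕ} {w : ℕ} {r : Scale}
    (hr : r ∈ boxScales n blk (allowed (s 1) V w) (allowed (s 2) V' w) w) :
    r = s ∨ s 0 < r 0 := by
  obtain ⟨h_sum, -, h1, h2⟩ := mem_boxScales.1 hr
  have h1 := le_of_mem_allowed h1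
  have h2 := le_of_mem_allowed h2
  refine or_iff_not_imp_right.2 fun h0 => ?_
  have hr' := h_sum
  have hs' := hs
  rw [Fin.sum_univ_three] at hr' hs'
  exact eq_of_two_coords (i := 1) (j := 2) (by decide) h_sum hs (by omega) (by omega)

theorem self_mem_allowed_iff {c w : ℕ} {V : Finset ℕ} : c ∈ allowed c V w ↔ w ∈ V := by
  by_cases hw : w ∈ V <;> simp [allowed, hw]

theorem boxScales_allowed_eq_singleton (hs : ∑ i, s i = n) {V V' : Finset ℕ}
    (hV : blk (s 0) ∈ V) (hV' : blk (s 0) ∈ V') :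
    boxScales n blk (allowed (s 1) V (blk (s 0))) (allowed (s 2) V' (blk (s 0))) (blk (s 0)) =
      {s} := by
  ext r
  rw [mem_boxScales, allowed, allowed, if_pos hV, if_pos hV', Finset.mem_singleton,
    Finset.mem_singleton, Finset.mem_singleton]
  refine ⟨fun ⟨h_sum, _, h1, h2⟩ => eq_of_two_coords (by decide) h_sum hs h1 h2, ?_⟩
  rintro rfl
  exact ⟨hs, rfl, rfl, rfl⟩

variable [Fintype Ω]

theorem expect_haar_mul_rieszTerm_of_ne (hf : IsSignFamily T n f) (hblk : Monotone blk)
    (hs : ∑ i, s i = n) (hH : IsHaar T s H) {t u : ℕ} (ht : t < q)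
    (h_ne : ¬(t = blk (s 0) ∧ u = blk (s 0))) :
    𝔼 ω, H ω * rieszTerm f n blk q ρ (s 1) (s 2) {t} {u} ω = 0 := by
  simp only [rieszTerm]
  rw [expect_mul_rieszProd hf hblk (isBlocked_boxScales _ _),
    Finset.prod_eq_zero (Finset.mem_range.2 ht) (by simp), mul_zero]
  intro w _ r hr ω
  refine (hH 0).inv _ ((eq_or_lt_of_mem_boxScales hs hr).resolve_left ?_) ω
  rintro rfl
  obtain ⟨-, rfl, h1, h2⟩ := mem_boxScales.1 hr
  rw [self_mem_allowed_iff, Finset.mem_singleton] at h1 h2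
  exact h_ne ⟨h1.symm, h2.symm⟩

theorem expect_haar_mul_rieszTerm_self (hf : IsSignFamily T n f) (hblk : Monotone blk)
    (hs : ∑ i, s i = n) (hH : IsHaar T s H) (hq : blk (s 0) < q) :
    𝔼 ω, H ω * rieszTerm f n blk q ρ (s 1) (s 2) {blk (s 0)} {blk (s 0)} ω =
      ρ * 𝔼 ω, H ω * f s ω := by
  set t := blk (s 0) with ht
  set A : ℕ → Finset Scale := fun w =>
    boxScales n blk (allowed (s 1) {t} w) (allowed (s 2) {t} w) w
  set ε : ℕ → ℝ := fun w => if w ∈ ({t} ∪ {t} : Finset ℕ) then 0 else 1 with hε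
  have h_split : ∀ ω, H ω * rieszTerm f n blk q ρ (s 1) (s 2) {t} {t} ω =
      ρ * (H ω * f s ω * rieszProd f ρ ε A ((Finset.range q).erase t) ω) := fun ω => by
    have h_single : A t = {s} :=
      boxScales_allowed_eq_singleton hs (by simp [ht]) (by simp [ht])
    have h_zero : ε t = 0 := by simp [hε]
    change H ω * rieszProd f ρ ε A (Finset.range q) ω = _
    rw [rieszProd, ← Finset.mul_prod_erase _ _ (Finset.mem_range.2 hq), h_single, h_zero, signSum,
      Finset.sum_singleton, rieszProd]
    ring
  simp only [h_split]
  rw [← Finset.mul_expect, expect_mul_rieszProd hf hblk (isBlocked_boxScales _ _)]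
  · rw [Finset.prod_eq_one fun w hw => by simp [hε, Finset.ne_of_mem_erase hw], mul_one]
  · intro w hw r hr ω
    have h_lt : s 0 < r 0 := by
      refine (eq_or_lt_of_mem_boxScales hs hr).resolve_left ?_
      rintro rfl
      exact Finset.ne_of_mem_erase hw (mem_boxScales.1 hr).2.1.symm
    rw [(hH 0).inv _ h_lt, (hf.isHaarAt hs 0).inv _ h_lt]

theorem expect_haar_mul_maximaPart (hf : IsSignFamily T n f) (hs : ∑ i, s i = n)
    (hH : IsHaar T s H) {t u : ℕ} (ht : t < q) (hu : u < q) :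
    𝔼 ω, H ω * maximaPart f n blk q ρ {t} {u} ω =
      𝔼 ω, H ω * rieszTerm f n blk q ρ (s 1) (s 2) {t} {u} ω := by
  have h_mem : ∀ i, s i ∈ Finset.range (n + 1) := fun i =>
    Finset.mem_range.2 (Nat.lt_succ_of_le (coord_le hs i))
  simp only [maximaPart, Finset.mul_sum, Finset.expect_sum_comm]
  rw [Finset.sum_eq_single_of_mem (s 1) (h_mem 1), Finset.sum_eq_single_of_mem (s 2) (h_mem 2)]
  · exact fun d _ hd => expect_eq_zero_of_odd (T 2 (max (s 2) d))
      ((hH 2).mul_of_ne (hf.isHaarAt_rieszTerm_third hu (s 1) d {t}) hd.symm).odd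
  · exact fun c _ hc => Finset.sum_eq_zero fun d _ => expect_eq_zero_of_odd (T 1 (max (s 1) c))
      ((hH 1).mul_of_ne (hf.isHaarAt_rieszTerm_second ht c d {u}) hc.symm).odd

theorem expect_haar_mul_mainPart (hf : IsSignFamily T n f) (hblk : Monotone blk)
    (hs : ∑ i, s i = n) (hq : blk (s 0) < q) (hH : IsHaar T s H) :
    𝔼 ω, H ω * mainPart f n blk q ρ ω = ρ * 𝔼 ω, H ω * f s ω := by
  have hq_mem := Finset.mem_range.2 hq
  simp only [mainPart, Finset.mul_sum, Finset.expect_sum_comm]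
  rw [Finset.sum_congr rfl fun t ht => Finset.sum_congr rfl fun u hu =>
      expect_haar_mul_maximaPart hf hs hH (Finset.mem_range.1 ht) (Finset.mem_range.1 hu),
    Finset.sum_eq_single_of_mem (blk (s 0)) hq_mem, Finset.sum_eq_single_of_mem (blk (s 0)) hq_mem,
    expect_haar_mul_rieszTerm_self hf hblk hs hH hq]
  · exact fun u _ hu => expect_haar_mul_rieszTerm_of_ne hf hblk hs hH hq fun h => hu h.2
  · exact fun t ht ht_ne => Finset.sum_eq_zero fun u _ =>
      expect_haar_mul_rieszTerm_of_ne hf hblk hs hH (Finset.mem_range.1 ht) fun h => ht_ne h.1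

end Duality

section LowerProducts

theorem prod_sub_prod_ordered {ι R : Type*} [LinearOrder ι] [CommRing R] (s : Finset ι)
    (a b : ι → R) :
    ∏ i ∈ s, a i - ∏ i ∈ s, b i =
      ∑ i ∈ s, (a i - b i) * ∏ j ∈ s.erase i, if j < i then b j else a j := by
  have h_telescope := Finset.prod_sub_ordered s a fun i => a i - b i
  simp only [sub_sub_cancel] at h_telescope
  rw [h_telescope, sub_sub_cancel]
  refine Finset.sum_congr rfl fun i _ => ?_
  rw [mul_assoc, ← Finset.prod_filter_mul_prod_filter_not (s.erase i) (· < i)]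
  congr 2
  · refine Finset.prod_congr ?_ fun j hj => (if_pos (Finset.mem_filter.1 hj).2).symm
    grind
  · refine Finset.prod_congr ?_ fun j hj => (if_neg (Finset.mem_filter.1 hj).2).symm
    grind

variable {Ω : Type*} {n : ℕ} {f : Scale → Ω → ℝ} {blk : ℕ → ℕ} {q : ℕ} {ρ : ℝ}

/-- The product over the blocks `w ∈ W` restricted to second coordinates below a cutoff `κ w`, for
given data `d`, `V'` of the third coordinate. -/
def lowProd (f : Scale → Ω → ℝ) (n : ℕ) (blk : ℕ → ℕ) (ρ : ℝ) (d : ℕ) (V' : Finset ℕ)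
    (κ : ℕ → ℕ) (W : Finset ℕ) (ω : Ω) : ℝ :=
  rieszProd f ρ (fun w => if w ∈ V' then 0 else 1)
    (fun w => boxScales n blk (Finset.range (κ w)) (allowed d V' w) w) W ω

theorem signSum_boxScales_range_sub {c₀ c : ℕ} (hc : c₀ ≤ c) (D : Finset ℕ) (w : ℕ) (ω : Ω) :
    signSum f (boxScales n blk (Finset.range c) D w) ω -
        signSum f (boxScales n blk (Finset.range c₀) D w) ω =
      signSum f (boxScales n blk (Finset.Ico c₀ c) D w) ω := by
  rw [Finset.range_eq_Ico, Finset.range_eq_Ico, ← Finset.Ico_union_Ico_eq_Ico c₀.zero_le hc,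
    signSum_boxScales_union (Finset.Ico_disjoint_Ico_consecutive _ _ _), add_sub_cancel_left]

theorem lowProd_sub_lowProd (d : ℕ) (V' : Finset ℕ) {c₀ c : ℕ} (hc : c₀ ≤ c) (W : Finset ℕ)
    (ω : Ω) :
    lowProd f n blk ρ d V' (fun _ => c) W ω - lowProd f n blk ρ d V' (fun _ => c₀) W ω =
      ∑ i ∈ W, ρ * signSum f (boxScales n blk (Finset.Ico c₀ c) (allowed d V' i) i) ω *
        lowProd f n blk ρ d V' (fun w => if w < i then c₀ else c) (W.erase i) ω := by
  simp only [lowProd, rieszProd]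
  rw [prod_sub_prod_ordered]
  refine Finset.sum_congr rfl fun i _ => ?_
  rw [add_sub_add_left_eq_sub, ← mul_sub, signSum_boxScales_range_sub hc]
  congr 1
  refine Finset.prod_congr rfl fun w _ => ?_
  split_ifs <;> rfl

/-- The product of the factors of two blocks `t`, `u` in which the second coordinate takes the same
value `c`, for given data `d`, `V'` of the third coordinate. -/
def pairFactor (f : Scale → Ω → ℝ) (n : ℕ) (blk : ℕ → ℕ) (ρ : ℝ) (d : ℕ) (V' : Finset ℕ)
    (t u c : ℕ) (ω : Ω) : ℝ :=
  ρ * signSum f (boxScales n blk {c} (allowed d V' t) t) ω *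
    (ρ * signSum f (boxScales n blk {c} (allowed d V' u) u) ω)

theorem rieszTerm_pair_eq {t u : ℕ} (htu : t ≠ u) (ht : t < q) (hu : u < q) (c d : ℕ)
    (V' : Finset ℕ) (ω : Ω) :
    rieszTerm f n blk q ρ c d {t, u} V' ω =
      pairFactor f n blk ρ d V' t u c ω *
        lowProd f n blk ρ d V' (fun _ => c) (((Finset.range q).erase t).erase u) ω := by
  have hu_mem : u ∈ (Finset.range q).erase t := by simp [htu.symm, hu]
  rw [rieszTerm, rieszProd, ← Finset.mul_prod_erase _ _ (Finset.mem_range.2 ht),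
    ← Finset.mul_prod_erase _ _ hu_mem, ← mul_assoc, lowProd, rieszProd]
  congr 1
  · simp [allowed, pairFactor]
  · refine Finset.prod_congr rfl fun w hw => ?_
    have hw_notMem : w ∉ ({t, u} : Finset ℕ) := by
      simp only [Finset.mem_erase] at hw
      simp [hw.1, hw.2.1]
    rw [allowed, if_neg hw_notMem]
    simp only [Finset.mem_union, hw_notMem, false_or]

theorem rieszTerm_pair_eq_zero (hblk : Monotone blk) {t u : ℕ} (htu : t < u) (hu : u < q)
    (c d : ℕ) {V' : Finset ℕ} (huV : u ∈ V') (ω : Ω) :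
    rieszTerm f n blk q ρ c d {t, u} V' ω = 0 := by
  rw [rieszTerm_pair_eq htu.ne (htu.trans hu) hu]
  rcases (boxScales n blk {c} (allowed d V' t) t).eq_empty_or_nonempty with h | ⟨r, hr⟩
  · simp [h, pairFactor, signSum]
  rcases (boxScales n blk {c} (allowed d V' u) u).eq_empty_or_nonempty with h | ⟨s, hs⟩
  · simp [h, pairFactor, signSum]
  -- The later scale has the larger first, the same second and no smaller third coordinate.
  exfalso
  obtain ⟨hr_sum, hr0, hr1, hr2⟩ := mem_boxScales.1 hr
  obtain ⟨hs_sum, hs0, hs1, hs2⟩ := mem_boxScales.1 hs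
  have h0 : r 0 < s 0 := hblk.reflect_lt (by rwa [hr0, hs0])
  have h2 := le_of_mem_allowed hr2
  rw [allowed, if_pos huV] at hs2
  rw [Finset.mem_singleton] at hr1 hs1 hs2
  rw [Fin.sum_univ_three] at hr_sum hs_sum
  omega

end LowerProducts

section Estimates

variable {Ω : Type*}

theorem rieszProd_ite_zero_one {f : Scale → Ω → ℝ} {ρ : ℝ} (A : ℕ → Finset Scale)
    (U W : Finset ℕ) (ω : Ω) :
    rieszProd f ρ (fun w => if w ∈ U then 0 else 1) A W ω =
      (∏ w ∈ W ∩ U, ρ * signSum f (A w) ω) * rieszProd f ρ 1 A (W \ U) ω := by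
  rw [rieszProd, rieszProd, ← Finset.prod_inter_mul_prod_sdiff W U]
  congr 1
  · exact Finset.prod_congr rfl fun w hw => by rw [if_pos (Finset.mem_inter.1 hw).2, zero_add]
  · exact Finset.prod_congr rfl fun w hw => by
      rw [if_neg (Finset.mem_sdiff.1 hw).2, Pi.one_apply]

theorem card_boxScales_le (n : ℕ) (blk : ℕ → ℕ) (C D : Finset ℕ) (w : ℕ) :
    (boxScales n blk C D w).card ≤
      (C ∩ Finset.range (n + 1)).card * (D ∩ Finset.range (n + 1)).card := by
  rw [← Finset.card_product]
  refine Finset.card_le_card_of_injOn (fun r => (r 1, r 2)) (fun r hr => ?_)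
    fun r hr s hs h => ?_
  · obtain ⟨h_sum, -, h1, h2⟩ := mem_boxScales.1 hr
    have := coord_le h_sum 1
    have := coord_le h_sum 2
    simp only [Finset.coe_product, Set.mem_prod, Finset.mem_coe, Finset.mem_inter,
      Finset.mem_range]
    exact ⟨⟨h1, by omega⟩, h2, by omega⟩
  · obtain ⟨h1, h2⟩ := Prod.mk.inj h
    exact eq_of_two_coords (i := 1) (j := 2) (by decide) (mem_boxScales.1 hr).1
      (mem_boxScales.1 hs).1 h1 h2

/-- The weight of block `w`: `σ ^ 2` if `w ∈ V`, and `1` otherwise. -/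
noncomputable def blockWeight (σ : ℝ) (V : Finset ℕ) (w : ℕ) : ℝ := if w ∈ V then σ ^ 2 else 1

/-- The relations between the parameters used in estimating the terms: `n` is the order of the
scales, `q` the number of blocks, `m` and `M` orders of moments, `ρ` the coefficient in the Riesz
product and `σ` the size of a sum over a block with one more coordinate prescribed. -/
structure TermParams (n q m M : ℕ) (ρ σ : ℝ) : Prop where
  m_ne : m ≠ 0
  M_ge : 2 * m * (q + 1) ≤ M
  ρ_pos : 0 < ρ
  σ_pos : 0 < σ
  σ_ge : 4 * ((4 * M : ℕ) : ℝ) ^ 4 * ρ ^ 2 * (n + 1) ≤ σ ^ 2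
  one_le : 1 ≤ σ ^ 2 * (n + 1)

variable [Fintype Ω] {T : Fin 3 → ℕ → Equiv.Perm Ω} {n : ℕ} {f : Scale → Ω → ℝ} {blk : ℕ → ℕ}
  {q m M : ℕ} {ρ σ : ℝ}

theorem RieszControl.expect_abs_mul_rieszProd_ite_le [Nonempty Ω]
    (hR : RieszControl f n blk q ρ m) (hm : m ≠ 0) {A : ℕ → Finset Scale}
    (hA : IsBlocked n blk A) (U : Finset ℕ) {W : Finset ℕ} (hW : W ⊆ Finset.range q) {G : Ω → ℝ}
    {vG : ℝ} (hG : HasMoments M G vG) {v : ℕ → ℝ}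
    (hA_moments : ∀ w ∈ W ∩ U, HasMoments M (fun ω => ρ * signSum f (A w) ω) (v w))
    (hM : 2 * m * (q + 1) ≤ M) {s : ℝ} (hs : 0 < s) (hv : vG * ∏ w ∈ W ∩ U, v w ≤ s ^ 2) :
    𝔼 ω, |G ω * rieszProd f ρ (fun w => if w ∈ U then 0 else 1) A W ω| ≤ 5 * s := by
  simp only [rieszProd_ite_zero_one, ← mul_assoc]
  exact hR.expect_abs_mul_prod_mul_rieszProd_le hm hA (Finset.sdiff_subset.trans hW)
    (Finset.inter_subset_left.trans hW) hG hA_moments hM hs hv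

theorem blockWeight_pos (hσ : 0 < σ) (V : Finset ℕ) (w : ℕ) : 0 < blockWeight σ V w := by
  unfold blockWeight
  split_ifs <;> positivity

theorem blockWeight_of_mem {V : Finset ℕ} {w : ℕ} (hw : w ∈ V) : blockWeight σ V w = σ ^ 2 :=
  if_pos hw

theorem blockWeight_of_notMem {V : Finset ℕ} {w : ℕ} (hw : w ∉ V) : blockWeight σ V w = 1 :=
  if_neg hw

theorem prod_blockWeight {V W : Finset ℕ} (h : V ⊆ W) :
    ∏ w ∈ W, blockWeight σ V w = (σ ^ V.card) ^ 2 := by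
  unfold blockWeight
  rw [Finset.prod_ite_mem, Finset.inter_eq_right.2 h, Finset.prod_const, pow_right_comm]

namespace TermParams

theorem M_pos (h : TermParams n q m M ρ σ) : 0 < M :=
  h.M_ge.trans_lt' (by have := h.m_ne; positivity)

theorem card_allowed_inter_range_le (h : TermParams n q m M ρ σ) (d : ℕ) (V : Finset ℕ) (w : ℕ) :
    ((allowed d V w ∩ Finset.range (n + 1)).card : ℝ) ≤ (n + 1) * blockWeight σ V w := by
  by_cases hw : w ∈ V
  · calc ((allowed d V w ∩ Finset.range (n + 1)).card : ℝ) ≤ (allowed d V w).card := by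
          exact_mod_cast Finset.card_le_card Finset.inter_subset_left
      _ = 1 := by rw [allowed, if_pos hw, Finset.card_singleton, Nat.cast_one]
      _ ≤ (n + 1) * blockWeight σ V w := by rw [blockWeight_of_mem hw, mul_comm]; exact h.one_le
  · calc ((allowed d V w ∩ Finset.range (n + 1)).card : ℝ) ≤ (Finset.range (n + 1)).card := by
          exact_mod_cast Finset.card_le_card Finset.inter_subset_right
      _ = (n + 1) * blockWeight σ V w := by
          rw [blockWeight_of_notMem hw, Finset.card_range, Nat.cast_succ, mul_one]

theorem hasMoments_of_card_le [Nonempty Ω] (h : TermParams n q m M ρ σ)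
    (hf : IsSignFamily T n f) {A : Finset Scale} (hA : ∀ r ∈ A, ∑ i, r i = n) {a : ℝ}
    (ha : 0 < a) (h_card : (A.card : ℝ) ≤ (n + 1) * a) :
    HasMoments (4 * M) (fun ω => ρ * signSum f A ω) (σ ^ 2 * a) := by
  have hM := h.M_pos
  refine hf.hasMoments h.ρ_pos hA (by omega) (by positivity) h_card ?_
  rw [← mul_assoc]
  exact mul_le_mul_of_nonneg_right h.σ_ge ha.le

theorem hasMoments_second [Nonempty Ω] (h : TermParams n q m M ρ σ) (hf : IsSignFamily T n f)
    {C : Finset ℕ} {a : ℝ} (ha : 0 < a) (hC : (C.card : ℝ) ≤ a) (d : ℕ) (V : Finset ℕ) (w : ℕ) :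
    HasMoments (4 * M) (fun ω => ρ * signSum f (boxScales n blk C (allowed d V w) w) ω)
      (σ ^ 2 * (a * blockWeight σ V w)) := by
  have h_blockWeight := blockWeight_pos h.σ_pos V w
  refine h.hasMoments_of_card_le hf (fun r hr => (mem_boxScales.1 hr).1) (by positivity) ?_
  calc ((boxScales n blk C (allowed d V w) w).card : ℝ)
      ≤ (C ∩ Finset.range (n + 1)).card * (allowed d V w ∩ Finset.range (n + 1)).card := by
        exact_mod_cast card_boxScales_le n blk C _ w
    _ ≤ a * ((n + 1) * blockWeight σ V w) := by
        refine mul_le_mul (hC.trans' ?_) (h.card_allowed_inter_range_le d V w) (by positivity)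
          ha.le
        exact_mod_cast Finset.card_le_card Finset.inter_subset_left
    _ = (n + 1) * (a * blockWeight σ V w) := by ring

theorem hasMoments_third [Nonempty Ω] (h : TermParams n q m M ρ σ) (hf : IsSignFamily T n f)
    (C : Finset ℕ) (d : ℕ) {V : Finset ℕ} {w : ℕ} (hw : w ∈ V) :
    HasMoments (4 * M) (fun ω => ρ * signSum f (boxScales n blk C (allowed d V w) w) ω)
      (σ ^ 2) := by
  rw [allowed, if_pos hw, ← mul_one (σ ^ 2)]
  refine h.hasMoments_of_card_le hf (fun r hr => (mem_boxScales.1 hr).1) one_pos ?_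
  have h_card := (card_boxScales_le n blk C {d} w).trans
    (Nat.mul_le_mul (Finset.card_le_card Finset.inter_subset_right)
      (Finset.card_le_card Finset.inter_subset_left))
  rw [Finset.card_range, Finset.card_singleton] at h_card
  exact_mod_cast h_card

theorem expect_abs_rieszTerm_le [Nonempty Ω] (h : TermParams n q m M ρ σ)
    (hf : IsSignFamily T n f) (hR : RieszControl f n blk q ρ m) (c d : ℕ) {V V' : Finset ℕ}
    (hV : V ⊆ Finset.range q) (hV' : V' ⊆ Finset.range q) :
    𝔼 ω, |rieszTerm f n blk q ρ c d V V' ω| ≤ 5 * σ ^ (V.card + V'.card) := by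
  have hσ := h.σ_pos
  have h_bound := hR.expect_abs_mul_rieszProd_ite_le h.m_ne
    (isBlocked_boxScales (allowed c V) (allowed d V')) (V ∪ V') subset_rfl (hasMoments_one M)
    (v := fun w => blockWeight σ V w * blockWeight σ V' w) (s := σ ^ (V.card + V'.card))
    (fun w hw => ?_) h.M_ge
    (by positivity) ?_
  · simpa only [one_mul, rieszTerm] using h_bound
  · refine HasMoments.mono (M := 4 * M) ?_ (by omega) le_rfl
    by_cases hwV : w ∈ V
    · rw [blockWeight_of_mem hwV, allowed, if_pos hwV, ← one_mul (blockWeight σ V' w)]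
      exact h.hasMoments_second hf one_pos (by simp) d V' w
    · have hwV' : w ∈ V' := (Finset.mem_union.1 (Finset.mem_inter.1 hw).2).resolve_left hwV
      rw [blockWeight_of_notMem hwV, one_mul, blockWeight_of_mem hwV']
      exact h.hasMoments_third hf _ d hwV'
  · rw [Finset.inter_eq_right.2 (Finset.union_subset hV hV'), one_mul, Finset.prod_mul_distrib,
      prod_blockWeight Finset.subset_union_left, prod_blockWeight Finset.subset_union_right,
      ← mul_pow, ← pow_add]

theorem expect_abs_mul_lowProd_le [Nonempty Ω] (h : TermParams n q m M ρ σ)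
    (hf : IsSignFamily T n f) (hR : RieszControl f n blk q ρ m) (d : ℕ) (V' : Finset ℕ)
    (κ : ℕ → ℕ) {W : Finset ℕ} (hW : W ⊆ Finset.range q) {G : Ω → ℝ} {vG : ℝ}
    (hG : HasMoments M G vG) {s : ℝ} (hs : 0 < s) (hv : vG * ∏ w ∈ W, blockWeight σ V' w ≤ s ^ 2) :
    𝔼 ω, |G ω * lowProd f n blk ρ d V' κ W ω| ≤ 5 * s := by
  refine hR.expect_abs_mul_rieszProd_ite_le h.m_ne
    (isBlocked_boxScales (fun w => Finset.range (κ w)) (allowed d V')) V' hW hG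
    (v := fun _ => σ ^ 2) (fun w hw => ?_) h.M_ge hs ?_
  · exact (h.hasMoments_third hf _ d (Finset.mem_inter.1 hw).2).mono (by omega) le_rfl
  · unfold blockWeight at hv
    rwa [Finset.prod_ite_mem] at hv

end TermParams

theorem expect_abs_sum_le {ι : Type*} (s : Finset ι) (g : ι → Ω → ℝ) :
    𝔼 ω, |∑ i ∈ s, g i ω| ≤ ∑ i ∈ s, 𝔼 ω, |g i ω| := by
  rw [← Finset.expect_sum_comm]
  exact Finset.expect_le_expect fun ω _ => Finset.abs_sum_le_sum_abs _ _

theorem expect_abs_add_le (g h : Ω → ℝ) :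
    𝔼 ω, |g ω + h ω| ≤ 𝔼 ω, |g ω| + 𝔼 ω, |h ω| := by
  rw [← Finset.expect_add_distrib]
  exact Finset.expect_le_expect fun ω _ => abs_add_le _ _

end Estimates

section PairEstimate

theorem card_filter_div_eq_le (s : Finset ℕ) {L : ℕ} (hL : 0 < L) (j : ℕ) :
    ({c ∈ s | c / L = j}).card ≤ L := by
  calc ({c ∈ s | c / L = j}).card ≤ (Finset.Ico (j * L) (j * L + L)).card := by
        refine Finset.card_le_card fun c hc => ?_
        rw [Finset.mem_Ico]
        have h := (Nat.div_eq_iff hL).1 (Finset.mem_filter.1 hc).2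
        omega
    _ = L := by simp

variable {Ω : Type*} {T : Fin 3 → ℕ → Equiv.Perm Ω} {n : ℕ} {f : Scale → Ω → ℝ} {blk : ℕ → ℕ}
  {q m M : ℕ} {ρ σ : ℝ}

/-- The pairs of scales in the blocks `t`, `u` which agree in the second coordinate, with a value in
`C`, for given data `d`, `V'` of the third coordinate. -/
def blockPairs (n : ℕ) (blk : ℕ → ℕ) (d : ℕ) (V' : Finset ℕ) (t u : ℕ) (C : Finset ℕ) :
    Finset (Scale × Scale) :=
  C.biUnion fun c =>
    boxScales n blk {c} (allowed d V' t) t ×ˢ boxScales n blk {c} (allowed d V' u) u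

theorem isCoincidence_of_mem_blockPairs (hblk : Monotone blk) {d : ℕ} {V' : Finset ℕ} {t u : ℕ}
    (htu : t < u) {C : Finset ℕ} {p : Scale × Scale} (hp : p ∈ blockPairs n blk d V' t u C) :
    IsCoincidence n 1 0 p := by
  obtain ⟨c, -, hp⟩ := Finset.mem_biUnion.1 hp
  obtain ⟨hr, hs⟩ := Finset.mem_product.1 hp
  obtain ⟨hr_sum, hr0, hr1, -⟩ := mem_boxScales.1 hr
  obtain ⟨hs_sum, hs0, hs1, -⟩ := mem_boxScales.1 hs
  exact ⟨hr_sum, hs_sum, (Finset.mem_singleton.1 hr1).trans (Finset.mem_singleton.1 hs1).symm,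
    hblk.reflect_lt (by rwa [hr0, hs0])⟩

theorem fst_of_mem_blockPairs {d : ℕ} {V' : Finset ℕ} {t u : ℕ} {C : Finset ℕ}
    {p : Scale × Scale} (hp : p ∈ blockPairs n blk d V' t u C) :
    p.1 1 ∈ C ∧ p.1 2 ∈ allowed d V' t ∩ Finset.range (n + 1) := by
  obtain ⟨c, hc, hp⟩ := Finset.mem_biUnion.1 hp
  obtain ⟨h_sum, -, h1, h2⟩ := mem_boxScales.1 (Finset.mem_product.1 hp).1
  have := coord_le h_sum 2
  rw [Finset.mem_singleton.1 h1, Finset.mem_inter, Finset.mem_range]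
  exact ⟨hc, h2, by omega⟩

theorem sum_pairFactor_eq (d : ℕ) (V' : Finset ℕ) (t u : ℕ) (C : Finset ℕ) (ω : Ω) :
    ∑ c ∈ C, pairFactor f n blk ρ d V' t u c ω =
      ρ ^ 2 * ∑ p ∈ blockPairs n blk d V' t u C, f p.1 ω * f p.2 ω := by
  rw [blockPairs, Finset.sum_biUnion, Finset.mul_sum]
  · refine Finset.sum_congr rfl fun c _ => ?_
    rw [Finset.sum_product, pairFactor, mul_mul_mul_comm, ← sq, signSum, signSum,
      Finset.sum_mul_sum]
  · refine fun c _ c' _ hc => Finset.disjoint_left.2 fun p hp hp' => hc ?_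
    have h := (mem_boxScales.1 (Finset.mem_product.1 hp).1).2.2.1
    have h' := (mem_boxScales.1 (Finset.mem_product.1 hp').1).2.2.1
    exact (Finset.mem_singleton.1 h).symm.trans (Finset.mem_singleton.1 h')

/-- The values of `c` are grouped into intervals of length `L`. Within each of them the cutoff `c`
in the product over the remaining blocks is replaced by the left end point. -/
theorem sum_rieszTerm_pair_eq {t u : ℕ} (htu : t ≠ u) (ht : t < q) (hu : u < q) (d : ℕ)
    (V' : Finset ℕ) (L : ℕ) {W : Finset ℕ} (hW : W = ((Finset.range q).erase t).erase u) (ω : Ω) :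
    ∑ c ∈ Finset.range (n + 1), rieszTerm f n blk q ρ c d {t, u} V' ω =
      ∑ j ∈ Finset.range (n / L + 1),
        (∑ c ∈ Finset.range (n + 1) with c / L = j, pairFactor f n blk ρ d V' t u c ω) *
          lowProd f n blk ρ d V' (fun _ => L * j) W ω +
      ∑ c ∈ Finset.range (n + 1), ∑ i ∈ W,
        pairFactor f n blk ρ d V' t u c ω * (ρ * signSum f (boxScales n blk
            (Finset.Ico (L * (c / L)) c) (allowed d V' i) i) ω) *
          lowProd f n blk ρ d V' (fun w => if w < i then L * (c / L) else c) (W.erase i) ω := by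
  have h_group : ∀ j ∈ Finset.range (n / L + 1),
      (∑ c ∈ Finset.range (n + 1) with c / L = j, pairFactor f n blk ρ d V' t u c ω) *
        lowProd f n blk ρ d V' (fun _ => L * j) W ω =
      ∑ c ∈ Finset.range (n + 1) with c / L = j, pairFactor f n blk ρ d V' t u c ω *
        lowProd f n blk ρ d V' (fun _ => L * (c / L)) W ω := fun j _ => by
    rw [Finset.sum_mul]
    exact Finset.sum_congr rfl fun c hc => by rw [(Finset.mem_filter.1 hc).2]
  have h_maps : ∀ c ∈ Finset.range (n + 1), c / L ∈ Finset.range (n / L + 1) := fun c hc =>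
    Finset.mem_range_succ_iff.2 (Nat.div_le_div_right (Finset.mem_range_succ_iff.1 hc))
  rw [Finset.sum_congr rfl h_group, Finset.sum_fiberwise_of_maps_to h_maps,
    ← Finset.sum_add_distrib]
  refine Finset.sum_congr rfl fun c _ => ?_
  simp only [mul_assoc (pairFactor f n blk ρ d V' t u c ω)]
  rw [rieszTerm_pair_eq htu ht hu, ← hW, ← Finset.mul_sum,
    ← lowProd_sub_lowProd d V' (Nat.mul_div_le c L), mul_sub, add_sub_cancel]

theorem mul_prod_blockWeight_erase {t u : ℕ} (htu : t ≠ u) (ht : t < q) (hu : u < q)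
    {V : Finset ℕ} (hV : V ⊆ Finset.range q) (huV : u ∉ V) :
    blockWeight σ V t * ∏ w ∈ ((Finset.range q).erase t).erase u, blockWeight σ V w =
      (σ ^ V.card) ^ 2 := by
  have hu_mem : u ∈ (Finset.range q).erase t := by simp [htu.symm, hu]
  rw [← prod_blockWeight hV, ← Finset.mul_prod_erase _ _ (Finset.mem_range.2 ht),
    ← Finset.mul_prod_erase _ _ hu_mem, blockWeight_of_notMem huV, one_mul]

/-- The bound for the sum of the terms with a maximum repeated exactly twice. -/
noncomputable def pairBound (n q M l : ℕ) (ρ σ : ℝ) : ℝ :=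
  ((n / l ^ 2 : ℕ) + 1) * (20 * ρ ^ 2 * M ^ 2 * (n + 1) * l) + (n + 1) * (q * (5 * (σ ^ 3 * l)))

variable [Fintype Ω] [Nonempty Ω]

namespace TermParams

theorem hasMoments_sum_pairFactor (h : TermParams n q m M ρ σ)
    (hf : IsSignFamily T n f) (hblk : Monotone blk) {t u : ℕ} (htu : t < u) (d : ℕ)
    (V' : Finset ℕ) {C : Finset ℕ} {L : ℝ} (hL : 0 < L) (hC : C.card ≤ L) {τ : ℝ} (hτ : 0 ≤ τ)
    (hτM : 2 * (M : ℝ) ^ 2 * (n + 1) ≤ τ ^ 2) (hLτ : L * τ ≤ n + 1) :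
    HasMoments M (fun ω => ∑ c ∈ C, pairFactor f n blk ρ d V' t u c ω)
      (16 * ρ ^ 4 * M ^ 4 * L * (n + 1) ^ 2 * blockWeight σ V' t) := by
  have hM : (0 : ℝ) < M := by exact_mod_cast h.M_pos
  have hρ := h.ρ_pos
  have h_blockWeight := blockWeight_pos h.σ_pos V' t
  set K := allowed d V' t ∩ Finset.range (n + 1)
  have hK : (K.card : ℝ) ≤ (n + 1) * blockWeight σ V' t := h.card_allowed_inter_range_le d V' t
  refine ⟨by positivity, fun l hl => ?_⟩
  rcases eq_or_ne l 0 with rfl | hl0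
  · simp
  have h_pairs : 𝔼 ω, (∑ p ∈ blockPairs n blk d V' t u C, f p.1 ω * f p.2 ω) ^ (2 * l) ≤
      (8 * (l : ℝ) ^ 4 * (C.card * K.card * (n + 1) + (C.card : ℝ) ^ 2 * K.card * τ)) ^ l :=
    hf.expect_coincidences_pow_le (k := 2) (by decide) (by decide) (by decide)
      (fun p hp => isCoincidence_of_mem_blockPairs hblk htu hp) C K
      (fun p hp => (fst_of_mem_blockPairs hp).1) (fun p hp => (fst_of_mem_blockPairs hp).2) hl0 hτ
      (hτM.trans' (by gcongr))
  simp only [sum_pairFactor_eq, mul_pow (ρ ^ 2), ← Finset.mul_expect]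
  calc _ ≤ (ρ ^ 2) ^ (2 * l) * (8 * (l : ℝ) ^ 4 *
        (C.card * K.card * (n + 1) + (C.card : ℝ) ^ 2 * K.card * τ)) ^ l := by gcongr
    _ = (8 * ρ ^ 4 * (l : ℝ) ^ 4 * (C.card * K.card * (n + 1 + C.card * τ))) ^ l := by
        rw [pow_mul (ρ ^ 2), ← mul_pow]
        ring_nf
    _ ≤ (8 * ρ ^ 4 * (M : ℝ) ^ 4 * (L * ((n + 1) * blockWeight σ V' t) * (n + 1 + L * τ))) ^ l := by
        gcongr
    _ ≤ (8 * ρ ^ 4 * (M : ℝ) ^ 4 *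
          (L * ((n + 1) * blockWeight σ V' t) * (n + 1 + (n + 1)))) ^ l := by
        gcongr
    _ = _ := by ring

theorem expect_abs_sum_pairFactor_mul_lowProd_le (h : TermParams n q m M ρ σ)
    (hf : IsSignFamily T n f) (hblk : Monotone blk) (hR : RieszControl f n blk q ρ m)
    {t u : ℕ} (htu : t < u) (hu : u < q) (d : ℕ) {V' : Finset ℕ} (hV' : V' ⊆ Finset.range q)
    (huV : u ∉ V') {C : Finset ℕ} {l : ℕ} (hl : 0 < l) (hC : C.card ≤ l ^ 2) {τ : ℝ}
    (hτ : 0 ≤ τ) (hτM : 2 * (M : ℝ) ^ 2 * (n + 1) ≤ τ ^ 2) (hlτ : (l : ℝ) ^ 2 * τ ≤ n + 1)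
    (κ : ℕ → ℕ) :
    𝔼 ω, |(∑ c ∈ C, pairFactor f n blk ρ d V' t u c ω) *
        lowProd f n blk ρ d V' κ (((Finset.range q).erase t).erase u) ω| ≤
      5 * (4 * ρ ^ 2 * M ^ 2 * (n + 1) * l * σ ^ V'.card) := by
  have hσ := h.σ_pos
  have hρ := h.ρ_pos
  have hM : (0 : ℝ) < M := by exact_mod_cast h.M_pos
  refine h.expect_abs_mul_lowProd_le hf hR d V' κ
    ((Finset.erase_subset _ _).trans (Finset.erase_subset _ _))
    (h.hasMoments_sum_pairFactor hf hblk htu d V' (L := (l : ℝ) ^ 2) (by positivity)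
      (by exact_mod_cast hC) hτ hτM hlτ) (by positivity) ?_
  rw [mul_assoc _ (blockWeight σ V' t),
    mul_prod_blockWeight_erase htu.ne (htu.trans hu) hu hV' huV]
  exact le_of_eq (by ring)

theorem expect_abs_pairFactor_mul_signSum_mul_lowProd_le (h : TermParams n q m M ρ σ)
    (hf : IsSignFamily T n f) (hR : RieszControl f n blk q ρ m) {t u : ℕ} (htu : t ≠ u)
    (ht : t < q) (hu : u < q) (c d : ℕ) {V' : Finset ℕ} (hV' : V' ⊆ Finset.range q)
    (huV : u ∉ V') {C : Finset ℕ} {l : ℕ} (hl : 0 < l) (hC : C.card ≤ l ^ 2) (κ : ℕ → ℕ)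
    {W : Finset ℕ} (hW : W = ((Finset.range q).erase t).erase u) {i : ℕ} (hi : i ∈ W) :
    𝔼 ω, |pairFactor f n blk ρ d V' t u c ω *
        (ρ * signSum f (boxScales n blk C (allowed d V' i) i) ω) *
        lowProd f n blk ρ d V' κ (W.erase i) ω| ≤ 5 * (σ ^ 3 * l * σ ^ V'.card) := by
  have hσ := h.σ_pos
  have h_top : ∀ w, HasMoments (4 * M)
      (fun ω => ρ * signSum f (boxScales n blk {c} (allowed d V' w) w) ω)
      (σ ^ 2 * (1 * blockWeight σ V' w)) := h.hasMoments_second hf one_pos (by simp) d V'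
  have h_block : HasMoments (4 * M)
      (fun ω => ρ * signSum f (boxScales n blk C (allowed d V' i) i) ω)
      (σ ^ 2 * ((l : ℝ) ^ 2 * blockWeight σ V' i)) :=
    h.hasMoments_second hf (by positivity) (by exact_mod_cast hC) d V' i
  have h_pair : HasMoments (2 * M) (pairFactor f n blk ρ d V' t u c)
      (σ ^ 2 * (1 * blockWeight σ V' t) * (σ ^ 2 * (1 * blockWeight σ V' u))) :=
    HasMoments.mul ((h_top t).mono (by omega) le_rfl) ((h_top u).mono (by omega) le_rfl)
  refine h.expect_abs_mul_lowProd_le hf hR d V' κ (W := W.erase i) ?_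
    (h_pair.mul (h_block.mono (by omega) le_rfl)) (by positivity) (le_of_eq ?_)
  · rw [hW]
    exact (Finset.erase_subset _ _).trans
      ((Finset.erase_subset _ _).trans (Finset.erase_subset _ _))
  · rw [blockWeight_of_notMem huV]
    calc _ = σ ^ 6 * l ^ 2 * (blockWeight σ V' t *
          (blockWeight σ V' i * ∏ w ∈ W.erase i, blockWeight σ V' w)) := by ring
      _ = (σ ^ 3 * l * σ ^ V'.card) ^ 2 := by
        rw [Finset.mul_prod_erase _ _ hi, hW, mul_prod_blockWeight_erase htu ht hu hV' huV]
        ring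

theorem pairBound_nonneg (h : TermParams n q m M ρ σ) (l : ℕ) : 0 ≤ pairBound n q M l ρ σ := by
  have := h.σ_pos
  have := h.ρ_pos
  unfold pairBound
  positivity

theorem expect_abs_sum_rieszTerm_pair_le (h : TermParams n q m M ρ σ)
    (hf : IsSignFamily T n f) (hblk : Monotone blk) (hR : RieszControl f n blk q ρ m)
    {t u : ℕ} (htu : t < u) (hu : u < q) (d : ℕ) {V' : Finset ℕ} (hV' : V' ⊆ Finset.range q)
    {l : ℕ} (hl : 0 < l) {τ : ℝ} (hτ : 0 ≤ τ) (hτM : 2 * (M : ℝ) ^ 2 * (n + 1) ≤ τ ^ 2)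
    (hlτ : (l : ℝ) ^ 2 * τ ≤ n + 1) :
    𝔼 ω, |∑ c ∈ Finset.range (n + 1), rieszTerm f n blk q ρ c d {t, u} V' ω| ≤
      pairBound n q M l ρ σ * σ ^ V'.card := by
  have hσ := h.σ_pos
  by_cases huV : u ∈ V'
  · simp only [rieszTerm_pair_eq_zero hblk htu hu _ d huV, Finset.sum_const_zero, abs_zero,
      Finset.expect_const_zero]
    exact mul_nonneg (h.pairBound_nonneg l) (by positivity)
  set W := ((Finset.range q).erase t).erase u with hW
  have hW_card : W.card ≤ q := by
    have h_card := Finset.card_le_card ((Finset.erase_subset u ((Finset.range q).erase t)).trans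
      (Finset.erase_subset _ _))
    rwa [Finset.card_range] at h_card
  have h_Ico : ∀ c, (Finset.Ico (l ^ 2 * (c / l ^ 2)) c).card ≤ l ^ 2 := fun c => by
    rw [Nat.card_Ico, tsub_le_iff_left]
    exact (Nat.lt_mul_div_succ c (pow_pos hl 2)).le
  simp only [sum_rieszTerm_pair_eq htu.ne (htu.trans hu) hu d V' (l ^ 2) hW]
  refine (expect_abs_add_le _ _).trans ?_
  rw [pairBound, add_mul]
  refine add_le_add ((expect_abs_sum_le _ _).trans ?_) ((expect_abs_sum_le _ _).trans ?_)
  · calc _ ≤ ∑ _j ∈ Finset.range (n / l ^ 2 + 1),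
          5 * (4 * ρ ^ 2 * M ^ 2 * (n + 1) * l * σ ^ V'.card) :=
          Finset.sum_le_sum fun j _ => h.expect_abs_sum_pairFactor_mul_lowProd_le hf hblk hR htu
            hu d hV' huV hl (card_filter_div_eq_le _ (pow_pos hl 2) j) hτ hτM hlτ _
      _ = _ := by
          rw [Finset.sum_const, Finset.card_range, nsmul_eq_mul, Nat.cast_succ]
          ring
  · calc _ ≤ ∑ _c ∈ Finset.range (n + 1), ∑ _i ∈ W, 5 * (σ ^ 3 * l * σ ^ V'.card) :=
          Finset.sum_le_sum fun c _ => (expect_abs_sum_le _ _).trans <|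
            Finset.sum_le_sum fun i hi => h.expect_abs_pairFactor_mul_signSum_mul_lowProd_le hf hR
              htu.ne (htu.trans hu) hu c d hV' huV hl (h_Ico c) _ hW hi
      _ = (n + 1) * (W.card * (5 * (σ ^ 3 * l * σ ^ V'.card))) := by
          simp only [Finset.sum_const, Finset.card_range, nsmul_eq_mul, Nat.cast_succ]
      _ ≤ (n + 1) * (q * (5 * (σ ^ 3 * l * σ ^ V'.card))) := by gcongr
      _ = _ := by ring

end TermParams

end PairEstimate

section MainPartBound

theorem one_add_inv_pow_le_three (q : ℕ) : (1 + (q : ℝ)⁻¹) ^ q ≤ 3 := by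
  rcases eq_or_ne q 0 with rfl | hq
  · norm_num
  calc (1 + (q : ℝ)⁻¹) ^ q ≤ Real.exp (q : ℝ)⁻¹ ^ q := by
        gcongr
        rw [add_comm]
        exact Real.add_one_le_exp _
    _ = Real.exp 1 := by rw [← Real.exp_nat_mul, mul_inv_cancel₀ (Nat.cast_ne_zero.2 hq)]
    _ ≤ 3 := by linarith [Real.exp_one_lt_d9]

theorem sum_powerset_pow_card_le {α : Type*} (s : Finset α) {σ : ℝ} (hσ : 0 ≤ σ)
    (hsσ : s.card * σ ≤ 1) {j : ℕ} (hj : j ≠ 0) :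
    ∑ V ∈ s.powerset with j ≤ V.card, σ ^ V.card ≤ 3 * (s.card * σ) ^ j := by
  calc ∑ V ∈ s.powerset with j ≤ V.card, σ ^ V.card
      ≤ ∑ V ∈ s.powerset with j ≤ V.card, (s.card * σ) ^ j * ((s.card : ℝ)⁻¹) ^ V.card := by
        refine Finset.sum_le_sum fun V hV => ?_
        obtain ⟨hVs, h_card⟩ := Finset.mem_filter.1 hV
        have hs : (s.card : ℝ) ≠ 0 := by
          have := Finset.card_le_card (Finset.mem_powerset.1 hVs)
          norm_cast
          omega
        calc σ ^ V.card = (s.card * σ) ^ V.card * ((s.card : ℝ)⁻¹) ^ V.card := by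
              rw [← mul_pow, mul_right_comm, mul_inv_cancel₀ hs, one_mul]
          _ ≤ (s.card * σ) ^ j * ((s.card : ℝ)⁻¹) ^ V.card :=
              mul_le_mul_of_nonneg_right (pow_le_pow_of_le_one (by positivity) hsσ h_card)
                (by positivity)
    _ ≤ ∑ V ∈ s.powerset, (s.card * σ) ^ j * ((s.card : ℝ)⁻¹) ^ V.card :=
        Finset.sum_le_sum_of_subset_of_nonneg (Finset.filter_subset _ _)
          fun _ _ _ => by positivity
    _ = (s.card * σ) ^ j * (1 + (s.card : ℝ)⁻¹) ^ s.card := by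
        have h_binom := Finset.sum_pow_mul_eq_add_pow ((s.card : ℝ)⁻¹) 1 s
        simp only [one_pow, mul_one] at h_binom
        rw [← Finset.mul_sum, h_binom, add_comm]
    _ ≤ (s.card * σ) ^ j * 3 := by
        gcongr
        exact one_add_inv_pow_le_three _
    _ = _ := mul_comm _ _

/-- The bound for the terms with a repeated maximum. -/
noncomputable def repeatedBound (n q M l : ℕ) (ρ σ : ℝ) : ℝ :=
  q ^ 2 * pairBound n q M l ρ σ + 15 * (n + 1) * (q * σ) ^ 3

variable {Ω : Type*} [Fintype Ω] {T : Fin 3 → ℕ → Equiv.Perm Ω} {n : ℕ} {f : Scale → Ω → ℝ}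
  {blk : ℕ → ℕ} {q m M l : ℕ} {ρ σ τ : ℝ}

namespace TermParams

theorem repeatedBound_nonneg (h : TermParams n q m M ρ σ) (l : ℕ) :
    0 ≤ repeatedBound n q M l ρ σ := by
  have := h.pairBound_nonneg l
  have := h.σ_pos
  unfold repeatedBound
  positivity

variable [Nonempty Ω]

theorem expect_abs_sum_powersetCard_two_le (h : TermParams n q m M ρ σ)
    (hf : IsSignFamily T n f) (hblk : Monotone blk) (hR : RieszControl f n blk q ρ m)
    (d : ℕ) {V' : Finset ℕ} (hV' : V' ⊆ Finset.range q) (hl : 0 < l) (hτ : 0 ≤ τ)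
    (hτM : 2 * (M : ℝ) ^ 2 * (n + 1) ≤ τ ^ 2) (hlτ : (l : ℝ) ^ 2 * τ ≤ n + 1) :
    𝔼 ω, |∑ V ∈ (Finset.range q).powersetCard 2, ∑ c ∈ Finset.range (n + 1),
        rieszTerm f n blk q ρ c d V V' ω| ≤ q ^ 2 * pairBound n q M l ρ σ * σ ^ V'.card := by
  have hσ := h.σ_pos
  have h_bound := h.pairBound_nonneg l
  have h_pair : ∀ V ∈ (Finset.range q).powersetCard 2,
      𝔼 ω, |∑ c ∈ Finset.range (n + 1), rieszTerm f n blk q ρ c d V V' ω| ≤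
        pairBound n q M l ρ σ * σ ^ V'.card := fun V hV => by
    obtain ⟨hVq, h_card⟩ := Finset.mem_powersetCard.1 hV
    obtain ⟨t, u, htu, rfl⟩ := Finset.card_eq_two.1 h_card
    have ht : t < q := Finset.mem_range.1 (hVq (by simp))
    have hu : u < q := Finset.mem_range.1 (hVq (by simp))
    rcases htu.lt_or_gt with hlt | hlt
    · exact h.expect_abs_sum_rieszTerm_pair_le hf hblk hR hlt hu d hV' hl hτ hτM hlτ
    · rw [Finset.pair_comm]
      exact h.expect_abs_sum_rieszTerm_pair_le hf hblk hR hlt ht d hV' hl hτ hτM hlτ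
  calc _ ≤ ∑ _V ∈ (Finset.range q).powersetCard 2, pairBound n q M l ρ σ * σ ^ V'.card :=
        (expect_abs_sum_le _ _).trans (Finset.sum_le_sum h_pair)
    _ = q.choose 2 * (pairBound n q M l ρ σ * σ ^ V'.card) := by
        rw [Finset.sum_const, Finset.card_powersetCard, Finset.card_range, nsmul_eq_mul]
    _ ≤ q ^ 2 * (pairBound n q M l ρ σ * σ ^ V'.card) := by
        gcongr
        exact_mod_cast Nat.choose_le_pow q 2
    _ = _ := (mul_assoc _ _ _).symm

theorem expect_abs_sum_card_ge_three_le (h : TermParams n q m M ρ σ) (hf : IsSignFamily T n f)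
    (hR : RieszControl f n blk q ρ m) (d : ℕ) {V' : Finset ℕ} (hV' : V' ⊆ Finset.range q)
    (hqσ : q * σ ≤ 1) :
    𝔼 ω, |∑ V ∈ (Finset.range q).powerset with 3 ≤ V.card, ∑ c ∈ Finset.range (n + 1),
        rieszTerm f n blk q ρ c d V V' ω| ≤ 15 * (n + 1) * (q * σ) ^ 3 * σ ^ V'.card := by
  have hσ := h.σ_pos
  have h_powers := sum_powerset_pow_card_le (Finset.range q) hσ.le (j := 3)
    (by rwa [Finset.card_range]) (by norm_num)
  rw [Finset.card_range] at h_powers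
  calc _ ≤ ∑ V ∈ (Finset.range q).powerset with 3 ≤ V.card, ∑ _c ∈ Finset.range (n + 1),
          5 * σ ^ (V.card + V'.card) :=
        (expect_abs_sum_le _ _).trans <| Finset.sum_le_sum fun V hV =>
          (expect_abs_sum_le _ _).trans <| Finset.sum_le_sum fun c _ =>
            h.expect_abs_rieszTerm_le hf hR c d
              (Finset.mem_powerset.1 (Finset.mem_filter.1 hV).1) hV'
    _ = 5 * (n + 1) * σ ^ V'.card *
          ∑ V ∈ (Finset.range q).powerset with 3 ≤ V.card, σ ^ V.card := by
        rw [Finset.mul_sum]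
        refine Finset.sum_congr rfl fun V _ => ?_
        rw [Finset.sum_const, Finset.card_range, nsmul_eq_mul, pow_add, Nat.cast_succ]
        ring
    _ ≤ 5 * (n + 1) * σ ^ V'.card * (3 * (q * σ) ^ 3) := by gcongr
    _ = _ := by ring

theorem expect_abs_repeatedPart_le (h : TermParams n q m M ρ σ)
    (hf : IsSignFamily T n f) (hblk : Monotone blk) (hR : RieszControl f n blk q ρ m)
    (d : ℕ) {V' : Finset ℕ} (hV' : V' ⊆ Finset.range q) (hl : 0 < l) (hτ : 0 ≤ τ)
    (hτM : 2 * (M : ℝ) ^ 2 * (n + 1) ≤ τ ^ 2) (hlτ : (l : ℝ) ^ 2 * τ ≤ n + 1)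
    (hqσ : q * σ ≤ 1) :
    𝔼 ω, |repeatedPart f n blk q ρ d V' ω| ≤ repeatedBound n q M l ρ σ * σ ^ V'.card := by
  simp only [repeatedPart, sum_powerset_card_ge _ 2]
  refine (expect_abs_add_le _ _).trans ?_
  rw [repeatedBound, add_mul]
  exact add_le_add
    (h.expect_abs_sum_powersetCard_two_le hf hblk hR d hV' hl hτ hτM hlτ)
    (h.expect_abs_sum_card_ge_three_le hf hR d hV' hqσ)

theorem expect_abs_sum_repeatedPart_le (h : TermParams n q m M ρ σ)
    (hf : IsSignFamily T n f) (hblk : Monotone blk) (hR : RieszControl f n blk q ρ m)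
    (hl : 0 < l) (hτ : 0 ≤ τ) (hτM : 2 * (M : ℝ) ^ 2 * (n + 1) ≤ τ ^ 2)
    (hlτ : (l : ℝ) ^ 2 * τ ≤ n + 1) (hqσ : q * σ ≤ 1) :
    𝔼 ω, |∑ V' ∈ (Finset.range q).powerset with 2 ≤ V'.card, ∑ d ∈ Finset.range (n + 1),
        repeatedPart f n blk q ρ d V' ω| ≤
      3 * (q * σ) ^ 2 * (n + 1) * repeatedBound n q M l ρ σ := by
  have h_bound := h.repeatedBound_nonneg l
  have h_powers := sum_powerset_pow_card_le (Finset.range q) h.σ_pos.le (j := 2)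
    (by rwa [Finset.card_range]) (by norm_num)
  rw [Finset.card_range] at h_powers
  calc _ ≤ ∑ V' ∈ (Finset.range q).powerset with 2 ≤ V'.card, ∑ _d ∈ Finset.range (n + 1),
          repeatedBound n q M l ρ σ * σ ^ V'.card :=
        (expect_abs_sum_le _ _).trans <| Finset.sum_le_sum fun V' hV' =>
          (expect_abs_sum_le _ _).trans <| Finset.sum_le_sum fun d _ =>
            h.expect_abs_repeatedPart_le hf hblk hR d
              (Finset.mem_powerset.1 (Finset.mem_filter.1 hV').1) hl hτ hτM hlτ hqσ
    _ = (n + 1) * repeatedBound n q M l ρ σ *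
          ∑ V' ∈ (Finset.range q).powerset with 2 ≤ V'.card, σ ^ V'.card := by
        rw [Finset.mul_sum]
        refine Finset.sum_congr rfl fun V' _ => ?_
        rw [Finset.sum_const, Finset.card_range, nsmul_eq_mul, Nat.cast_succ, mul_assoc]
    _ ≤ (n + 1) * repeatedBound n q M l ρ σ * (3 * (q * σ) ^ 2) := by gcongr
    _ = _ := by ring

theorem expect_abs_mainPart_le (h : TermParams n q m M ρ σ)
    (hf : IsSignFamily T n f) (hblk : Monotone blk) (hR : RieszControl f n blk q ρ m)
    (hR' : RieszControl (swapFamily f) n blk q ρ m) (hl : 0 < l) (hτ : 0 ≤ τ)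
    (hτM : 2 * (M : ℝ) ^ 2 * (n + 1) ≤ τ ^ 2) (hlτ : (l : ℝ) ^ 2 * τ ≤ n + 1)
    (hqσ : q * σ ≤ 1) :
    𝔼 ω, |mainPart f n blk q ρ ω| ≤
      6 + 2 * repeatedBound n q M l ρ σ +
        3 * (q * σ) ^ 2 * (n + 1) * repeatedBound n q M l ρ σ := by
  have h_sub : ∀ g g' : Ω → ℝ, 𝔼 ω, |g ω - g' ω| ≤ 𝔼 ω, |g ω| + 𝔼 ω, |g' ω| := fun g g' => by
    simpa only [sub_eq_add_neg, abs_neg] using expect_abs_add_le g fun ω => -g' ω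
  have h_all : 𝔼 ω, |rieszTerm f n blk q ρ (n + 1) (n + 1) ∅ ∅ ω| ≤ 5 := by
    simpa using h.expect_abs_rieszTerm_le hf hR (n + 1) (n + 1) (Finset.empty_subset _)
      (Finset.empty_subset _)
  have h_one : 𝔼 _ω : Ω, |(1 : ℝ)| = 1 := by simp
  have h_second : 𝔼 ω, |repeatedPart f n blk q ρ (n + 1) ∅ ω| ≤ repeatedBound n q M l ρ σ := by
    simpa using h.expect_abs_repeatedPart_le hf hblk hR (n + 1) (Finset.empty_subset _) hl hτ hτM
      hlτ hqσ
  have h_third : 𝔼 ω, |repeatedPart (swapFamily f) n blk q ρ (n + 1) ∅ ω| ≤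
      repeatedBound n q M l ρ σ := by
    simpa using h.expect_abs_repeatedPart_le hf.swap hblk hR' (n + 1) (Finset.empty_subset _) hl
      hτ hτM hlτ hqσ
  have h_both := h.expect_abs_sum_repeatedPart_le hf hblk hR hl hτ hτM hlτ hqσ
  simp only [mainPart_eq]
  refine (expect_abs_add_le _ _).trans (add_le_add ?_ h_both)
  refine (h_sub _ _).trans ((add_le_add (h_sub _ _) le_rfl).trans
    ((add_le_add (add_le_add (h_sub _ _) le_rfl) le_rfl).trans ?_))
  linarith

end TermParams

/-- Testing the sum against the main part of the Riesz product, which has the same Haar coefficients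
as the sum of all sign functions, up to the factor `ρ`. -/
theorem mul_sum_expect_abs_le (hf : IsSignFamily T n f) (hblk : Monotone blk)
    (hq : ∀ a ≤ n, blk a < q) {H : Scale → Ω → ℝ} {S : Finset Scale}
    (hS : ∀ s ∈ S, ∑ i, s i = n) (hH : ∀ s ∈ S, IsHaar T s (H s))
    (hHf : ∀ s ∈ S, ∀ ω, H s ω * f s ω = |H s ω|) {X B : ℝ}
    (hX : ∀ ω, |∑ s ∈ S, H s ω| ≤ X) (hX₀ : 0 ≤ X)
    (hB : 𝔼 ω, |mainPart f n blk q ρ ω| ≤ B) :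
    ρ * ∑ s ∈ S, 𝔼 ω, |H s ω| ≤ X * B := by
  calc ρ * ∑ s ∈ S, 𝔼 ω, |H s ω| = 𝔼 ω, (∑ s ∈ S, H s ω) * mainPart f n blk q ρ ω := by
        simp only [Finset.sum_mul, Finset.expect_sum_comm, Finset.mul_sum]
        refine Finset.sum_congr rfl fun s hs => ?_
        rw [expect_haar_mul_mainPart hf hblk (hS s hs) (hq _ (coord_le (hS s hs) 0)) (hH s hs)]
        simp only [hHf s hs]
    _ ≤ 𝔼 ω, X * |mainPart f n blk q ρ ω| := Finset.expect_le_expect fun ω _ => by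
        refine (le_abs_self _).trans ?_
        rw [abs_mul]
        exact mul_le_mul_of_nonneg_right (hX ω) (abs_nonneg _)
    _ ≤ X * B := by
        rw [← Finset.mul_expect]
        gcongr

end MainPartBound

section Parameters

/-- The index of the block containing `a`, when `{0, …, n}` is cut into `q` blocks of nearly equal
length. -/
def equalBlock (n q a : ℕ) : ℕ := a * q / (n + 1)

theorem monotone_equalBlock (n q : ℕ) : Monotone (equalBlock n q) := fun _ _ h =>
  Nat.div_le_div_right (Nat.mul_le_mul_right _ h)

theorem equalBlock_lt {n q a : ℕ} (hq : 0 < q) (ha : a ≤ n) : equalBlock n q a < q := by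
  rw [equalBlock, Nat.div_lt_iff_lt_mul (Nat.succ_pos n), mul_comm a]
  exact Nat.mul_lt_mul_of_pos_left (Nat.lt_succ_of_le ha) hq

theorem card_filter_equalBlock_eq_le {q n : ℕ} (hq : 0 < q) (w : ℕ) :
    ((Finset.range (n + 1)).filter fun a => equalBlock n q a = w).card ≤ (n + 1) / q + 2 := by
  have h_sub : ((Finset.range (n + 1)).filter fun a => equalBlock n q a = w) ⊆
      Finset.Ico (w * (n + 1) / q) (w * (n + 1) / q + ((n + 1) / q + 2)) := by
    intro a ha
    have h := (Finset.mem_filter.1 ha).2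
    rw [equalBlock, Nat.div_eq_iff (Nat.succ_pos n), Nat.succ_eq_add_one] at h
    generalize w * (n + 1) = y at h ⊢
    have hy : y < (y / q + 1) * q := by
      simpa only [mul_comm] using Nat.lt_mul_div_succ y hq
    have hn : n + 1 < ((n + 1) / q + 1) * q := by
      simpa only [mul_comm] using Nat.lt_mul_div_succ (n + 1) hq
    rw [Finset.mem_Ico]
    refine ⟨(Nat.div_le_iff_le_mul_add_pred hq).2 (by rw [mul_comm q a]; omega),
      lt_of_mul_lt_mul_right (a := q) ?_ (Nat.zero_le _)⟩
    have : (y / q + ((n + 1) / q + 2)) * q = (y / q + 1) * q + ((n + 1) / q + 1) * q := by ring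
    omega
  simpa using Finset.card_le_card h_sub

theorem card_scales_le {n : ℕ} {S : Finset Scale} (hS : ∀ s ∈ S, ∑ i, s i = n) {I : Finset ℕ}
    (hI : ∀ s ∈ S, s 0 ∈ I) : S.card ≤ I.card * (n + 1) := by
  calc S.card ≤ (I ×ˢ Finset.range (n + 1)).card := by
        refine Finset.card_le_card_of_injOn (fun r => (r 0, r 1)) (fun r hr => ?_)
          fun r hr s hs h => ?_
        · exact Finset.mem_coe.2 (Finset.mem_product.2
            ⟨hI r hr, Finset.mem_range_succ_iff.2 (coord_le (hS r hr) 1)⟩)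
        · exact eq_of_two_coords (i := 0) (j := 1) (by decide) (hS r hr) (hS s hs)
            (congrArg Prod.fst h) (congrArg Prod.snd h)
    _ = _ := by rw [Finset.card_product, Finset.card_range]

theorem IsBlocked.card_le {n q : ℕ} (hq : 0 < q) {A : ℕ → Finset Scale}
    (hA : IsBlocked n (equalBlock n q) A) (w : ℕ) :
    (A w).card ≤ ((n + 1) / q + 2) * (n + 1) := by
  have h_first : ∀ r ∈ A w, r 0 ∈ (Finset.range (n + 1)).filter fun a => equalBlock n q a = w :=
    fun r hr => Finset.mem_filter.2
      ⟨Finset.mem_range_succ_iff.2 (coord_le (hA w r hr).1 0), (hA w r hr).2⟩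
  exact (card_scales_le (fun r hr => (hA w r hr).1) h_first).trans
    (Nat.mul_le_mul_right _ (card_filter_equalBlock_eq_le hq w))

/-- The number of scales is large compared with the parameter `k` of the proof, and `s` is its
square root. The other parameters are powers of `k`, up to constants: there are `q = k ^ 16` blocks,
the Riesz products have coefficient `ρ = k / (2 * (n + 1))`, and moments of order `m = k ^ 3` are
used. The exponents leave room for every estimate below. -/
structure LargeParams (n k : ℕ) (s : ℝ) : Prop where
  le_k : (100 : ℝ) ≤ k
  pow_le : (k : ℝ) ^ 500 ≤ s
  sq_eq : (n : ℝ) + 1 = s ^ 2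

theorem largeParams_sqrt {n k : ℕ} (hk : 100 ≤ k) (hn : k ^ 1000 ≤ n + 1) :
    LargeParams n k √(n + 1) where
  le_k := by exact_mod_cast hk
  pow_le := by
    refine Real.le_sqrt_of_sq_le ?_
    have := Nat.cast_le (α := ℝ).2 hn
    rwa [Nat.cast_pow, Nat.cast_succ, show 1000 = 500 * 2 from rfl, pow_mul] at this
  sq_eq := (Real.sq_sqrt (by positivity)).symm

theorem one_add_pow_le_four_pow {k : ℕ} (hk : (100 : ℝ) ≤ k) :
    (1 + 1 / (2 * (k : ℝ) ^ 14) + 2 * (1 / (k : ℝ) ^ 16)) ^ k ^ 16 ≤ 4 ^ (k ^ 3 - 1) := by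
  have hk_pos : (0 : ℝ) < k := by linarith
  set x : ℝ := 1 / (2 * (k : ℝ) ^ 14) + 2 * (1 / (k : ℝ) ^ 16) with hx
  have h_mul : ((k ^ 16 : ℕ) : ℝ) * x = (k : ℝ) ^ 2 / 2 + 2 := by
    rw [hx]
    push_cast
    field_simp
  have h_exponent : (k : ℝ) ^ 2 / 2 + 2 ≤ ((k ^ 3 - 1 : ℕ) : ℝ) := by
    rw [Nat.cast_sub (Nat.one_le_pow _ _ (by exact_mod_cast hk_pos))]
    push_cast
    nlinarith [pow_pos hk_pos 2]
  calc _ ≤ Real.exp x ^ k ^ 16 := by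
        gcongr
        linarith [Real.add_one_le_exp x]
    _ = Real.exp ((k : ℝ) ^ 2 / 2 + 2) := by rw [← Real.exp_nat_mul, h_mul]
    _ ≤ Real.exp ((k ^ 3 - 1 : ℕ) * 1) := by
        rw [mul_one]
        exact Real.exp_le_exp.2 h_exponent
    _ = Real.exp 1 ^ (k ^ 3 - 1) := Real.exp_nat_mul _ _
    _ ≤ _ := by
        gcongr
        linarith [Real.exp_one_lt_d9]

theorem four_pow_mul_pow_le {k : ℕ} (hk : (100 : ℝ) ≤ k) :
    (4 : ℝ) ^ (k ^ 3 - 1) * (((k ^ 16 : ℕ) : ℝ) *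
      (4 * ((k ^ 3 : ℕ) : ℝ) ^ 4 * (1 / (2 * k ^ 14))) ^ k ^ 3) ≤ 1 / 4 := by
  have hk_pos : (0 : ℝ) < k := by linarith
  have hk_nat : 100 ≤ k := by exact_mod_cast hk
  have h16 : 16 ≤ k ^ 3 := (by norm_num : 16 ≤ 100 ^ 3).trans (Nat.pow_le_pow_left hk_nat 3)
  have h_base : 4 * ((k ^ 3 : ℕ) : ℝ) ^ 4 * (1 / (2 * k ^ 14)) = 2 / k ^ 2 := by
    push_cast
    field_simp
    ring
  have h_four : (4 : ℝ) ^ (k ^ 3 - 1) = 4 ^ k ^ 3 / 4 := by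
    rw [eq_div_iff (by norm_num), ← pow_succ, Nat.sub_add_cancel (by omega)]
  rw [h_base, h_four]
  calc (4 : ℝ) ^ k ^ 3 / 4 * (((k ^ 16 : ℕ) : ℝ) * (2 / k ^ 2) ^ k ^ 3)
      = (k : ℝ) ^ 16 * (4 * (2 / k ^ 2)) ^ k ^ 3 / 4 := by
        rw [mul_pow 4]
        push_cast
        ring
    _ ≤ (k : ℝ) ^ 16 * (1 / k) ^ k ^ 3 / 4 := by
        gcongr (k : ℝ) ^ 16 * ?_ ^ _ / 4
        rw [mul_div_assoc', div_le_div_iff₀ (by positivity) (by positivity)]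
        nlinarith
    _ ≤ (k : ℝ) ^ 16 * (1 / k) ^ 16 / 4 := by
        gcongr (k : ℝ) ^ 16 * ?_ / 4
        exact pow_le_pow_of_le_one (by positivity) (by rw [div_le_one hk_pos]; linarith) h16
    _ = 1 / 4 := by rw [← mul_pow, mul_one_div_cancel hk_pos.ne', one_pow]

theorem pow_sq_mul_pow_le {B Y η : ℝ} (h : B ^ 2 * Y ^ 10 ≤ η ^ 20) (q : ℕ) :
    (B ^ q) ^ 2 * Y ^ (10 * q) ≤ η ^ (2 * (10 * q)) := by
  calc _ = (B ^ 2 * Y ^ 10) ^ q := by ring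
    _ ≤ (η ^ 20) ^ q := pow_le_pow_left₀ (by positivity) h q
    _ = _ := by ring

/-- The order of the moments controlled in the estimates of the main part. -/
def momentOrder (k : ℕ) : ℕ := 2 * k ^ 3 * (k ^ 16 + 1)

/-- The constant `a` in the size `σ = a / s` of the moments of the normalized block sums. -/
def momentConst (k : ℕ) : ℝ := 16 * (momentOrder k : ℝ) ^ 2 * k

theorem one_le_momentOrder {k : ℕ} (hk : (100 : ℝ) ≤ k) : (1 : ℝ) ≤ momentOrder k := by
  have hk_nat : 0 < k := by exact_mod_cast (by linarith : (0 : ℝ) < k)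
  exact_mod_cast (by unfold momentOrder; positivity : 0 < momentOrder k)

theorem momentOrder_le {k : ℕ} (hk : (100 : ℝ) ≤ k) : (momentOrder k : ℝ) ≤ k ^ 20 := by
  have h16 : (1 : ℝ) ≤ k ^ 16 := one_le_pow₀ (by linarith)
  calc (momentOrder k : ℝ) = 2 * k ^ 3 * (k ^ 16 + 1) := by
        rw [momentOrder]
        push_cast
        ring
    _ ≤ 2 * k ^ 3 * (k ^ 16 + k ^ 16) := by gcongr
    _ = 4 * k ^ 19 := by ring
    _ ≤ k * k ^ 19 := by gcongr; linarith
    _ = _ := by ring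

theorem one_le_momentConst {k : ℕ} (hk : (100 : ℝ) ≤ k) : 1 ≤ momentConst k := by
  have h_order := one_le_pow₀ (one_le_momentOrder hk) (n := 2)
  rw [momentConst]
  nlinarith

theorem momentConst_le {k : ℕ} (hk : (100 : ℝ) ≤ k) : momentConst k ≤ k ^ 42 := by
  calc momentConst k ≤ k * (k ^ 20) ^ 2 * k := by
        rw [momentConst]
        gcongr
        · linarith
        · exact momentOrder_le hk
    _ = _ := by ring

namespace LargeParams

variable {n k : ℕ} {s : ℝ}

theorem k_pos (h : LargeParams n k s) : (0 : ℝ) < k := by linarith [h.le_k]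

theorem one_le_k (h : LargeParams n k s) : (1 : ℝ) ≤ k := by linarith [h.le_k]

theorem s_pos (h : LargeParams n k s) : 0 < s := h.pow_le.trans_lt' (pow_pos h.k_pos _)

theorem one_le_s (h : LargeParams n k s) : 1 ≤ s := h.pow_le.trans' (one_le_pow₀ h.one_le_k)

theorem card_le (h : LargeParams n k s) {A : ℕ → Finset Scale}
    (hA : IsBlocked n (equalBlock n (k ^ 16)) A) (w : ℕ) :
    ((A w).card : ℝ) ≤ 2 * (s ^ 2) ^ 2 / k ^ 16 := by
  have hk := h.k_pos
  have h_count : ((A w).card : ℝ) ≤ (((n + 1) / k ^ 16 : ℕ) + 2) * (n + 1) := by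
    exact_mod_cast hA.card_le (pow_pos (by exact_mod_cast hk) 16) w
  have h_div : (((n + 1) / k ^ 16 : ℕ) : ℝ) ≤ ((n : ℝ) + 1) / k ^ 16 := by
    have := Nat.cast_div_le (α := ℝ) (m := n + 1) (n := k ^ 16)
    rwa [Nat.cast_pow, Nat.cast_succ] at this
  have h_two : 2 ≤ ((n : ℝ) + 1) / k ^ 16 := by
    rw [le_div_iff₀ (by positivity), h.sq_eq]
    calc 2 * (k : ℝ) ^ 16 ≤ k * k ^ 16 := by gcongr; linarith [h.le_k]
      _ = (k : ℝ) ^ 17 := by ring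
      _ ≤ (k : ℝ) ^ 500 := pow_le_pow_right₀ h.one_le_k (by norm_num)
      _ ≤ s := h.pow_le
      _ ≤ s ^ 2 := le_self_pow₀ h.one_le_s two_ne_zero
  calc ((A w).card : ℝ) ≤ _ := h_count
    _ ≤ (((n : ℝ) + 1) / k ^ 16 + ((n : ℝ) + 1) / k ^ 16) * (n + 1) := by gcongr
    _ = _ := by rw [h.sq_eq]; ring

theorem sq_mul_card_le (h : LargeParams n k s) {A : ℕ → Finset Scale}
    (hA : IsBlocked n (equalBlock n (k ^ 16)) A) (w : ℕ) :
    ((k : ℝ) / (2 * (n + 1))) ^ 2 * (A w).card ≤ 1 / (2 * k ^ 14) := by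
  have hk := h.k_pos
  have hs := h.s_pos
  calc _ ≤ ((k : ℝ) / (2 * (n + 1))) ^ 2 * (2 * (s ^ 2) ^ 2 / k ^ 16) := by
        gcongr
        exact h.card_le hA w
    _ = _ := by rw [h.sq_eq]; field_simp

theorem one_add_mul_card_le (h : LargeParams n k s) {A : ℕ → Finset Scale}
    (hA : IsBlocked n (equalBlock n (k ^ 16)) A) (w : ℕ) :
    1 + |(k : ℝ) / (2 * (n + 1))| * (A w).card ≤ k * s ^ 2 := by
  have hk := h.k_pos
  have hs := h.s_pos
  have h_one : 1 ≤ k * s ^ 2 / 100 := by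
    have := one_le_pow₀ h.one_le_s (n := 2)
    nlinarith [h.le_k]
  rw [abs_of_nonneg (by positivity), h.sq_eq]
  calc 1 + (k : ℝ) / (2 * s ^ 2) * (A w).card
      ≤ 1 + (k : ℝ) / (2 * s ^ 2) * (2 * (s ^ 2) ^ 2 / (100 * k ^ 15)) := by
        gcongr
        refine (h.card_le hA w).trans ?_
        gcongr
        calc 100 * (k : ℝ) ^ 15 ≤ k * k ^ 15 := by gcongr; exact h.le_k
          _ = (k : ℝ) ^ 16 := by ring
    _ = 1 + k * s ^ 2 / 100 / k ^ 15 := by field_simp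
    _ ≤ 1 + k * s ^ 2 / 100 / 1 := by
        gcongr
        exact one_le_pow₀ h.one_le_k
    _ ≤ _ := by linarith

theorem riesz_error_le (h : LargeParams n k s) :
    ((k : ℝ) * s ^ 2) ^ 2 * (4 * (k / (2 * s ^ 2)) ^ 4 * (8 * (10 * k ^ 16) ^ 4 * ((s ^ 2) ^ 3 +
      (s ^ 2) ^ 3 * (2 * (10 * k ^ 16) * s)))) ^ 10 ≤ (1 / k ^ 16) ^ 20 := by
  have hk := h.k_pos
  have hs := h.s_pos
  have h16 : (1 : ℝ) ≤ k ^ 16 := one_le_pow₀ h.one_le_k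
  have h_const : (600000 : ℝ) ≤ k ^ 3 :=
    (by norm_num : (600000 : ℝ) ≤ 100 ^ 3).trans (pow_le_pow_left₀ (by norm_num) h.le_k 3)
  have h_inner : 4 * ((k : ℝ) / (2 * s ^ 2)) ^ 4 * (8 * (10 * k ^ 16) ^ 4 * ((s ^ 2) ^ 3 +
      (s ^ 2) ^ 3 * (2 * (10 * k ^ 16) * s))) ≤ k ^ 87 / s := by
    have h_sum : 1 + 2 * (10 * (k : ℝ) ^ 16) * s ≤ 30 * k ^ 16 * s := by
      nlinarith [mul_le_mul h16 h.one_le_s zero_le_one (by positivity)]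
    calc _ = 20000 * (k : ℝ) ^ 68 * (1 + 2 * (10 * k ^ 16) * s) / s ^ 2 := by field_simp; ring
      _ ≤ 20000 * (k : ℝ) ^ 68 * (30 * k ^ 16 * s) / s ^ 2 := by gcongr
      _ = 600000 * (k : ℝ) ^ 84 / s := by field_simp; ring
      _ ≤ (k : ℝ) ^ 3 * k ^ 84 / s := by gcongr
      _ = _ := by ring
  calc _ ≤ ((k : ℝ) * s ^ 2) ^ 2 * (k ^ 87 / s) ^ 10 := by gcongr
    _ = (k : ℝ) ^ 872 / s ^ 6 := by field_simp
    _ ≤ (k : ℝ) ^ 872 / (k ^ 500) ^ 6 := by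
        gcongr
        exact h.pow_le
    _ ≤ (1 / (k : ℝ) ^ 16) ^ 20 := by
        rw [div_pow, one_pow, div_le_div_iff₀ (by positivity) (by positivity), one_mul,
          ← pow_mul, ← pow_mul, ← pow_add]
        exact pow_le_pow_right₀ h.one_le_k (by norm_num)

variable {Ω : Type*} [Fintype Ω] {T : Fin 3 → ℕ → Equiv.Perm Ω} {f : Scale → Ω → ℝ}

theorem expect_rieszProd_sq_le [Nonempty Ω] (h : LargeParams n k s) (hf : IsSignFamily T n f)
    {A : ℕ → Finset Scale} (hA : IsBlocked n (equalBlock n (k ^ 16)) A) :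
    𝔼 ω, rieszProd f (k / (2 * (n + 1))) 1 A (Finset.range (k ^ 16)) ω ^ 2 ≤ 4 ^ (k ^ 3 - 1) := by
  have hk := h.k_pos
  have hs := h.s_pos
  have hk_nat : 0 < k := by exact_mod_cast hk
  refine (_root_.expect_rieszProd_sq_le hf (monotone_equalBlock n _) hA (m := 10 * k ^ 16)
    (by positivity) (by positivity : (0 : ℝ) < 1 / k ^ 16) (h.sq_mul_card_le hA)
    (h.one_add_mul_card_le hA) (by positivity : 0 ≤ 2 * (10 * (k : ℝ) ^ 16) * s) ?_ ?_).trans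
    (one_add_pow_le_four_pow h.le_k)
  · push_cast
    rw [h.sq_eq]
    have : 0 ≤ (10 * (k : ℝ) ^ 16) ^ 2 * s ^ 2 := by positivity
    linarith
  · push_cast
    rw [h.sq_eq]
    exact pow_sq_mul_pow_le h.riesz_error_le _

theorem rieszControl [Nonempty Ω] (h : LargeParams n k s) (hf : IsSignFamily T n f) :
    RieszControl f n (equalBlock n (k ^ 16)) (k ^ 16) (k / (2 * (n + 1))) (k ^ 3) := by
  refine ⟨fun A hA => expect_abs_rieszProd_le (m := k ^ 3) hf (monotone_equalBlock n _) hA _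
    (h.sq_mul_card_le hA) (h.expect_rieszProd_sq_le hf hA) ?_,
    fun A hA => h.expect_rieszProd_sq_le hf hA⟩
  rw [Finset.card_range]
  exact four_pow_mul_pow_le h.le_k

theorem termParams (h : LargeParams n k s) : TermParams n (k ^ 16) (k ^ 3) (momentOrder k)
    (k / (2 * (n + 1))) (momentConst k / s) := by
  have hk := h.k_pos
  have hs := h.s_pos
  have hk_nat : 0 < k := by exact_mod_cast hk
  have h_const := one_le_momentConst h.le_k
  refine ⟨by positivity, le_rfl, by positivity, by positivity, ?_, ?_⟩
  · rw [h.sq_eq, momentConst]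
    push_cast
    refine le_of_eq ?_
    field_simp
    ring
  · rw [h.sq_eq, div_pow, div_mul_cancel₀ _ (by positivity)]
    exact one_le_pow₀ h_const

theorem pow_mul_momentConst_div_le_one (h : LargeParams n k s) :
    ((k ^ 16 : ℕ) : ℝ) * (momentConst k / s) ≤ 1 := by
  rw [Nat.cast_pow, mul_div_assoc', div_le_one h.s_pos]
  calc (k : ℝ) ^ 16 * momentConst k ≤ k ^ 16 * k ^ 42 := by
        gcongr
        exact momentConst_le h.le_k
    _ = (k : ℝ) ^ 58 := by ring
    _ ≤ (k : ℝ) ^ 500 := pow_le_pow_right₀ h.one_le_k (by norm_num)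
    _ ≤ s := h.pow_le

theorem sq_mul_pairBound_le (h : LargeParams n k s) :
    ((k ^ 16 : ℕ) : ℝ) ^ 2 * pairBound n (k ^ 16) (momentOrder k) (k ^ 200) (k / (2 * (n + 1)))
      (momentConst k / s) ≤ 2 / k ^ 125 := by
  have hk := h.k_pos
  have hk_one := h.one_le_k
  have hs := h.s_pos
  have h_const := (one_le_momentConst h.le_k).trans' zero_le_one
  have h_count : ((n / (k ^ 200) ^ 2 : ℕ) : ℝ) + 1 ≤ 2 * (s ^ 2 / (k ^ 200) ^ 2) := by
    have h_div : ((n / (k ^ 200) ^ 2 : ℕ) : ℝ) ≤ s ^ 2 / (k ^ 200) ^ 2 := by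
      refine Nat.cast_div_le.trans ?_
      push_cast
      gcongr
      linarith [h.sq_eq]
    have h_one : 1 ≤ s ^ 2 / ((k : ℝ) ^ 200) ^ 2 := by
      rw [one_le_div (by positivity)]
      gcongr
      exact h.pow_le.trans' (pow_le_pow_right₀ hk_one (by norm_num))
    linarith
  have h_near : ((k : ℝ) ^ 16) ^ 2 * ((((n / (k ^ 200) ^ 2 : ℕ) : ℝ) + 1) *
      (20 * (k / (2 * s ^ 2)) ^ 2 * momentOrder k ^ 2 * s ^ 2 * k ^ 200)) ≤ 1 / k ^ 125 := by
    calc _ ≤ ((k : ℝ) ^ 16) ^ 2 * (2 * (s ^ 2 / (k ^ 200) ^ 2) *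
          (20 * (k / (2 * s ^ 2)) ^ 2 * (k ^ 20) ^ 2 * s ^ 2 * k ^ 200)) := by
          gcongr
          exact momentOrder_le h.le_k
      _ = 10 * (k : ℝ) ^ 74 / k ^ 200 := by field_simp; ring
      _ ≤ (k : ℝ) * k ^ 74 / k ^ 200 := by gcongr; linarith [h.le_k]
      _ = _ := by field_simp
  have h_far : ((k : ℝ) ^ 16) ^ 2 * (s ^ 2 * (k ^ 16 * (5 * ((momentConst k / s) ^ 3 *
      k ^ 200)))) ≤ 1 / k ^ 125 := by
    calc _ ≤ ((k : ℝ) ^ 16) ^ 2 * (s ^ 2 * (k ^ 16 * (5 * ((k ^ 42 / s) ^ 3 * k ^ 200)))) := by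
          gcongr
          exact momentConst_le h.le_k
      _ = 5 * (k : ℝ) ^ 374 / s := by field_simp
      _ ≤ (k : ℝ) * k ^ 374 / k ^ 500 := by
          gcongr
          · linarith [h.le_k]
          · exact h.pow_le
      _ = _ := by field_simp
  rw [pairBound, h.sq_eq, mul_add]
  push_cast
  linarith [add_div (1 : ℝ) 1 (k ^ 125)]

theorem repeatedBound_le (h : LargeParams n k s) :
    repeatedBound n (k ^ 16) (momentOrder k) (k ^ 200) (k / (2 * (n + 1)))
      (momentConst k / s) ≤ 3 / k ^ 125 := by
  have hk := h.k_pos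
  have hk_one := h.one_le_k
  have hs := h.s_pos
  have h_const := (one_le_momentConst h.le_k).trans' zero_le_one
  have h_cubic : 15 * s ^ 2 * ((k : ℝ) ^ 16 * (momentConst k / s)) ^ 3 ≤ 1 / k ^ 125 := by
    calc _ ≤ 15 * s ^ 2 * ((k : ℝ) ^ 16 * (k ^ 42 / s)) ^ 3 := by
          gcongr
          exact momentConst_le h.le_k
      _ = 15 * (k : ℝ) ^ 174 / s := by field_simp
      _ ≤ (k : ℝ) * k ^ 174 / k ^ 500 := by
          gcongr
          · linarith [h.le_k]
          · exact h.pow_le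
      _ = 1 / (k : ℝ) ^ 325 := by field_simp
      _ ≤ _ := by
          gcongr
          norm_num
  calc _ ≤ 2 / (k : ℝ) ^ 125 + 1 / k ^ 125 := by
        rw [repeatedBound]
        refine add_le_add h.sq_mul_pairBound_le ?_
        rw [h.sq_eq, Nat.cast_pow]
        exact h_cubic
    _ = _ := by ring

theorem expect_abs_mainPart_le [Nonempty Ω] (h : LargeParams n k s) (hf : IsSignFamily T n f) :
    𝔼 ω, |mainPart f n (equalBlock n (k ^ 16)) (k ^ 16) (k / (2 * (n + 1))) ω| ≤ 7 := by
  have hk := h.k_pos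
  have hk_one := h.one_le_k
  have hs := h.s_pos
  have h_const := (one_le_momentConst h.le_k).trans' zero_le_one
  have h_bound := h.termParams.repeatedBound_nonneg (k ^ 200)
  have h_gap : ((k ^ 200 : ℕ) : ℝ) ^ 2 * (2 * momentOrder k * s) ≤ n + 1 := by
    rw [h.sq_eq, Nat.cast_pow]
    calc ((k : ℝ) ^ 200) ^ 2 * (2 * momentOrder k * s) ≤ (k ^ 200) ^ 2 * (k * k ^ 20 * s) := by
          gcongr
          · linarith [h.le_k]
          · exact momentOrder_le h.le_k
      _ = k ^ 421 * s := by ring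
      _ ≤ k ^ 500 * s := by
          gcongr
          norm_num
      _ ≤ s * s := by gcongr; exact h.pow_le
      _ = _ := (sq s).symm
  have h_mainPart := h.termParams.expect_abs_mainPart_le hf (monotone_equalBlock n _)
    (h.rieszControl hf) (h.rieszControl hf.swap) (l := k ^ 200) (τ := 2 * momentOrder k * s)
    (by exact_mod_cast pow_pos hk 200) (by positivity)
    (by rw [h.sq_eq]; nlinarith [(by positivity : 0 ≤ (momentOrder k : ℝ) ^ 2 * s ^ 2)])
    h_gap h.pow_mul_momentConst_div_le_one
  have h_coeff : 3 * (((k ^ 16 : ℕ) : ℝ) * (momentConst k / s)) ^ 2 * (n + 1) ≤ 3 * k ^ 116 := by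
    rw [h.sq_eq, Nat.cast_pow]
    calc 3 * ((k : ℝ) ^ 16 * (momentConst k / s)) ^ 2 * s ^ 2
        = 3 * ((k : ℝ) ^ 16 * momentConst k) ^ 2 := by field_simp
      _ ≤ 3 * ((k : ℝ) ^ 16 * k ^ 42) ^ 2 := by
          gcongr
          exact momentConst_le h.le_k
      _ = _ := by ring
  calc _ ≤ 6 + 2 * (3 / (k : ℝ) ^ 125) + 3 * k ^ 116 * (3 / k ^ 125) := by
        refine h_mainPart.trans ?_
        gcongr <;> exact h.repeatedBound_le
    _ = 6 + 6 / (k : ℝ) ^ 125 + 9 / k ^ 9 := by field_simp; ring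
    _ ≤ 6 + 6 / (k : ℝ) + 9 / k := by
        gcongr <;> exact le_self_pow₀ hk_one (by norm_num)
    _ ≤ 6 + 6 / 100 + 9 / 100 := by gcongr <;> exact h.le_k
    _ ≤ 7 := by norm_num

end LargeParams

section HaarSums

variable {Ω : Type*} [Fintype Ω] {T : Fin 3 → ℕ → Equiv.Perm Ω} {n : ℕ} {f : Scale → Ω → ℝ}

theorem expect_mul_eq_zero_of_ne {r s : Scale} (h : r ≠ s) {g g' : Ω → ℝ} (hg : IsHaar T r g)
    (hg' : IsHaar T s g') : 𝔼 ω, g ω * g' ω = 0 := by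
  obtain ⟨i, hi⟩ := Function.ne_iff.1 h
  exact expect_eq_zero_of_odd _ ((hg i).mul_of_ne (hg' i) hi).odd

variable {H : Scale → Ω → ℝ} {S : Finset Scale} {X : ℝ}

theorem expect_abs_le_of_abs_sum_le [Nonempty Ω] (hf : IsSignFamily T n f)
    (hS : ∀ s ∈ S, ∑ i, s i = n) (hH : ∀ s ∈ S, IsHaar T s (H s))
    (hHf : ∀ s ∈ S, ∀ ω, H s ω * f s ω = |H s ω|) (hX : ∀ ω, |∑ s ∈ S, H s ω| ≤ X)
    {s : Scale} (hs : s ∈ S) : 𝔼 ω, |H s ω| ≤ X := by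
  calc 𝔼 ω, |H s ω| = 𝔼 ω, (∑ r ∈ S, H r ω) * f s ω := by
        simp only [Finset.sum_mul]
        rw [Finset.expect_sum_comm, Finset.sum_eq_single_of_mem s hs fun r hr hrs =>
          expect_mul_eq_zero_of_ne hrs (hH r hr) (hf s (hS s hs)).1]
        simp only [hHf s hs]
    _ ≤ X := Finset.expect_le Finset.univ_nonempty fun ω _ => (le_abs_self _).trans <| by
        rw [abs_mul, hf.abs_eq_one (hS s hs), mul_one]
        exact hX ω

theorem sum_expect_abs_le_sq_mul [Nonempty Ω] (hf : IsSignFamily T n f)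
    (hS : ∀ s ∈ S, ∑ i, s i = n) (hH : ∀ s ∈ S, IsHaar T s (H s))
    (hHf : ∀ s ∈ S, ∀ ω, H s ω * f s ω = |H s ω|) (hX : ∀ ω, |∑ s ∈ S, H s ω| ≤ X)
    (hX₀ : 0 ≤ X) : ∑ s ∈ S, 𝔼 ω, |H s ω| ≤ ((n : ℝ) + 1) ^ 2 * X := by
  have h_card : S.card ≤ (n + 1) ^ 2 := by
    simpa [sq] using card_scales_le hS fun s hs =>
      Finset.mem_range_succ_iff.2 (coord_le (hS s hs) 0)
  calc ∑ s ∈ S, 𝔼 ω, |H s ω| ≤ S.card • X :=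
        Finset.sum_le_card_nsmul _ _ X fun s hs => expect_abs_le_of_abs_sum_le hf hS hH hHf hX hs
    _ ≤ ((n : ℝ) + 1) ^ 2 * X := by
        rw [nsmul_eq_mul]
        gcongr
        exact_mod_cast h_card

theorem sum_expect_abs_le_of_pow_le [Nonempty Ω] {k : ℕ} (hk : 100 ≤ k) (hn : k ^ 1000 ≤ n + 1)
    (hf : IsSignFamily T n f) (hS : ∀ s ∈ S, ∑ i, s i = n) (hH : ∀ s ∈ S, IsHaar T s (H s))
    (hHf : ∀ s ∈ S, ∀ ω, H s ω * f s ω = |H s ω|) (hX : ∀ ω, |∑ s ∈ S, H s ω| ≤ X)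
    (hX₀ : 0 ≤ X) : ∑ s ∈ S, 𝔼 ω, |H s ω| ≤ 14 * ((n : ℝ) + 1) * X / k := by
  have hk_pos : 0 < k := by omega
  have h_test := mul_sum_expect_abs_le hf (monotone_equalBlock n (k ^ 16))
    (fun a ha => equalBlock_lt (pow_pos hk_pos 16) ha) hS hH hHf hX hX₀
    ((largeParams_sqrt hk hn).expect_abs_mainPart_le hf)
  rw [div_mul_eq_mul_div, div_le_iff₀ (by positivity)] at h_test
  rw [le_div_iff₀ (by exact_mod_cast hk_pos)]
  linarith

theorem sum_expect_abs_le_rpow [Nonempty Ω] (hf : IsSignFamily T n f)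
    (hS : ∀ s ∈ S, ∑ i, s i = n) (hH : ∀ s ∈ S, IsHaar T s (H s))
    (hHf : ∀ s ∈ S, ∀ ω, H s ω * f s ω = |H s ω|) (hX : ∀ ω, |∑ s ∈ S, H s ω| ≤ X) :
    ∑ s ∈ S, 𝔼 ω, |H s ω| ≤ 100 ^ 1001 * ((n : ℝ) + 1) ^ (1 - 1 / 1000 : ℝ) * X := by
  have hX₀ : 0 ≤ X := (abs_nonneg _).trans (hX (Classical.arbitrary Ω))
  set N : ℝ := (n : ℝ) + 1 with hN_def
  have hN : 0 < N := by positivity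
  set z : ℝ := N ^ (1 / 1000 : ℝ) with hz_def
  have hz : 0 < z := Real.rpow_pos_of_pos hN _
  have hz_pow : z ^ 1000 = N := by
    rw [hz_def, one_div]
    exact_mod_cast Real.rpow_inv_natCast_pow hN.le (n := 1000) (by norm_num)
  rw [Real.rpow_sub hN, Real.rpow_one, ← hz_def]
  rcases lt_or_ge z 100 with hz_lt | hz_ge
  · refine (sum_expect_abs_le_sq_mul hf hS hH hHf hX hX₀).trans ?_
    refine mul_le_mul_of_nonneg_right ?_ hX₀
    calc N ^ 2 = z ^ 1001 * (N / z) := by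
          rw [pow_succ z, hz_pow]
          field_simp
      _ ≤ 100 ^ 1001 * (N / z) := by gcongr
  · set k := ⌊z⌋₊
    have hk : 100 ≤ k := Nat.le_floor (by exact_mod_cast hz_ge)
    have hkn : k ^ 1000 ≤ n + 1 := by
      have : (k : ℝ) ^ 1000 ≤ N := hz_pow ▸ pow_le_pow_left₀ (by positivity) (Nat.floor_le hz.le) _
      rw [hN_def] at this
      exact_mod_cast this
    have hk_one : (1 : ℝ) ≤ k := by exact_mod_cast hk.trans' (by norm_num)
    have hzk : z ≤ 2 * k := by linarith [Nat.lt_floor_add_one z, hk_one]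
    have h_const : (28 : ℝ) ≤ 100 ^ 1001 :=
      (by norm_num : (28 : ℝ) ≤ 100).trans (le_self_pow₀ (by norm_num) (by norm_num))
    calc ∑ s ∈ S, 𝔼 ω, |H s ω| ≤ 14 * N * X / k :=
          sum_expect_abs_le_of_pow_le hk hkn hf hS hH hHf hX hX₀
      _ = 28 * N * X / (2 * k) := by field_simp; ring
      _ ≤ 28 * N * X / z := by gcongr
      _ = 28 * (N / z) * X := by ring
      _ ≤ _ := by gcongr

end HaarSums

end Parameters

section BinaryDigits

/-- The digit `k` of an `N`-digit binary number, flipped. As everywhere below, digits are indexed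
from the most significant one. -/
def digitFlip (N k : ℕ) (u : Fin (2 ^ N)) : Fin (2 ^ N) :=
  if h : k < N then
    ⟨u ^^^ 2 ^ (N - 1 - k), Nat.xor_lt_two_pow u.2 (Nat.pow_lt_pow_right one_lt_two (by omega))⟩
  else u

theorem digitFlip_involutive (N k : ℕ) : Function.Involutive (digitFlip N k) := by
  intro u
  unfold digitFlip
  split_ifs
  · ext
    simp
  · rfl

theorem digitFlip_div {N k r : ℕ} (hr : r ≤ k) (u : Fin (2 ^ N)) :
    (digitFlip N k u : ℕ) / 2 ^ (N - r) = u / 2 ^ (N - r) := by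
  unfold digitFlip
  split_ifs
  · have h_low : 2 ^ (N - 1 - k) < 2 ^ (N - r) := Nat.pow_lt_pow_right one_lt_two (by omega)
    rw [← Nat.shiftRight_eq_div_pow, ← Nat.shiftRight_eq_div_pow, Nat.shiftRight_xor_distrib,
      Nat.shiftRight_eq_div_pow (2 ^ (N - 1 - k)), Nat.div_eq_of_lt h_low, Nat.xor_zero]
  · rfl

/-- The binary digit `r` of an `N`-digit number, as a sign: the value at this number of the Haar
functions of intervals of length `2 ^ (-r)`. -/
def digitSign (N r : ℕ) (u : Fin (2 ^ N)) : ℝ := if u.1.testBit (N - 1 - r) then 1 else -1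

theorem digitSign_sq (N r : ℕ) (u : Fin (2 ^ N)) : digitSign N r u ^ 2 = 1 := by
  unfold digitSign
  split_ifs <;> norm_num

theorem digitSign_digitFlip {N k r : ℕ} (hr : r < k) (u : Fin (2 ^ N)) :
    digitSign N r (digitFlip N k u) = digitSign N r u := by
  unfold digitSign digitFlip
  split_ifs <;> simp_all [Nat.testBit_xor, Nat.testBit_two_pow] <;> omega

theorem digitSign_digitFlip_self {N r : ℕ} (hr : r < N) (u : Fin (2 ^ N)) :
    digitSign N r (digitFlip N r u) = -digitSign N r u := by
  unfold digitSign digitFlip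
  rw [dif_pos hr]
  cases h : u.1.testBit (N - 1 - r) <;> simp [Nat.testBit_xor, h]

theorem card_filter_div_eq {N r p : ℕ} (hr : r ≤ N) (hp : p < 2 ^ r) :
    (Finset.univ.filter fun u : Fin (2 ^ N) => (u : ℕ) / 2 ^ (N - r) = p).card =
      2 ^ (N - r) := by
  have h_lt : ∀ v ∈ Finset.Ico (p * 2 ^ (N - r)) ((p + 1) * 2 ^ (N - r)), v < 2 ^ N := fun v hv =>
    calc v < (p + 1) * 2 ^ (N - r) := (Finset.mem_Ico.1 hv).2
      _ ≤ 2 ^ r * 2 ^ (N - r) := Nat.mul_le_mul_right _ hp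
      _ = 2 ^ N := by rw [← pow_add, Nat.add_sub_cancel' hr]
  have h_eq : (Finset.univ.filter fun u : Fin (2 ^ N) => (u : ℕ) / 2 ^ (N - r) = p) =
      (Finset.Ico (p * 2 ^ (N - r)) ((p + 1) * 2 ^ (N - r))).attachFin h_lt := by
    ext u
    rw [Finset.mem_filter_univ, Finset.mem_attachFin, Finset.mem_Ico,
      ← Nat.le_div_iff_mul_le (by positivity), ← Nat.div_lt_iff_lt_mul (by positivity)]
    omega
  rw [h_eq, Finset.card_attachFin, Nat.card_Ico, add_one_mul, Nat.add_sub_cancel_left]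

end BinaryDigits

namespace DyadicInterval

theorem mem_toSet_iff_floor {r : ℕ} {p : ℤ} {x : ℝ} :
    x ∈ (DyadicInterval.mk (-(r : ℤ)) p).toSet ↔ ⌊x * 2 ^ r⌋ = p := by
  rw [toSet, Set.mem_Ico, Int.floor_eq_iff, zpow_neg, zpow_natCast, ← div_eq_mul_inv,
    ← div_eq_mul_inv, div_le_iff₀ (by positivity), lt_div_iff₀ (by positivity)]

theorem mem_toSet_iff_div_eq {N r u : ℕ} (hr : r ≤ N) {x : ℝ}
    (hx : x ∈ (DyadicInterval.mk (-(N : ℤ)) u).toSet) (p : ℤ) :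
    x ∈ (DyadicInterval.mk (-(r : ℤ)) p).toSet ↔ ((u / 2 ^ (N - r) : ℕ) : ℤ) = p := by
  have h_floor : ⌊x * 2 ^ r⌋ = ((u / 2 ^ (N - r) : ℕ) : ℤ) := by
    rw [Int.natCast_div, ← mem_toSet_iff_floor.1 hx,
      ← Int.mul_natCast_floor_div_cancel (n := 2 ^ (N - r)) (by positivity) (x * 2 ^ r)]
    rw [Nat.cast_pow, Nat.cast_ofNat, mul_assoc, ← pow_add, Nat.add_sub_cancel' hr]
  rw [mem_toSet_iff_floor, h_floor]

theorem haar_eq_digitSign {N r : ℕ} (hr : r < N) (u : Fin (2 ^ N)) {x : ℝ}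
    (hx : x ∈ (DyadicInterval.mk (-(N : ℤ)) (u : ℕ)).toSet) (p : ℤ) :
    (DyadicInterval.mk (-(r : ℤ)) p).haar x =
      if ((u / 2 ^ (N - r) : ℕ) : ℤ) = p then digitSign N r u else 0 := by
  classical
  have h_scale : -(r : ℤ) - 1 = -((r + 1 : ℕ) : ℤ) := by push_cast; ring
  have h_succ : N - r = N - (r + 1) + 1 := by omega
  have h_index : N - 1 - r = N - (r + 1) := by omega
  simp only [haar, left, right, h_scale, Set.indicator_apply, mem_toSet_iff_div_eq hr hx,
    Pi.one_apply]
  rw [h_succ, pow_succ, ← Nat.div_div_eq_div_mul, digitSign, Nat.testBit_eq_decide_div_mod_eq,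
    h_index]
  generalize u.1 / 2 ^ (N - (r + 1)) = v
  simp only [decide_eq_true_eq]
  split_ifs <;> first | omega | norm_num

theorem abs_haar_le (I : DyadicInterval) (x : ℝ) : |I.haar x| ≤ 2 := by
  have h_indicator : ∀ s : Set ℝ, |s.indicator (1 : ℝ → ℝ) x| ≤ 1 := by
    intro s
    by_cases hx : x ∈ s <;> simp [hx]
  rw [haar]
  refine (abs_add_le _ _).trans ?_
  rw [abs_neg]
  linarith [h_indicator I.left.toSet, h_indicator I.right.toSet]

theorem toSet_nonempty (I : DyadicInterval) : I.toSet.Nonempty := by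
  rw [toSet, Set.nonempty_Ico]
  gcongr
  linarith

theorem scale_nonpos {I : DyadicInterval} (hI : I.toSet ⊆ Set.Icc 0 1) : I.scale ≤ 0 := by
  obtain ⟨h_pos, h_le⟩ := DyadicRectangle.side_bounds hI
  have h_pos : (0 : ℝ) ≤ I.pos := by exact_mod_cast h_pos
  have h_length : (2 : ℝ) ^ I.scale ≤ 2 ^ (0 : ℤ) := by
    rw [zpow_zero]
    nlinarith [(by positivity : (0 : ℝ) < 2 ^ I.scale)]
  exact (zpow_le_zpow_iff_right₀ one_lt_two).1 h_length

end DyadicInterval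

namespace DyadicRectangle

variable {d : ℕ}

section Cells

variable {N : ℕ}

/-- The cell of index `u` of the grid of mesh `2 ^ (-N)`. -/
def cell (N : ℕ) (u : Fin d → Fin (2 ^ N)) : DyadicRectangle d := fun i => ⟨-(N : ℤ), (u i : ℕ)⟩

/-- The dyadic rectangle with side lengths `2 ^ (-r i)` containing the cell of index `u`. -/
def cellRect (N : ℕ) (r : Fin d → ℕ) (u : Fin d → Fin (2 ^ N)) : DyadicRectangle d :=
  fun i => ⟨-(r i : ℤ), (u i / 2 ^ (N - r i) : ℕ)⟩

/-- The flip of digit `k` of coordinate `i` of a cell. -/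
def cellFlip (N : ℕ) (i : Fin d) (k : ℕ) : Equiv.Perm (Fin d → Fin (2 ^ N)) :=
  Function.Involutive.toPerm (fun u => Function.update u i (digitFlip N k (u i))) fun u => by
    simp [digitFlip_involutive N k (u i)]

theorem cellFlip_apply (i : Fin d) (k : ℕ) (u : Fin d → Fin (2 ^ N)) :
    cellFlip N i k u = Function.update u i (digitFlip N k (u i)) := rfl

theorem cellRect_cellFlip {r : Fin d → ℕ} {i : Fin d} {k : ℕ} (h : r i ≤ k)
    (u : Fin d → Fin (2 ^ N)) : cellRect N r (cellFlip N i k u) = cellRect N r u := by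
  ext j
  · rfl
  · rw [cellRect, cellRect, cellFlip_apply]
    obtain rfl | hj := eq_or_ne j i
    · rw [Function.update_self, digitFlip_div h]
    · rw [Function.update_of_ne hj]

theorem prod_digitSign_update (r : Fin d → ℕ) (i : Fin d) (u : Fin d → Fin (2 ^ N))
    {v : Fin (2 ^ N)} {c : ℝ} (h : digitSign N (r i) v = c * digitSign N (r i) (u i)) :
    ∏ j, digitSign N (r j) (Function.update u i v j) = c * ∏ j, digitSign N (r j) (u j) := by
  rw [← Finset.mul_prod_erase _ _ (Finset.mem_univ i),
    ← Finset.mul_prod_erase _ (fun j => digitSign N (r j) (u j)) (Finset.mem_univ i),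
    Function.update_self, h, mul_assoc]
  congr 2
  refine Finset.prod_congr rfl fun j hj => ?_
  rw [Function.update_of_ne (Finset.ne_of_mem_erase hj)]

theorem prod_digitSign_sq (r : Fin d → ℕ) (u : Fin d → Fin (2 ^ N)) :
    (∏ i, digitSign N (r i) (u i)) ^ 2 = 1 := by
  rw [← Finset.prod_pow]
  simp only [digitSign_sq, Finset.prod_const_one]

/-- The value on the cell of index `u` of the sum of `α R * R.haar` over the rectangles `R` of
side lengths `2 ^ (-r i)`. -/
def cellHaar (N : ℕ) (α : DyadicRectangle d → ℝ) (r : Fin d → ℕ) (u : Fin d → Fin (2 ^ N)) : ℝ :=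
  α (cellRect N r u) * ∏ i, digitSign N (r i) (u i)

theorem isHaarAt_cellHaar (α : DyadicRectangle d → ℝ) {r : Fin d → ℕ} {i : Fin d}
    (hr : r i < N) : IsHaarAt (cellFlip N i) (r i) (cellHaar N α r) where
  odd u := by
    rw [cellHaar, cellHaar, cellRect_cellFlip le_rfl, cellFlip_apply,
      prod_digitSign_update (c := -1) r i u (by rw [digitSign_digitFlip_self hr, neg_one_mul])]
    ring
  inv k hk u := by
    rw [cellHaar, cellHaar, cellRect_cellFlip hk.le, cellFlip_apply,
      prod_digitSign_update (c := 1) r i u (by rw [digitSign_digitFlip hk, one_mul]), one_mul]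

theorem abs_cellHaar (α : DyadicRectangle d → ℝ) (r : Fin d → ℕ) (u : Fin d → Fin (2 ^ N)) :
    |cellHaar N α r u| = |α (cellRect N r u)| := by
  rw [cellHaar, abs_mul, (pow_eq_one_iff_of_nonneg (abs_nonneg _) two_ne_zero).1
    ((sq_abs _).trans (prod_digitSign_sq r u)), mul_one]

theorem isSignFamily_cellHaar {n : ℕ} (hN : n < N) {ε : DyadicRectangle 3 → ℝ}
    (hε : ∀ R, ε R ^ 2 = 1) : IsSignFamily (cellFlip N) n (cellHaar N ε) := fun r hr =>
  ⟨fun i => isHaarAt_cellHaar ε ((coord_le hr i).trans_lt hN), fun u => by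
    rw [cellHaar, mul_pow, hε, prod_digitSign_sq, one_mul]⟩

end Cells

section Hyperbolic

variable {n N : ℕ} {r : Fin d → ℕ} {R : DyadicRectangle d}

/-- The scales of a rectangle contained in the unit cube: its side lengths are
`2 ^ (-scales R i)`. Sides longer than `1` get the junk value `0`. -/
def scales (R : DyadicRectangle d) (i : Fin d) : ℕ := (-(R i).scale).toNat

theorem scales_cellRect (r : Fin d → ℕ) (u : Fin d → Fin (2 ^ N)) :
    scales (cellRect N r u) = r := by
  ext i
  simp [scales, cellRect]

theorem vol_eq_zpow (R : DyadicRectangle d) : R.vol = (2 : ℝ) ^ (∑ i, (R i).scale) := by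
  simp only [vol, DyadicInterval.length]
  refine Finset.induction_on Finset.univ (by simp) fun i s hi ih => ?_
  rw [Finset.prod_insert hi, Finset.sum_insert hi, zpow_add₀ two_ne_zero, ih]

theorem cellRect_mem_hyperbolic (hN : n ≤ N) (hr : ∑ i, r i = n) (u : Fin d → Fin (2 ^ N)) :
    cellRect N r u ∈ hyperbolic d n := by
  rw [hyperbolic, Set.Finite.mem_toFinset]
  constructor
  · rw [toSet, ← Set.pi_univ_Icc]
    refine Set.pi_mono fun i _ x hx => ?_
    obtain ⟨h_left, h_right⟩ := hx
    simp only [cellRect] at h_left h_right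
    refine ⟨h_left.trans' (by positivity), h_right.le.trans ?_⟩
    rw [zpow_neg, zpow_natCast, ← div_eq_mul_inv, Pi.one_apply, div_le_one (by positivity)]
    have h_lt : (u i : ℕ) / 2 ^ (N - r i) < 2 ^ r i := by
      rw [Nat.div_lt_iff_lt_mul (by positivity), ← pow_add,
        Nat.add_sub_cancel' ((coord_le hr i).trans hN)]
      exact (u i).2
    exact_mod_cast h_lt
  · rw [vol_eq_zpow]
    simp only [cellRect, Finset.sum_neg_distrib, ← hr, Nat.cast_sum]

theorem toSet_side_subset (hR : R.toSet ⊆ Set.Icc 0 1) (i : Fin d) :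
    (R i).toSet ⊆ Set.Icc 0 1 := by
  rw [toSet, ← Set.pi_univ_Icc, Set.pi_subset_pi_iff] at hR
  exact hR.resolve_right (Set.univ_pi_nonempty_iff.2 fun j => (R j).toSet_nonempty).ne_empty
    i (Set.mem_univ i)

theorem scale_eq_neg_scales (hR : R ∈ hyperbolic d n) (i : Fin d) :
    (R i).scale = -(scales R i : ℤ) := by
  have h_nonpos := DyadicInterval.scale_nonpos
    (toSet_side_subset ((Set.Finite.mem_toFinset _).1 hR).1 i)
  rw [scales, Int.toNat_of_nonneg (neg_nonneg.2 h_nonpos), neg_neg]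

theorem sum_scales (hR : R ∈ hyperbolic d n) : ∑ i, scales R i = n := by
  have h_vol := ((Set.Finite.mem_toFinset _).1 hR).2
  rw [vol_eq_zpow] at h_vol
  have h_sum := zpow_right_injective₀ two_pos (by norm_num) h_vol
  simp only [scale_eq_neg_scales hR, Finset.sum_neg_distrib, neg_inj] at h_sum
  exact_mod_cast h_sum

theorem exists_pos_of_mem_hyperbolic (hR : R ∈ hyperbolic d n) :
    ∃ p : Fin d → ℕ, (∀ i, p i < 2 ^ scales R i) ∧ R = fun i => ⟨-(scales R i : ℤ), p i⟩ := by
  have h_side := fun i => side_bounds (toSet_side_subset ((Set.Finite.mem_toFinset _).1 hR).1 i)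
  refine ⟨fun i => (R i).pos.toNat, fun i => ?_, funext fun i =>
    DyadicInterval.ext (scale_eq_neg_scales hR i) (Int.toNat_of_nonneg (h_side i).1).symm⟩
  obtain ⟨h_pos, h_le⟩ := h_side i
  rw [scale_eq_neg_scales hR i, zpow_neg, zpow_natCast, ← div_eq_mul_inv,
    div_le_one (by positivity)] at h_le
  rw [Int.toNat_lt h_pos]
  exact_mod_cast h_le

theorem sum_hyperbolic_eq_sum_scales (g : DyadicRectangle d → ℝ) :
    ∑ R ∈ hyperbolic d n, g R = ∑ r ∈ Finset.Nat.antidiagonalTuple d n,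
      ∑ R ∈ hyperbolic d n with scales R = r, g R :=
  (Finset.sum_fiberwise_of_maps_to (fun _ hR =>
    Finset.Nat.mem_antidiagonalTuple.2 (sum_scales hR)) g).symm

theorem sum_haar_scales_eq_cellHaar (hN : n < N) (α : DyadicRectangle d → ℝ)
    {u : Fin d → Fin (2 ^ N)} {x : Fin d → ℝ} (hx : x ∈ (cell N u).toSet) (hr : ∑ i, r i = n) :
    ∑ R ∈ hyperbolic d n with scales R = r, α R * R.haar x = cellHaar N α r u := by
  have h_side : ∀ i (p : ℤ), (DyadicInterval.mk (-(r i : ℤ)) p).haar (x i) =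
      if ((u i / 2 ^ (N - r i) : ℕ) : ℤ) = p then digitSign N (r i) (u i) else 0 := fun i p =>
    DyadicInterval.haar_eq_digitSign ((coord_le hr i).trans_lt hN) (u i) (hx i (Set.mem_univ i)) p
  rw [Finset.sum_eq_single_of_mem (cellRect N r u)]
  · rw [cellHaar, haar]
    congr 1
    refine Finset.prod_congr rfl fun i _ => ?_
    rw [cellRect, h_side, if_pos rfl]
  · exact Finset.mem_filter.2 ⟨cellRect_mem_hyperbolic hN.le hr u, scales_cellRect r u⟩
  · intro R hR h_ne
    obtain ⟨h_mem, rfl⟩ := Finset.mem_filter.1 hR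
    obtain ⟨i, hi⟩ := Function.ne_iff.1 h_ne
    have h_scale := scale_eq_neg_scales h_mem i
    have h_zero : (R i).haar (x i) = 0 := by
      rw [show R i = ⟨-(scales R i : ℤ), (R i).pos⟩ from DyadicInterval.ext h_scale rfl, h_side,
        if_neg]
      exact fun h => hi (DyadicInterval.ext h_scale h.symm)
    rw [haar, Finset.prod_eq_zero (Finset.mem_univ i) h_zero, mul_zero]

theorem hyperbolicHaarSum_eq_of_mem_cell (hN : n < N) (α : DyadicRectangle d → ℝ)
    {u : Fin d → Fin (2 ^ N)} {x : Fin d → ℝ} (hx : x ∈ (cell N u).toSet) :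
    hyperbolicHaarSum n α x = ∑ r ∈ Finset.Nat.antidiagonalTuple d n, cellHaar N α r u := by
  rw [hyperbolicHaarSum, sum_hyperbolic_eq_sum_scales]
  exact Finset.sum_congr rfl fun r hr =>
    sum_haar_scales_eq_cellHaar hN α hx (Finset.Nat.mem_antidiagonalTuple.1 hr)

theorem card_filter_cellRect_eq [DecidableEq (DyadicRectangle d)] (hN : n ≤ N)
    (hR : R ∈ hyperbolic d n) :
    2 ^ n * (Finset.univ.filter fun u : Fin d → Fin (2 ^ N) =>
      cellRect N (scales R) u = R).card = (2 ^ N) ^ d := by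
  obtain ⟨p, hp, h_eq⟩ := exists_pos_of_mem_hyperbolic hR
  have h_le : ∀ i, scales R i ≤ N := fun i => (coord_le (sum_scales hR) i).trans hN
  have h_filter : (Finset.univ.filter fun u : Fin d → Fin (2 ^ N) =>
      cellRect N (scales R) u = R) = Fintype.piFinset fun i =>
        Finset.univ.filter fun v : Fin (2 ^ N) => (v : ℕ) / 2 ^ (N - scales R i) = p i := by
    ext u
    simp only [Finset.mem_filter_univ, Fintype.mem_piFinset, funext_iff]
    refine forall_congr' fun i => ?_
    rw [cellRect, congrFun h_eq i, DyadicInterval.ext_iff, Nat.cast_inj, eq_self, true_and]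
  calc _ = (∏ i, 2 ^ scales R i) * ∏ i, 2 ^ (N - scales R i) := by
        rw [h_filter, Fintype.card_piFinset, Finset.prod_pow_eq_pow_sum, sum_scales hR]
        simp only [card_filter_div_eq (h_le _) (hp _)]
    _ = ∏ _i : Fin d, 2 ^ N := by
        rw [← Finset.prod_mul_distrib]
        simp only [← pow_add, Nat.add_sub_cancel' (h_le _)]
    _ = _ := by rw [Finset.prod_const, Finset.card_univ, Fintype.card_fin]

theorem expect_cellRect_eq (hN : n ≤ N) (hr : ∑ i, r i = n) (g : DyadicRectangle d → ℝ) :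
    𝔼 u, g (cellRect N r u) =
      2 ^ (-(n : ℤ)) * ∑ R ∈ hyperbolic d n with scales R = r, g R := by
  classical
  have h_fiber : ∀ R ∈ (hyperbolic d n).filter fun R => scales R = r,
      ∑ u with cellRect N r u = R, g (cellRect N r u) = (2 ^ N) ^ d / 2 ^ n * g R := by
    intro R hR
    obtain ⟨h_mem, rfl⟩ := Finset.mem_filter.1 hR
    have h_card : (2 : ℝ) ^ n * (Finset.univ.filter fun u : Fin d → Fin (2 ^ N) =>
        cellRect N (scales R) u = R).card = (2 ^ N) ^ d := by
      exact_mod_cast card_filter_cellRect_eq hN h_mem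
    rw [Finset.sum_congr rfl fun u hu => congrArg g (Finset.mem_filter.1 hu).2, Finset.sum_const,
      nsmul_eq_mul, ← h_card, mul_div_cancel_left₀ _ (by positivity)]
  rw [Fintype.expect_eq_sum_div_card, ← Finset.sum_fiberwise_of_maps_to
      (t := (hyperbolic d n).filter fun R => scales R = r) (fun u _ => Finset.mem_filter.2
        ⟨cellRect_mem_hyperbolic hN hr u, scales_cellRect r u⟩),
    Finset.sum_congr rfl h_fiber, ← Finset.mul_sum]
  simp only [Fintype.card_pi, Fintype.card_fin, Finset.prod_const, Finset.card_univ]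
  push_cast
  rw [zpow_neg, zpow_natCast]
  field_simp

theorem sum_abs_eq_sum_expect (hN : n ≤ N) (α : DyadicRectangle d → ℝ) :
    (2 : ℝ) ^ (-(n : ℤ)) * ∑ R ∈ hyperbolic d n, |α R| =
      ∑ r ∈ Finset.Nat.antidiagonalTuple d n, 𝔼 u, |cellHaar N α r u| := by
  rw [sum_hyperbolic_eq_sum_scales, Finset.mul_sum]
  refine Finset.sum_congr rfl fun r hr => ?_
  simp only [abs_cellHaar]
  exact (expect_cellRect_eq hN (Finset.Nat.mem_antidiagonalTuple.1 hr) fun R => |α R|).symm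

end Hyperbolic

section SupNorm

open MeasureTheory

variable {n N : ℕ}

theorem eLpNorm_hyperbolicHaarSum_ne_top (n : ℕ) (α : DyadicRectangle d → ℝ) :
    eLpNorm (hyperbolicHaarSum n α) ∞ volume ≠ ⊤ := by
  rw [eLpNorm_exponent_top]
  refine (eLpNormEssSup_lt_top_of_ae_bound (C := ∑ R ∈ hyperbolic d n, |α R| * 2 ^ d)
    (Filter.Eventually.of_forall fun x => ?_)).ne
  rw [Real.norm_eq_abs, hyperbolicHaarSum]
  refine (Finset.abs_sum_le_sum_abs _ _).trans (Finset.sum_le_sum fun R _ => ?_)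
  rw [abs_mul, haar, Finset.abs_prod]
  gcongr
  calc ∏ i, |(R i).haar (x i)| ≤ ∏ _i : Fin d, (2 : ℝ) :=
        Finset.prod_le_prod (fun _ _ => abs_nonneg _) fun i _ => (R i).abs_haar_le (x i)
    _ = 2 ^ d := by rw [Finset.prod_const, Finset.card_univ, Fintype.card_fin]

theorem volume_toSet_ne_zero (R : DyadicRectangle d) : volume R.toSet ≠ 0 := by
  simp only [toSet, DyadicInterval.toSet]
  rw [Real.volume_pi_Ico]
  refine Finset.prod_ne_zero_iff.2 fun i _ => ?_
  rw [Ne, ENNReal.ofReal_eq_zero, not_le, sub_pos]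
  gcongr
  linarith

theorem abs_sum_cellHaar_le (hN : n < N) (α : DyadicRectangle d → ℝ) (u : Fin d → Fin (2 ^ N)) :
    |∑ r ∈ Finset.Nat.antidiagonalTuple d n, cellHaar N α r u| ≤
      (eLpNorm (hyperbolicHaarSum n α) ∞ volume).toReal := by
  obtain ⟨x, hx, h_le⟩ : ∃ x ∈ (cell N u).toSet, ‖hyperbolicHaarSum n α x‖ₑ ≤
      eLpNormEssSup (hyperbolicHaarSum n α) volume := by
    by_contra! h_lt
    exact volume_toSet_ne_zero (cell N u)
      (measure_mono_null (fun x hx => not_le.2 (h_lt x hx)) ae_le_eLpNormEssSup)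
  rw [← hyperbolicHaarSum_eq_of_mem_cell hN α hx, ← Real.norm_eq_abs, ← toReal_enorm]
  refine ENNReal.toReal_mono (eLpNorm_hyperbolicHaarSum_ne_top n α) ?_
  rwa [eLpNorm_exponent_top]

theorem sum_abs_le_rpow (n : ℕ) (α : DyadicRectangle 3 → ℝ) :
    (2 : ℝ) ^ (-(n : ℤ)) * ∑ R ∈ hyperbolic 3 n, |α R| ≤
      100 ^ 1001 * ((n : ℝ) + 1) ^ (1 - 1 / 1000 : ℝ) *
        (eLpNorm (hyperbolicHaarSum n α) ∞ volume).toReal := by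
  have h_scale : ∀ r ∈ Finset.Nat.antidiagonalTuple 3 n, ∑ i, r i = n := fun r hr =>
    Finset.Nat.mem_antidiagonalTuple.1 hr
  have hN := Nat.lt_succ_self n
  rw [sum_abs_eq_sum_expect hN.le]
  refine sum_expect_abs_le_rpow (T := cellFlip (n + 1))
    (f := cellHaar (n + 1) fun R => if α R < 0 then -1 else 1)
    (isSignFamily_cellHaar hN fun R => by split_ifs <;> norm_num) h_scale
    (fun r hr i => isHaarAt_cellHaar α ((coord_le (h_scale r hr) i).trans_lt hN))
    (fun r _ u => ?_) (abs_sum_cellHaar_le hN α)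
  rw [abs_cellHaar, cellHaar, cellHaar, mul_mul_mul_comm, ← sq, prod_digitSign_sq, mul_one]
  split_ifs with h
  · rw [abs_of_neg h, mul_neg_one]
  · rw [abs_of_nonneg (not_lt.1 h), mul_one]

end SupNorm

end DyadicRectangle

theorem add_one_rpow_le {x a : ℝ} (hx : 1 ≤ x) (ha₀ : 0 ≤ a) (ha₁ : a ≤ 1) :
    (x + 1) ^ a ≤ 2 * x ^ a := by
  calc (x + 1) ^ a ≤ (2 * x) ^ a := by
        gcongr
        linarith
    _ = 2 ^ a * x ^ a := Real.mul_rpow two_pos.le (by positivity)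
    _ ≤ 2 * x ^ a := by
        gcongr
        exact Real.rpow_le_self_of_one_le one_le_two ha₁

theorem theorem1p5 :
    ∃ ε : ℝ, 0 < ε ∧ ∃ K : ℝ, 0 < K ∧
      ∀ n : ℕ, 1 ≤ n → ∀ α : DyadicRectangle 3 → ℝ,
        (2 : ℝ) ^ (-(n : ℤ)) * ∑ R ∈ DyadicRectangle.hyperbolic 3 n, |α R| ≤
          K * (n : ℝ) ^ (1 - ε) *
            (MeasureTheory.eLpNorm (hyperbolicHaarSum n α) ∞ MeasureTheory.volume).toReal := by
  refine ⟨1 / 1000, by norm_num, 100 ^ 1001 * 2, by positivity, fun n hn α => ?_⟩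
  refine (DyadicRectangle.sum_abs_le_rpow n α).trans ?_
  rw [mul_assoc (100 ^ 1001) 2]
  gcongr
  exact add_one_rpow_le (by exact_mod_cast hn) (by norm_num) (by norm_num)
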